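/- All functions are real-valued Lebesgue measurable functions on $(0,\infty)$ with Lebesgue measure, identified when equal almost everywhere. For such $f$ let $\tilde f(x)=\operatorname{ess\,sup}\{|f(y)|:y\ge x\}$ be its least decreasing majorant, and let $\widetilde{L^1}$ be the Banach space of all $f$ with $\|f\|_{\widetilde{L^1}}=\|\tilde f\|_{L^1}<\infty$. For a compatible couple $(X_0,X_1)$ of Banach spaces, let $K(t,x;X_0,X_1)=\inf\{\|x_0\|_{X_0}+t\|x_1\|_{X_1}:x_0\in X_0,\ x_1\in X_1,\ x_0+x_1=x\}$ for $x\in X_0+X_1$ and $t>0$. Write $T:(X_0,X_1)\to(Y_0,Y_1)$ if $T:X_0+X_1\to Y_0+Y_1$ is linear and restricts to a bounded map $X_j\to Y_j$ for $j=0,1$; its norm is the maximum of the norms of these two restrictions. For compatible couples, $[(X_0,X_1),(Y_0,Y_1)]$ is a $c$-uniform relative Calderón–Mityagin pair if, whenever $x\in X_0+X_1$ and $y\in Y_0+Y_1$ satisfy $K(t,y;Y_0,Y_1)\le K(t,x;X_0,X_1)$ for all $t>0$, there is $T:(X_0,X_1)\to(Y_0,Y_1)$ of norm at most $c$ with $Tx=y$.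 It is exact if $c=1$, and $(X_0,X_1)$ is an exact Calderón–Mityagin couple if $[(X_0,X_1),(X_0,X_1)]$ is an exact relative Calderón–Mityagin pair. Call $m\ge 0$ admissible if for each $g\in\widetilde{L^1}+L^\infty$ there is a linear operator $M:(L^1,L^\infty)\to(\widetilde{L^1},L^\infty)$ of norm at most $m$ with $M\tilde g=g$. **Theorem.** The constant $m=4$ is admissible. Let $m$ be any admissible constant. Then: (a) $(\widetilde{L^1},L^\infty)$ is an exact Calderón–Mityagin couple. (b) $[(\widetilde{L^1},L^\infty),(L^1,L^\infty)]$ is an exact relative Calderón–Mityagin pair. (c) $[(L^1,L^\infty),(\widetilde{L^1},L^\infty)]$ is an $m$-uniform relative Calderón–Mityagin pair. (d) $[(L^1,L^\infty),(\widetilde{L^1},L^\infty)]$ is not an exact relative Calderón–Mityagin pair. Moreover, there is $g\in\widetilde{L^1}\cap L^\infty$ such that every $M:(L^1,L^\infty)\to(\widetilde{L^1},L^\infty)$ with $M\tilde g=g$ has norm at least $9/8$. -/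

import Mathlib

open MeasureTheory Filter Topology Set
open scoped ENNReal NNReal

namespace CalderonMityagin

noncomputable section

/-! ### Compatible couples of Banach spaces, the `K`-functional, operators between couples -/

/-- A Banach space contained in the real vector space `V` as a linear subspace. It is given by an
extended norm on `V`: the underlying subspace is `{x | nrm x < ∞}`, and it is complete. -/
structure BanachSubspace (V : Type*) [AddCommGroup V] [Module ℝ V] where
  /-- the norm, with value `∞` off the space -/
  nrm : V → ℝ≥0∞
  eq_zero_of_nrm : ∀ x, nrm x = 0 → x = 0
  nrm_add_le : ∀ x y, nrm (x + y) ≤ nrm x + nrm y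
  nrm_smul : ∀ (a : ℝ) (x : V), nrm (a • x) = ‖a‖ₑ * nrm x
  complete : ∀ u : ℕ → V, (∀ n, nrm (u n) < ∞) →
    (∀ ε : ℝ≥0∞, 0 < ε → ∃ N, ∀ m ≥ N, ∀ n ≥ N, nrm (u m - u n) ≤ ε) →
    ∃ x, nrm x < ∞ ∧ Tendsto (fun n => nrm (u n - x)) atTop (𝓝 0)

/-- The underlying linear subspace. -/
def BanachSubspace.carrier {V : Type*} [AddCommGroup V] [Module ℝ V] (X : BanachSubspace V) :
    Submodule ℝ V where
  carrier := {x | X.nrm x < ∞}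
  zero_mem' := by
    have h := X.nrm_smul 0 0
    simp only [zero_smul, enorm_zero, zero_mul] at h
    simp [h]
  add_mem' := fun {x y} hx hy =>
    (X.nrm_add_le x y).trans_lt (ENNReal.add_lt_top.2 ⟨hx, hy⟩)
  smul_mem' := fun a x hx => by
    have hx' : X.nrm x < ∞ := hx
    show X.nrm (a • x) < ∞
    rw [X.nrm_smul]
    exact ENNReal.mul_lt_top enorm_lt_top hx'

/-- `K(t, x; X₀, X₁) = inf {‖x₀‖ + t ‖x₁‖ : x₀ ∈ X₀, x₁ ∈ X₁, x₀ + x₁ = x}`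
(decompositions with `x₀ ∉ X₀` or `x₁ ∉ X₁` would contribute the value `∞`, for `t > 0`). -/
def Kfun {V : Type*} [AddCommGroup V] [Module ℝ V] (X₀ X₁ : BanachSubspace V) (t : ℝ≥0) (x : V) :
    ℝ≥0∞ :=
  ⨅ (x₀ : V) (x₁ : V) (_ : x₀ ∈ X₀.carrier) (_ : x₁ ∈ X₁.carrier) (_ : x₀ + x₁ = x),
    X₀.nrm x₀ + t * X₁.nrm x₁

/-- A compatible couple of Banach spaces inside the vector space `V`. That `X₀` and `X₁` embed
continuously into a common Hausdorff topological vector space is expressed by saying that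
`X₀ + X₁`, with the seminorm `K(1, ·; X₀, X₁)`, is such a space. -/
structure BanachCouple (V : Type*) [AddCommGroup V] [Module ℝ V] where
  X₀ : BanachSubspace V
  X₁ : BanachSubspace V
  hausdorff : ∀ x, Kfun X₀ X₁ 1 x = 0 → x = 0

section Couples

variable {V W : Type*} [AddCommGroup V] [Module ℝ V] [AddCommGroup W] [Module ℝ W]

/-- The sum `X₀ + X₁`. -/
def BanachCouple.sum (X : BanachCouple V) : Submodule ℝ V := X.X₀.carrier ⊔ X.X₁.carrier

/-- The `K`-functional of the couple. -/
def BanachCouple.K (X : BanachCouple V) (t : ℝ≥0) (x : V) : ℝ≥0∞ := Kfun X.X₀ X.X₁ t x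

/-- `x ∈ X₀` as an element of `X₀ + X₁`. -/
def BanachCouple.incl₀ (X : BanachCouple V) (x : X.X₀.carrier) : X.sum :=
  ⟨x, Submodule.mem_sup_left x.2⟩

/-- `x ∈ X₁` as an element of `X₀ + X₁`. -/
def BanachCouple.incl₁ (X : BanachCouple V) (x : X.X₁.carrier) : X.sum :=
  ⟨x, Submodule.mem_sup_right x.2⟩

/-- `T : (X₀, X₁) → (Y₀, Y₁)`: a linear operator `T : X₀ + X₁ → Y₀ + Y₁` whose restriction to
`X_j` is a bounded map into `Y_j`, `j = 0, 1`. -/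
structure CoupleMap (X : BanachCouple V) (Y : BanachCouple W) where
  toLin : X.sum →ₗ[ℝ] Y.sum
  bounded₀ : ∃ C : ℝ≥0, ∀ x : X.X₀.carrier, Y.X₀.nrm (toLin (X.incl₀ x)) ≤ C * X.X₀.nrm x
  bounded₁ : ∃ C : ℝ≥0, ∀ x : X.X₁.carrier, Y.X₁.nrm (toLin (X.incl₁ x)) ≤ C * X.X₁.nrm x

/-- The norm of `T : (X₀, X₁) → (Y₀, Y₁)`: the maximum of the operator norms of `T : X₀ → Y₀` and
`T : X₁ → Y₁` (with `0 / 0 = 0` in the quotients). -/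
def CoupleMap.norm {X : BanachCouple V} {Y : BanachCouple W} (T : CoupleMap X Y) : ℝ≥0∞ :=
  max (⨆ x : X.X₀.carrier, Y.X₀.nrm (T.toLin (X.incl₀ x)) / X.X₀.nrm x)
    (⨆ x : X.X₁.carrier, Y.X₁.nrm (T.toLin (X.incl₁ x)) / X.X₁.nrm x)

/-- `[(X₀, X₁), (Y₀, Y₁)]` is a `c`-uniform relative Calderón–Mityagin pair. -/
def IsUniformRelativePair (c : ℝ≥0) (X : BanachCouple V) (Y : BanachCouple W) : Prop :=
  ∀ (x : X.sum) (y : Y.sum), (∀ t : ℝ≥0, 0 < t → Y.K t y ≤ X.K t x) →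
    ∃ T : CoupleMap X Y, T.norm ≤ c ∧ T.toLin x = y

/-- An exact relative Calderón–Mityagin pair. -/
def IsExactRelativePair (X : BanachCouple V) (Y : BanachCouple W) : Prop :=
  IsUniformRelativePair 1 X Y

/-- An exact Calderón–Mityagin couple. -/
def IsExactCouple (X : BanachCouple V) : Prop := IsExactRelativePair X X

end Couples

/-! ### The spaces `L¹`, `L^∞` and `L̃¹` on the half line -/

/-- Lebesgue measure on `(0, ∞)`. -/
abbrev halfLine : Measure ℝ := volume.restrict (Ioi 0)

/-- Real-valued Lebesgue measurable functions on `(0, ∞)`, modulo equality almost everywhere. -/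
abbrev L0 : Type := ℝ →ₘ[halfLine] ℝ

theorem nrm_sub_congr (p : ℝ≥0∞) (f g : L0) :
    eLpNorm (f - g : L0) p halfLine = eLpNorm (⇑f - ⇑g) p halfLine :=
  eLpNorm_congr_ae (AEEqFun.coeFn_sub f g)

/-- The Lebesgue space `L^p` on `(0, ∞)`, `1 ≤ p ≤ ∞`. -/
def lebesgue (p : ℝ≥0∞) [hp : Fact (1 ≤ p)] : BanachSubspace L0 where
  nrm f := eLpNorm f p halfLine
  eq_zero_of_nrm f hf := by
    have hp0 : p ≠ 0 := (zero_lt_one.trans_le hp.out).ne'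
    rw [eLpNorm_eq_zero_iff f.aestronglyMeasurable hp0] at hf
    exact AEEqFun.ext (hf.trans AEEqFun.coeFn_zero.symm)
  nrm_add_le f g := by
    rw [eLpNorm_congr_ae (AEEqFun.coeFn_add f g)]
    exact eLpNorm_add_le f.aestronglyMeasurable g.aestronglyMeasurable hp.out
  nrm_smul a f := by
    rw [eLpNorm_congr_ae (AEEqFun.coeFn_smul a f)]
    exact eLpNorm_const_smul a _ p _
  complete u hu hc := by
    let v : ℕ → Lp ℝ p halfLine := fun n => ⟨u n, hu n⟩
    have hv : CauchySeq v := by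
      rw [EMetric.cauchySeq_iff]
      intro ε hε
      obtain ⟨δ, hδ0, hδ⟩ := exists_between hε
      obtain ⟨N, hN⟩ := hc δ hδ0
      refine ⟨N, fun m hm n hn => ?_⟩
      rw [Lp.edist_def, ← nrm_sub_congr]
      exact (hN m hm n hn).trans_lt hδ
    obtain ⟨x, hx⟩ := cauchySeq_tendsto_of_complete hv
    refine ⟨x.1, x.2, ?_⟩
    rw [tendsto_iff_edist_tendsto_0] at hx
    refine hx.congr fun n => ?_
    rw [Lp.edist_def, ← nrm_sub_congr]

/-- The least decreasing majorant `f̃(x) = ess sup {|f(y)| : y ≥ x}` of `f`, with values in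
`[0, ∞]`; only its values at `x > 0` matter. -/
def ldmE (f : L0) (x : ℝ) : ℝ≥0∞ := essSup (fun y => ‖f y‖ₑ) (halfLine.restrict (Ici x))

theorem ldmE_eq (f : L0) (x : ℝ) : ldmE f x = eLpNorm f ∞ (halfLine.restrict (Ici x)) := by
  simp [ldmE, eLpNorm_exponent_top, eLpNormEssSup]

theorem ldmE_antitone (f : L0) : Antitone (ldmE f) := by
  intro x y hxy
  rw [ldmE_eq, ldmE_eq]
  exact eLpNorm_mono_measure _ (Measure.restrict_mono (Ici_subset_Ici.2 hxy) le_rfl)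

theorem measurable_ldmE (f : L0) : Measurable (ldmE f) := (ldmE_antitone f).measurable

theorem ldmE_add_le (f g : L0) (x : ℝ) : ldmE (f + g) x ≤ ldmE f x + ldmE g x := by
  simp only [ldmE_eq]
  rw [eLpNorm_congr_ae (ae_restrict_of_ae (AEEqFun.coeFn_add f g))]
  exact eLpNorm_add_le f.aestronglyMeasurable.restrict g.aestronglyMeasurable.restrict le_top

theorem ldmE_smul (a : ℝ) (f : L0) (x : ℝ) : ldmE (a • f) x = ‖a‖ₑ * ldmE f x := by
  simp only [ldmE_eq]
  rw [eLpNorm_congr_ae (ae_restrict_of_ae (AEEqFun.coeFn_smul a f))]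
  exact eLpNorm_const_smul a _ _ _

theorem ldmE_le_nrm_top (f : L0) (x : ℝ) : ldmE f x ≤ eLpNorm f ∞ halfLine := by
  rw [ldmE_eq]
  exact eLpNorm_mono_measure _ Measure.restrict_le_self

/-- `|f| ≤ f̃` almost everywhere. -/
theorem ae_le_ldmE (f : L0) : ∀ᵐ y ∂halfLine, ‖f y‖ₑ ≤ ldmE f y := by
  have h1 : ∀ᵐ y ∂halfLine, ∀ q : ℚ, (q : ℝ) ≤ y → ‖f y‖ₑ ≤ ldmE f q := by
    rw [ae_all_iff]
    intro q
    have := ENNReal.ae_le_essSup (μ := halfLine.restrict (Ici (q : ℝ))) (fun y => ‖f y‖ₑ)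
    rw [ae_restrict_iff' measurableSet_Ici] at this
    exact this
  have h2 : ∀ᵐ y ∂halfLine, ContinuousAt (ldmE f) y := by
    have : {y | ¬ ContinuousAt (ldmE f) y}.Countable := (ldmE_antitone f).countable_not_continuousAt
    exact this.measure_zero _
  filter_upwards [h1, h2] with y hy hc
  have hl : Tendsto (ldmE f) (𝓝[<] y) (𝓝 (ldmE f y)) := hc.tendsto.mono_left inf_le_left
  refine ge_of_tendsto hl ?_
  filter_upwards [self_mem_nhdsWithin] with z hz
  obtain ⟨q, hzq, hqy⟩ := exists_rat_btwn (show z < y from hz)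
  exact (hy q hqy.le).trans (ldmE_antitone f hzq.le)

/-- The norm of `L̃¹`: `‖f‖ = ‖f̃‖_{L¹}`. -/
def tildeNorm (f : L0) : ℝ≥0∞ := ∫⁻ x, ldmE f x ∂halfLine

theorem nrm_one_le_tildeNorm (f : L0) : eLpNorm f 1 halfLine ≤ tildeNorm f := by
  rw [eLpNorm_one_eq_lintegral_enorm]
  exact lintegral_mono_ae (ae_le_ldmE f)

theorem tildeNorm_le_liminf (f : ℕ → L0) (g : L0)
    (h : ∀ᵐ y ∂halfLine, Tendsto (fun n => f n y) atTop (𝓝 (g y))) :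
    tildeNorm g ≤ liminf (fun n => tildeNorm (f n)) atTop := by
  refine le_trans (lintegral_mono fun x => ?_) (lintegral_liminf_le fun n => measurable_ldmE (f n))
  refine essSup_le_of_ae_le _ ?_
  have h1 : ∀ᵐ y ∂(halfLine.restrict (Ici x)), ∀ n, ‖f n y‖ₑ ≤ ldmE (f n) x :=
    ae_all_iff.2 fun n => ENNReal.ae_le_essSup _
  filter_upwards [h1, ae_restrict_of_ae h] with y hy hlim
  rw [← (hlim.enorm).liminf_eq]
  exact liminf_le_liminf (Eventually.of_forall hy)

/-- `L̃¹`, the space of functions whose least decreasing majorant is integrable. -/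
def tildeL1 : BanachSubspace L0 where
  nrm := tildeNorm
  eq_zero_of_nrm f hf := (lebesgue 1).eq_zero_of_nrm f
    (le_antisymm ((nrm_one_le_tildeNorm f).trans hf.le) zero_le)
  nrm_add_le f g := by
    unfold tildeNorm
    rw [← lintegral_add_left (measurable_ldmE f)]
    exact lintegral_mono (ldmE_add_le f g)
  nrm_smul a f := by
    unfold tildeNorm
    simp only [ldmE_smul]
    exact lintegral_const_mul _ (measurable_ldmE f)
  complete u hu hc := by
    obtain ⟨x, -, hx⟩ := (lebesgue 1).complete u
      (fun n => (nrm_one_le_tildeNorm _).trans_lt (hu n))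
      (fun ε hε => (hc ε hε).imp fun N h m hm n hn =>
        (nrm_one_le_tildeNorm _).trans (h m hm n hn))
    have hx' : Tendsto (fun n => eLpNorm (⇑(u n) - ⇑x) 1 halfLine) atTop (𝓝 0) :=
      hx.congr fun n => nrm_sub_congr 1 (u n) x
    obtain ⟨ns, hns, hae⟩ := (tendstoInMeasure_of_tendsto_eLpNorm one_ne_zero
      (fun n => (u n).aestronglyMeasurable) x.aestronglyMeasurable hx').exists_seq_tendsto_ae
    have key : ∀ ε : ℝ≥0∞, 0 < ε → ∃ N, ∀ m ≥ N, tildeNorm (u m - x) ≤ ε := by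
      intro ε hε
      obtain ⟨N, hN⟩ := hc ε hε
      refine ⟨N, fun m hm => ?_⟩
      refine (tildeNorm_le_liminf (fun n => u m - u (ns n)) (u m - x) ?_).trans ?_
      · have h1 : ∀ᵐ y ∂halfLine, ∀ n, (u m - u (ns n) : L0) y = u m y - u (ns n) y :=
          ae_all_iff.2 fun n => AEEqFun.coeFn_sub _ _
        filter_upwards [h1, AEEqFun.coeFn_sub (u m) x, hae] with y h1 h2 h3
        simp only [h1, h2, Pi.sub_apply]
        exact tendsto_const_nhds.sub h3
      · refine liminf_le_of_le (by isBoundedDefault) fun b hb => ?_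
        obtain ⟨n, hn1, hn2⟩ := (hb.and (hns.tendsto_atTop.eventually_ge_atTop N)).exists
        exact hn1.trans (hN m hm _ hn2)
    refine ⟨x, ?_, ?_⟩
    · obtain ⟨N, hN⟩ := key 1 one_pos
      have h : x = u N + (-1 : ℝ) • (u N - x) := by simp
      rw [h]
      calc tildeNorm (u N + (-1 : ℝ) • (u N - x))
          ≤ tildeNorm (u N) + tildeNorm ((-1 : ℝ) • (u N - x)) := by
            unfold tildeNorm
            rw [← lintegral_add_left (measurable_ldmE _)]
            exact lintegral_mono (ldmE_add_le _ _)
        _ = tildeNorm (u N) + tildeNorm (u N - x) := by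
            congr 1
            unfold tildeNorm
            simp only [ldmE_smul]
            simp
        _ < ∞ := ENNReal.add_lt_top.2 ⟨hu N, (hN N le_rfl).trans_lt ENNReal.one_lt_top⟩
    · exact ENNReal.tendsto_atTop_zero.2 key

theorem hausdorff_lebesgue (x : L0) (h : Kfun (lebesgue 1) (lebesgue ∞) 1 x = 0) : x = 0 := by
  have key : ∀ k : ℕ, eLpNorm x 1 (halfLine.restrict (Iic (k : ℝ))) = 0 := by
    intro k
    have hle : eLpNorm x 1 (halfLine.restrict (Iic (k : ℝ))) ≤
        ((k : ℝ≥0∞) + 1) * Kfun (lebesgue 1) (lebesgue ∞) 1 x := by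
      unfold Kfun
      have hk0 : ((k : ℝ≥0∞) + 1) ≠ 0 := by simp
      have hkt : ((k : ℝ≥0∞) + 1) ≠ ∞ := by simp
      rw [mul_comm, ← ENNReal.div_le_iff hk0 hkt]
      refine le_iInf fun x₀ => le_iInf fun x₁ => le_iInf fun _ => le_iInf fun _ =>
        le_iInf fun hs => ?_
      rw [ENNReal.div_le_iff hk0 hkt]
      subst hs
      rw [eLpNorm_congr_ae (ae_restrict_of_ae (AEEqFun.coeFn_add x₀ x₁))]
      refine (eLpNorm_add_le x₀.aestronglyMeasurable.restrict x₁.aestronglyMeasurable.restrict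
        le_rfl).trans ?_
      have h0 : eLpNorm x₀ 1 (halfLine.restrict (Iic (k : ℝ))) ≤ (lebesgue 1).nrm x₀ :=
        eLpNorm_mono_measure _ Measure.restrict_le_self
      have h1 : eLpNorm x₁ 1 (halfLine.restrict (Iic (k : ℝ))) ≤ (lebesgue ∞).nrm x₁ * k := by
        rw [eLpNorm_one_eq_lintegral_enorm]
        have hb : ∀ᵐ y ∂(halfLine.restrict (Iic (k : ℝ))), ‖x₁ y‖ₑ ≤ (lebesgue ∞).nrm x₁ := by
          refine ae_restrict_of_ae ?_
          have := ae_le_eLpNormEssSup (f := x₁) (μ := halfLine)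
          simpa [lebesgue, eLpNorm_exponent_top] using this
        refine (lintegral_mono_ae hb).trans ?_
        rw [lintegral_const]
        gcongr
        rw [Measure.restrict_apply_univ, Measure.restrict_apply measurableSet_Iic, inter_comm,
          Ioi_inter_Iic, Real.volume_Ioc]
        simp
      calc _ ≤ (lebesgue 1).nrm x₀ + (lebesgue ∞).nrm x₁ * k := add_le_add h0 h1
        _ ≤ (lebesgue 1).nrm x₀ * (k + 1) + (lebesgue ∞).nrm x₁ * (k + 1) := by
            gcongr
            · exact le_mul_of_one_le_right zero_le (by simp)
            · simp
        _ = _ := by simp [add_mul]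
    rw [h, mul_zero] at hle
    exact le_antisymm hle zero_le
  refine AEEqFun.ext (EventuallyEq.trans ?_ AEEqFun.coeFn_zero.symm)
  have h2 : ∀ k : ℕ, ∀ᵐ y ∂halfLine, y ∈ Iic (k : ℝ) → x y = 0 := by
    intro k
    have := (eLpNorm_eq_zero_iff x.aestronglyMeasurable.restrict one_ne_zero).1 (key k)
    exact (ae_restrict_iff' measurableSet_Iic).1 this
  filter_upwards [ae_all_iff.2 h2] with y hy
  obtain ⟨k, hk⟩ := exists_nat_ge y
  exact hy k hk

/-- The couple `(L¹, L^∞)`. -/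
def coupleL : BanachCouple L0 where
  X₀ := lebesgue 1
  X₁ := lebesgue ∞
  hausdorff := hausdorff_lebesgue

/-- The couple `(L̃¹, L^∞)`. -/
def coupleTildeL : BanachCouple L0 where
  X₀ := tildeL1
  X₁ := lebesgue ∞
  hausdorff x h := by
    refine hausdorff_lebesgue x (le_antisymm (le_trans ?_ h.le) zero_le)
    refine le_iInf fun x₀ => le_iInf fun x₁ => le_iInf fun h₀ => le_iInf fun h₁ =>
      le_iInf fun hs => ?_
    refine (iInf_le_of_le x₀ <| iInf_le_of_le x₁ <|
      iInf_le_of_le ((nrm_one_le_tildeNorm x₀).trans_lt h₀) <| iInf_le_of_le h₁ <|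
      iInf_le_of_le hs ?_)
    gcongr
    exact nrm_one_le_tildeNorm x₀

/-- The least decreasing majorant as a real-valued function modulo equality almost everywhere.
It is finite on `(0, ∞)` whenever `f ∈ L̃¹ + L^∞`. -/
def ldm (f : L0) : L0 :=
  AEEqFun.mk (fun x => (ldmE f x).toReal) (measurable_ldmE f).ennreal_toReal.aestronglyMeasurable

theorem ldmE_lt_top_of_tildeNorm {f : L0} (hf : tildeNorm f < ∞) {x : ℝ} (hx : 0 < x) :
    ldmE f x < ∞ := by
  by_contra hc
  have hc' : ldmE f x = ∞ := not_lt_top_iff.1 hc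
  have h1 : ∫⁻ y in Iic x, ldmE f y ∂halfLine ≤ tildeNorm f :=
    lintegral_mono' Measure.restrict_le_self le_rfl
  have h2 : ∫⁻ _ in Iic x, (∞ : ℝ≥0∞) ∂halfLine ≤ ∫⁻ y in Iic x, ldmE f y ∂halfLine := by
    refine setLIntegral_mono (measurable_ldmE f) fun y hy => ?_
    rw [← hc']
    exact ldmE_antitone f hy
  have h3 : ∫⁻ _ in Iic x, (∞ : ℝ≥0∞) ∂halfLine = ∞ := by
    rw [setLIntegral_const, Measure.restrict_apply measurableSet_Iic, inter_comm, Ioi_inter_Iic,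
      Real.volume_Ioc]
    exact ENNReal.top_mul (by simpa using hx)
  rw [h3] at h2
  exact (not_lt_of_ge (h2.trans h1)) hf

theorem ldmE_lt_top {f : L0} (hf : f ∈ coupleTildeL.sum) {x : ℝ} (hx : 0 < x) :
    ldmE f x < ∞ := by
  obtain ⟨f₀, h₀, f₁, h₁, rfl⟩ := Submodule.mem_sup.1 hf
  exact (ldmE_add_le f₀ f₁ x).trans_lt (ENNReal.add_lt_top.2
    ⟨ldmE_lt_top_of_tildeNorm h₀ hx, (ldmE_le_nrm_top f₁ x).trans_lt h₁⟩)

/-- If `f ∈ L̃¹ + L^∞` then `f̃ ∈ L¹ + L^∞`. -/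
theorem ldm_mem_sum {f : L0} (hf : f ∈ coupleTildeL.sum) : ldm f ∈ coupleL.sum := by
  have hfin : ∀ᵐ x ∂halfLine, ldmE f x < ∞ :=
    (ae_restrict_iff' measurableSet_Ioi).2 (Eventually.of_forall fun x hx => ldmE_lt_top hf hx)
  obtain ⟨f₀, h₀, f₁, h₁, rfl⟩ := Submodule.mem_sup.1 hf
  have h₁' : eLpNorm f₁ ∞ halfLine < ∞ := h₁
  set C : ℝ≥0∞ := eLpNorm f₁ ∞ halfLine with hC
  set F := ldmE (f₀ + f₁) with hF
  have hmF : Measurable F := measurable_ldmE _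
  have m0 : Measurable fun x => (F x - C).toReal := (hmF.sub_const C).ennreal_toReal
  have m1 : Measurable fun x => (min (F x) C).toReal := (hmF.min measurable_const).ennreal_toReal
  refine Submodule.mem_sup.2 ⟨AEEqFun.mk _ m0.aestronglyMeasurable, ?_,
    AEEqFun.mk _ m1.aestronglyMeasurable, ?_, ?_⟩
  · show eLpNorm _ 1 halfLine < ∞
    rw [eLpNorm_congr_ae (AEEqFun.coeFn_mk _ _), eLpNorm_one_eq_lintegral_enorm]
    refine lt_of_le_of_lt (lintegral_mono fun x => ?_) (show tildeNorm f₀ < ∞ from h₀)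
    have hle : F x - C ≤ ldmE f₀ x := by
      rw [tsub_le_iff_right]
      exact (ldmE_add_le f₀ f₁ x).trans (by gcongr; exact ldmE_le_nrm_top f₁ x)
    refine le_trans ?_ hle
    rw [Real.enorm_eq_ofReal ENNReal.toReal_nonneg]
    exact ENNReal.ofReal_toReal_le
  · show eLpNorm _ ∞ halfLine < ∞
    rw [eLpNorm_congr_ae (AEEqFun.coeFn_mk _ _), eLpNorm_exponent_top]
    refine lt_of_le_of_lt (essSup_le_of_ae_le C (Eventually.of_forall fun x => ?_)) h₁'
    show ‖(min (F x) C).toReal‖ₑ ≤ C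
    rw [Real.enorm_eq_ofReal ENNReal.toReal_nonneg]
    exact ENNReal.ofReal_toReal_le.trans (min_le_right _ _)
  · unfold ldm
    rw [AEEqFun.mk_add_mk]
    refine AEEqFun.mk_eq_mk.2 ?_
    filter_upwards [hfin] with x hx
    show (F x - C).toReal + (min (F x) C).toReal = (F x).toReal
    rw [← ENNReal.toReal_add (tsub_le_self.trans_lt hx).ne ((min_le_left _ _).trans_lt hx).ne]
    congr 1
    rcases le_total (F x) C with h | h
    · rw [min_eq_left h, tsub_eq_zero_of_le h, zero_add]
    · rw [min_eq_right h, tsub_add_cancel_of_le h]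

/-- `g̃`, as an element of `L¹ + L^∞`, for `g ∈ L̃¹ + L^∞`. -/
def majorant (g : coupleTildeL.sum) : coupleL.sum := ⟨ldm g, ldm_mem_sum g.2⟩

/-- `m` is a constant such that for each `g ∈ L̃¹ + L^∞` there is a linear operator
`M : (L¹, L^∞) → (L̃¹, L^∞)`, of norm at most `m`, with `M g̃ = g`. -/
def IsMajorantConstant (m : ℝ≥0) : Prop :=
  ∀ g : coupleTildeL.sum, ∃ M : CoupleMap coupleL coupleTildeL,
    M.norm ≤ m ∧ M.toLin (majorant g) = g

end

end CalderonMityagin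

open CalderonMityagin

/-!
The `K`-functionals are `K(t, x; L¹, L^∞) = ∫₀ᵗ x*` and `K(t, f; L̃¹, L^∞) = ∫₀ᵗ f̃`. Hence the
hypothesis on them compares integrals over `(0, t]` of two antitone functions, and by Calderón's
theorem a contraction maps one of these functions to the other: finitely many averagings over
intervals carry the larger function above any step function below the smaller one. This is the
middle step of the chains `f ↦ f̃ ↦ g̃ ↦ g` for (a), `f ↦ f̃ ↦ g* ↦ g` for (b) and `x ↦ x* ↦ g̃ ↦ g`
for (c). The step `f ↦ f̃` reads off almost maximal values of `|f|` to the right of the point, the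
steps `x ↦ x*` and `g* ↦ g` match level sets of equal measure, and `g̃ ↦ g` is multiplication by a
function of absolute value at most `1` in (a) and the operator `M` in (c). Steps that succeed only
up to a small error are made exact by a weak limit of the operators along an ultrafilter.

Replacing a function on each dyadic interval by its average over the preceding one maps `L¹` to
`L̃¹` with norm at most `4` and does not make `g̃` smaller, so `4` is admissible.

For (d), `g = 2 · 1_{(0, 1]} + 1_{(1, 3]}` is its own majorant. If `M` has norm `n` and `M g = g`,
put `A = M 1_{(0, 1]}` and `B = M 1_{(1, 3]}`, so that `2 A + B = g`. A decreasing function has at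
most two thirds of its integral over `(0, 3]` on `(1, 3]`, hence `∫₁³ B ≤ 4 n / 3`. Together with
`∫₀³ A ≤ n` and `∫₀¹ (A + B) ≤ n` this gives `9 / 8 ≤ n`.
-/

namespace CalderonMityagin

noncomputable section

section Contractions

variable {U V W : Type*} [AddCommGroup U] [Module ℝ U] [AddCommGroup V] [Module ℝ V]
  [AddCommGroup W] [Module ℝ W]
variable {X : BanachCouple U} {Y : BanachCouple V} {Z : BanachCouple W}

theorem BanachSubspace.nrm_zero (E : BanachSubspace V) : E.nrm 0 = 0 := by
  simpa using E.nrm_smul 0 0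

theorem BanachSubspace.nrm_le_of_iSup_div_le (E : BanachSubspace U) (F : BanachSubspace V)
    {T : E.carrier → V} (hT : T 0 = 0) {c : ℝ≥0∞} (hc : ⨆ x, F.nrm (T x) / E.nrm x ≤ c)
    (x : E.carrier) : F.nrm (T x) ≤ c * E.nrm x := by
  rcases eq_or_ne (E.nrm x) 0 with h0 | h0
  · have hx : x = 0 := Subtype.ext (E.eq_zero_of_nrm _ h0)
    simp [hx, hT, F.nrm_zero]
  · rw [← ENNReal.div_le_iff h0 x.2.ne]
    exact (le_iSup (fun x : E.carrier => F.nrm (T x) / E.nrm x) x).trans hc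

theorem CoupleMap.nrm₀_le (S : CoupleMap X Y) {c : ℝ≥0∞} (hS : S.norm ≤ c) (x : X.X₀.carrier) :
    Y.X₀.nrm (S.toLin (X.incl₀ x)) ≤ c * X.X₀.nrm x :=
  X.X₀.nrm_le_of_iSup_div_le Y.X₀ (T := fun x => S.toLin (X.incl₀ x))
    (congrArg Subtype.val (map_zero S.toLin)) ((le_max_left _ _).trans hS) x

theorem CoupleMap.nrm₁_le (S : CoupleMap X Y) {c : ℝ≥0∞} (hS : S.norm ≤ c) (x : X.X₁.carrier) :
    Y.X₁.nrm (S.toLin (X.incl₁ x)) ≤ c * X.X₁.nrm x :=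
  X.X₁.nrm_le_of_iSup_div_le Y.X₁ (T := fun x => S.toLin (X.incl₁ x))
    (congrArg Subtype.val (map_zero S.toLin)) ((le_max_right _ _).trans hS) x

theorem BanachCouple.exists_add_eq (h : X.sum) :
    ∃ (h₀ : X.X₀.carrier) (h₁ : X.X₁.carrier), X.incl₀ h₀ + X.incl₁ h₁ = h := by
  obtain ⟨h₀, hh₀, h₁, hh₁, e⟩ := Submodule.mem_sup.1 h.2
  exact ⟨⟨h₀, hh₀⟩, ⟨h₁, hh₁⟩, Subtype.ext e⟩

theorem mem_sum_of_nrm_le {c : ℝ≥0} {T : X.sum →ₗ[ℝ] V}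
    (h₀ : ∀ x, Y.X₀.nrm (T (X.incl₀ x)) ≤ c * X.X₀.nrm x)
    (h₁ : ∀ x, Y.X₁.nrm (T (X.incl₁ x)) ≤ c * X.X₁.nrm x) (h : X.sum) : T h ∈ Y.sum := by
  obtain ⟨a, b, rfl⟩ := X.exists_add_eq h
  rw [map_add]
  exact Submodule.add_mem_sup ((h₀ a).trans_lt (ENNReal.mul_lt_top ENNReal.coe_lt_top a.2))
    ((h₁ b).trans_lt (ENNReal.mul_lt_top ENNReal.coe_lt_top b.2))

theorem exists_coupleMap_of_nrm_le {c : ℝ≥0} {T : X.sum →ₗ[ℝ] V}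
    (h₀ : ∀ x, Y.X₀.nrm (T (X.incl₀ x)) ≤ c * X.X₀.nrm x)
    (h₁ : ∀ x, Y.X₁.nrm (T (X.incl₁ x)) ≤ c * X.X₁.nrm x) :
    ∃ S : CoupleMap X Y, S.norm ≤ c ∧ ∀ h, (S.toLin h : V) = T h :=
  ⟨⟨T.codRestrict Y.sum (mem_sum_of_nrm_le h₀ h₁), ⟨c, h₀⟩, ⟨c, h₁⟩⟩,
    max_le (iSup_le fun x => ENNReal.div_le_of_le_mul (h₀ x))
      (iSup_le fun x => ENNReal.div_le_of_le_mul (h₁ x)), fun _ => rfl⟩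

/-- A linear map on `X₀ + X₁` that is a contraction from `X_j` to `Y_j`, `j = 0, 1`. The codomain
is the ambient space of `Y`, so that such maps can be composed with maps of that space; the range
automatically lies in `Y₀ + Y₁`. -/
structure IsContraction (X : BanachCouple U) (Y : BanachCouple V) (T : X.sum →ₗ[ℝ] V) : Prop where
  nrm₀_le : ∀ h : X.sum, Y.X₀.nrm (T h) ≤ X.X₀.nrm h
  nrm₁_le : ∀ h : X.sum, Y.X₁.nrm (T h) ≤ X.X₁.nrm h

theorem IsContraction.mem_sum {T : X.sum →ₗ[ℝ] V} (hT : IsContraction X Y T) (h : X.sum) :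
    T h ∈ Y.sum :=
  mem_sum_of_nrm_le (c := 1) (fun x => by
    rw [ENNReal.coe_one, one_mul]; exact hT.nrm₀_le (X.incl₀ x))
    (fun x => by
    rw [ENNReal.coe_one, one_mul]; exact hT.nrm₁_le (X.incl₁ x)) h

theorem IsContraction.exists_coupleMap {T : X.sum →ₗ[ℝ] V} (hT : IsContraction X Y T) :
    ∃ S : CoupleMap X Y, S.norm ≤ (1 : ℝ≥0) ∧ ∀ h, (S.toLin h : V) = T h :=
  exists_coupleMap_of_nrm_le (fun x => by
    rw [ENNReal.coe_one, one_mul]; exact hT.nrm₀_le (X.incl₀ x))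
    (fun x => by
    rw [ENNReal.coe_one, one_mul]; exact hT.nrm₁_le (X.incl₁ x))

theorem IsContraction.comp {T : X.sum →ₗ[ℝ] V} (hT : IsContraction X Y T) {S : Y.sum →ₗ[ℝ] W}
    (hS : IsContraction Y Z S) : IsContraction X Z (S.comp (T.codRestrict Y.sum hT.mem_sum)) :=
  ⟨fun h => (hS.nrm₀_le _).trans (hT.nrm₀_le h), fun h => (hS.nrm₁_le _).trans (hT.nrm₁_le h)⟩

theorem isContraction_subtype (X : BanachCouple U) : IsContraction X X X.sum.subtype :=
  ⟨fun _ => le_rfl, fun _ => le_rfl⟩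

/-- `y` lies in the orbit of `x` under the contractions from `X` to `Y`. -/
def InOrbit (X : BanachCouple U) (Y : BanachCouple V) (x : X.sum) (y : V) : Prop :=
  ∃ T : X.sum →ₗ[ℝ] V, IsContraction X Y T ∧ T x = y

theorem InOrbit.mem_sum {x : X.sum} {y : V} (h : InOrbit X Y x y) : y ∈ Y.sum := by
  obtain ⟨T, hT, rfl⟩ := h
  exact hT.mem_sum x

theorem InOrbit.trans {x : X.sum} {y : V} (hxy : InOrbit X Y x y) (hy : y ∈ Y.sum) {z : W}
    (hyz : InOrbit Y Z ⟨y, hy⟩ z) : InOrbit X Z x z := by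
  obtain ⟨T, hT, rfl⟩ := hxy
  obtain ⟨S, hS, rfl⟩ := hyz
  exact ⟨_, hT.comp hS, rfl⟩

theorem InOrbit.exists_coupleMap {x : X.sum} {y : Y.sum} (h : InOrbit X Y x y) :
    ∃ S : CoupleMap X Y, S.norm ≤ (1 : ℝ≥0) ∧ S.toLin x = y := by
  obtain ⟨T, hT, e⟩ := h
  obtain ⟨S, hS, hST⟩ := hT.exists_coupleMap
  exact ⟨S, hS, Subtype.ext ((hST x).trans e)⟩

theorem InOrbit.exists_coupleMap_comp {x : X.sum} {y : Y.sum} (h : InOrbit X Y x y)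
    {M : CoupleMap Y Z} {c : ℝ≥0} (hM : M.norm ≤ c) :
    ∃ S : CoupleMap X Z, S.norm ≤ c ∧ S.toLin x = M.toLin y := by
  obtain ⟨T, hT, hTx⟩ := h
  set T' : X.sum →ₗ[ℝ] Y.sum := T.codRestrict Y.sum hT.mem_sum
  obtain ⟨S, hS, hSM⟩ := exists_coupleMap_of_nrm_le (X := X) (Y := Z) (c := c)
    (T := (Z.sum.subtype.comp M.toLin).comp T')
    (fun a => (M.nrm₀_le hM ⟨T (X.incl₀ a), (hT.nrm₀_le _).trans_lt a.2⟩).trans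
      (mul_le_mul_right (hT.nrm₀_le (X.incl₀ a)) _))
    (fun a => (M.nrm₁_le hM ⟨T (X.incl₁ a), (hT.nrm₁_le _).trans_lt a.2⟩).trans
      (mul_le_mul_right (hT.nrm₁_le (X.incl₁ a)) _))
  have hT'x : T' x = y := Subtype.ext hTx
  exact ⟨S, hS, Subtype.ext ((hSM x).trans (congrArg (fun z => (M.toLin z : W)) hT'x))⟩

end Contractions

section FunctionsOnHalfLine

theorem halfLine_Iic (t : ℝ) : halfLine (Iic t) = ENNReal.ofReal t := by
  rw [Measure.restrict_apply measurableSet_Iic, inter_comm, Ioi_inter_Iic, Real.volume_Ioc,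
    sub_zero]

theorem halfLine_Iic_lt_top (t : ℝ) : halfLine (Iic t) < ∞ := by
  rw [halfLine_Iic]
  exact ENNReal.ofReal_lt_top

theorem halfLine_Ioc {a : ℝ} (ha : 0 ≤ a) (b : ℝ) :
    halfLine (Ioc a b) = ENNReal.ofReal (b - a) := by
  rw [Measure.restrict_apply measurableSet_Ioc, inter_eq_left.2, Real.volume_Ioc]
  exact fun x hx => ha.trans_lt hx.1

theorem halfLine_Ioc_lt_top (a b : ℝ) : halfLine (Ioc a b) < ∞ :=
  (measure_mono Ioc_subset_Iic_self).trans_lt (halfLine_Iic_lt_top b)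

theorem halfLine_restrict_Ioc {a : ℝ} (ha : 0 ≤ a) (b : ℝ) :
    halfLine.restrict (Ioc a b) = volume.restrict (Ioc a b) :=
  Measure.restrict_restrict_of_subset fun _ hx => ha.trans_lt hx.1

theorem enorm_le_enorm_iff_abs_le {a b : ℝ} : ‖a‖ₑ ≤ ‖b‖ₑ ↔ |a| ≤ |b| := by
  rw [Real.enorm_eq_ofReal_abs, Real.enorm_eq_ofReal_abs,
    ENNReal.ofReal_le_ofReal_iff (abs_nonneg _)]

theorem ae_halfLine_of_forall_pos {P : ℝ → Prop} (h : ∀ s, 0 < s → P s) : ∀ᵐ s ∂halfLine, P s :=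
  (ae_restrict_mem measurableSet_Ioi).mono fun s hs => h s hs

theorem ae_le_nrm_top (f : L0) : ∀ᵐ s ∂halfLine, ‖f s‖ₑ ≤ (lebesgue ∞).nrm f := by
  simpa [lebesgue, eLpNorm_exponent_top] using ae_le_eLpNormEssSup (f := f) (μ := halfLine)

theorem nrm_top_le {f : L0} {C : ℝ≥0∞} (h : ∀ᵐ s ∂halfLine, ‖f s‖ₑ ≤ C) :
    (lebesgue ∞).nrm f ≤ C := by
  change eLpNorm f ∞ halfLine ≤ C
  rw [eLpNorm_exponent_top]
  exact essSup_le_of_ae_le C h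

theorem nrm_one_eq (f : L0) : (lebesgue 1).nrm f = ∫⁻ s, ‖f s‖ₑ ∂halfLine :=
  eLpNorm_one_eq_lintegral_enorm

theorem setLIntegral_le_nrm_one (f : L0) (P : Set ℝ) :
    ∫⁻ s in P, ‖f s‖ₑ ∂halfLine ≤ (lebesgue 1).nrm f :=
  (setLIntegral_le_lintegral _ _).trans_eq (nrm_one_eq f).symm

theorem ae_enorm_add_le (f g : L0) :
    ∀ᵐ s ∂halfLine, ‖(f + g : L0) s‖ₑ ≤ ‖f s‖ₑ + (lebesgue ∞).nrm g := by
  filter_upwards [AEEqFun.coeFn_add f g, ae_le_nrm_top g] with s hadd hg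
  rw [hadd, Pi.add_apply]
  exact (enorm_add_le _ _).trans (by gcongr)

theorem setLIntegral_enorm_add_le (f g : L0) (P : Set ℝ) :
    ∫⁻ s in P, ‖(f + g : L0) s‖ₑ ∂halfLine ≤
      (lebesgue 1).nrm f + (lebesgue ∞).nrm g * halfLine P := by
  calc ∫⁻ s in P, ‖(f + g : L0) s‖ₑ ∂halfLine
      ≤ ∫⁻ s in P, (‖f s‖ₑ + (lebesgue ∞).nrm g) ∂halfLine :=
        lintegral_mono_ae (ae_restrict_of_ae (ae_enorm_add_le f g))
    _ ≤ (lebesgue 1).nrm f + (lebesgue ∞).nrm g * halfLine P := by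
        rw [lintegral_add_right _ measurable_const, setLIntegral_const]
        gcongr
        exact setLIntegral_le_nrm_one f P

theorem integrableOn_of_mem_sum {h : L0} (hh : h ∈ coupleL.sum) {P : Set ℝ}
    (hP : halfLine P < ∞) : IntegrableOn h P halfLine := by
  obtain ⟨a, ha, b, hb, rfl⟩ := Submodule.mem_sup.1 hh
  exact ⟨AEEqFun.aestronglyMeasurable _ |>.restrict, (setLIntegral_enorm_add_le a b P).trans_lt
    (ENNReal.add_lt_top.2 ⟨ha, ENNReal.mul_lt_top hb hP⟩)⟩

theorem setIntegral_add_of_mem_sum {P : Set ℝ} (hP : halfLine P < ∞) {h k : L0}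
    (hh : h ∈ coupleL.sum) (hk : k ∈ coupleL.sum) :
    ∫ s in P, (h + k : L0) s ∂halfLine = ∫ s in P, h s ∂halfLine + ∫ s in P, k s ∂halfLine := by
  rw [← integral_add (integrableOn_of_mem_sum hh hP) (integrableOn_of_mem_sum hk hP)]
  exact integral_congr_ae (ae_restrict_of_ae (AEEqFun.coeFn_add h k))

theorem setIntegral_const_smul (P : Set ℝ) (c : ℝ) (h : L0) :
    ∫ s in P, (c • h : L0) s ∂halfLine = c * ∫ s in P, h s ∂halfLine := by
  rw [integral_congr_ae (ae_restrict_of_ae (AEEqFun.coeFn_smul c h))]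
  exact integral_const_mul c h

theorem ldmE_mono {f g : L0} (h : ∀ᵐ s ∂halfLine, ‖f s‖ₑ ≤ ‖g s‖ₑ) (x : ℝ) :
    ldmE f x ≤ ldmE g x :=
  essSup_mono_ae (ae_restrict_of_ae h)

theorem ldmE_le_of_antitoneOn {f : L0} {q : ℝ → ℝ≥0∞} (hq : AntitoneOn q (Ioi 0))
    (h : ∀ᵐ s ∂halfLine, ‖f s‖ₑ ≤ q s) {x : ℝ} (hx : 0 < x) : ldmE f x ≤ q x := by
  refine essSup_le_of_ae_le _ ?_
  filter_upwards [ae_restrict_of_ae h, ae_restrict_mem measurableSet_Ici] with s hs hxs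
  exact hs.trans (hq hx (hx.trans_le hxs) hxs)

theorem tildeNorm_le_of_antitoneOn {f : L0} {q : ℝ → ℝ≥0∞} (hq : AntitoneOn q (Ioi 0))
    (h : ∀ᵐ s ∂halfLine, ‖f s‖ₑ ≤ q s) : tildeNorm f ≤ ∫⁻ s, q s ∂halfLine :=
  lintegral_mono_ae (ae_halfLine_of_forall_pos fun _ hx => ldmE_le_of_antitoneOn hq h hx)

theorem coupleTildeL_sum_le : coupleTildeL.sum ≤ coupleL.sum :=
  sup_le_sup_right (fun x hx => lt_of_le_of_lt (nrm_one_le_tildeNorm x) hx) _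

/-- The linear map into `L0` that sends `v` to the class of `F v`. -/
def linOfRep {V : Type*} [AddCommGroup V] [Module ℝ V] (F : V → ℝ → ℝ)
    (hm : ∀ v, AEStronglyMeasurable (F v) halfLine)
    (hadd : ∀ v w, F (v + w) =ᵐ[halfLine] F v + F w)
    (hsmul : ∀ (a : ℝ) v, F (a • v) =ᵐ[halfLine] a • F v) : V →ₗ[ℝ] L0 where
  toFun v := AEEqFun.mk (F v) (hm v)
  map_add' v w := by
    rw [AEEqFun.mk_add_mk]
    exact AEEqFun.mk_eq_mk.2 (hadd v w)
  map_smul' a v := by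
    rw [RingHom.id_apply, AEEqFun.smul_mk]
    exact AEEqFun.mk_eq_mk.2 (hsmul a v)

theorem linOfRep_ae {V : Type*} [AddCommGroup V] [Module ℝ V] {F : V → ℝ → ℝ}
    {hm : ∀ v, AEStronglyMeasurable (F v) halfLine}
    {hadd : ∀ v w, F (v + w) =ᵐ[halfLine] F v + F w}
    {hsmul : ∀ (a : ℝ) v, F (a • v) =ᵐ[halfLine] a • F v} (v : V) :
    linOfRep F hm hadd hsmul v =ᵐ[halfLine] F v :=
  AEEqFun.coeFn_mk _ _

end FunctionsOnHalfLine

section WeakLimits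

/-- The limit of a bounded real sequence along a fixed nonprincipal ultrafilter on `ℕ`. -/
def ulim (u : ℕ → ℝ) : ℝ := limUnder (hyperfilter ℕ : Filter ℕ) u

theorem tendsto_ulim {u : ℕ → ℝ} {C : ℝ} (h : ∀ n, |u n| ≤ C) :
    Tendsto u (hyperfilter ℕ : Filter ℕ) (𝓝 (ulim u)) := by
  have hmem : ((hyperfilter ℕ).map u : Filter ℝ) ≤ 𝓟 (Icc (-C) C) :=
    le_principal_iff.2 (Filter.mem_map.2 (Eventually.of_forall fun n => abs_le.1 (h n)))
  obtain ⟨L, -, hL⟩ := isCompact_Icc.ultrafilter_le_nhds _ hmem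
  exact tendsto_nhds_limUnder ⟨L, hL⟩

/-- A sequence of functions on the half line that is bounded in `L¹(0, t)` for each `t`. -/
structure IsLocBdd (u : ℕ → ℝ → ℝ) : Prop where
  aestronglyMeasurable : ∀ n, AEStronglyMeasurable (u n) halfLine
  exists_lintegral_le : ∀ t, ∃ C < ∞, ∀ n, ∫⁻ s in Iic t, ‖u n s‖ₑ ∂halfLine ≤ C

/-- The limit of the primitives of the `u n` along the ultrafilter. -/
def limPrim (u : ℕ → ℝ → ℝ) (t : ℝ) : ℝ := ulim fun n => ∫ s in Iic t, u n s ∂halfLine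

/-- A weak limit of the sequence `u`, namely the derivative of the limit of the primitives. The mass
that escapes to a singular part of the limit is lost, so this is an absolutely continuous part. -/
def weakLim (u : ℕ → ℝ → ℝ) : ℝ → ℝ := deriv (limPrim u)

variable {u v : ℕ → ℝ → ℝ}

theorem IsLocBdd.integrableOn (hu : IsLocBdd u) (n : ℕ) (t : ℝ) :
    IntegrableOn (u n) (Iic t) halfLine := by
  obtain ⟨C, hC, h⟩ := hu.exists_lintegral_le t
  exact ⟨(hu.aestronglyMeasurable n).restrict, (h n).trans_lt hC⟩

theorem IsLocBdd.mono (hu : IsLocBdd u) (hv : ∀ n, AEStronglyMeasurable (v n) halfLine)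
    (h : ∀ n, ∀ᵐ s ∂halfLine, ‖v n s‖ₑ ≤ ‖u n s‖ₑ) : IsLocBdd v :=
  ⟨hv, fun t => (hu.exists_lintegral_le t).imp fun _ hC => ⟨hC.1, fun n =>
    (lintegral_mono_ae (ae_restrict_of_ae (h n))).trans (hC.2 n)⟩⟩

theorem IsLocBdd.abs (hu : IsLocBdd u) : IsLocBdd fun n s => |u n s| :=
  hu.mono (fun n => (hu.aestronglyMeasurable n).norm) fun n => ae_of_all _ fun s => by simp

theorem IsLocBdd.add (hu : IsLocBdd u) (hv : IsLocBdd v) : IsLocBdd fun n s => u n s + v n s := by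
  refine ⟨fun n => (hu.aestronglyMeasurable n).add (hv.aestronglyMeasurable n), fun t => ?_⟩
  obtain ⟨C, hC, huC⟩ := hu.exists_lintegral_le t
  obtain ⟨D, hD, hvD⟩ := hv.exists_lintegral_le t
  refine ⟨C + D, ENNReal.add_lt_top.2 ⟨hC, hD⟩, fun n => ?_⟩
  calc ∫⁻ s in Iic t, ‖u n s + v n s‖ₑ ∂halfLine
      ≤ ∫⁻ s in Iic t, (‖u n s‖ₑ + ‖v n s‖ₑ) ∂halfLine := lintegral_mono fun s => enorm_add_le _ _
    _ = _ := lintegral_add_left' (hu.aestronglyMeasurable n).restrict.enorm _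
    _ ≤ C + D := add_le_add (huC n) (hvD n)

theorem isLocBdd_of_lintegral_le (hu : ∀ n, AEStronglyMeasurable (u n) halfLine) {C : ℝ≥0∞}
    (hC : C < ∞) (h : ∀ n, ∫⁻ s, ‖u n s‖ₑ ∂halfLine ≤ C) : IsLocBdd u :=
  ⟨hu, fun _ => ⟨C, hC, fun n => (setLIntegral_le_lintegral _ _).trans (h n)⟩⟩

theorem isLocBdd_const {f : ℝ → ℝ} (hf : ∀ t, IntegrableOn f (Iic t) halfLine)
    (hm : AEStronglyMeasurable f halfLine) : IsLocBdd fun _ => f :=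
  ⟨fun _ => hm, fun t => ⟨_, (hf t).2, fun _ => le_rfl⟩⟩

theorem tendsto_limPrim (hu : IsLocBdd u) (t : ℝ) :
    Tendsto (fun n => ∫ s in Iic t, u n s ∂halfLine) (hyperfilter ℕ : Filter ℕ)
      (𝓝 (limPrim u t)) := by
  obtain ⟨C, hC, h⟩ := hu.exists_lintegral_le t
  refine tendsto_ulim (C := C.toReal) fun n => ?_
  rw [← ENNReal.ofReal_le_iff_le_toReal hC.ne, ← Real.enorm_eq_ofReal_abs]
  exact (enorm_integral_le_lintegral_enorm _).trans (h n)

theorem limPrim_add (hu : IsLocBdd u) (hv : IsLocBdd v) :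
    limPrim (fun n s => u n s + v n s) = limPrim u + limPrim v :=
  funext fun t => Tendsto.limUnder_eq (((tendsto_limPrim hu t).add (tendsto_limPrim hv t)).congr
    fun n => (integral_add (hu.integrableOn n t) (hv.integrableOn n t)).symm)

theorem limPrim_const_mul (hu : IsLocBdd u) (c : ℝ) :
    limPrim (fun n s => c * u n s) = fun t => c * limPrim u t :=
  funext fun t => Tendsto.limUnder_eq (((tendsto_limPrim hu t).const_mul c).congr
    fun _ => (integral_const_mul _ _).symm)

theorem setIntegral_Iic_sub {f : ℝ → ℝ} {s t : ℝ} (hst : s ≤ t)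
    (hf : IntegrableOn f (Iic t) halfLine) :
    (∫ r in Iic t, f r ∂halfLine) - ∫ r in Iic s, f r ∂halfLine =
      ∫ r in Ioc s t, f r ∂halfLine := by
  rw [← Iic_union_Ioc_eq_Iic hst, setIntegral_union (Iic_disjoint_Ioc le_rfl) measurableSet_Ioc
    (hf.mono_set (Iic_subset_Iic.2 hst)) (hf.mono_set Ioc_subset_Iic_self)]
  ring

theorem tendsto_limPrim_sub (hu : IsLocBdd u) {s t : ℝ} (hst : s ≤ t) :
    Tendsto (fun n => ∫ r in Ioc s t, u n r ∂halfLine) (hyperfilter ℕ : Filter ℕ)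
      (𝓝 (limPrim u t - limPrim u s)) :=
  ((tendsto_limPrim hu t).sub (tendsto_limPrim hu s)).congr fun n =>
    setIntegral_Iic_sub hst (hu.integrableOn n t)

theorem limPrim_sub_le (hu : IsLocBdd u) (hv : IsLocBdd v)
    (h : ∀ n, ∀ᵐ s ∂halfLine, u n s ≤ v n s) {s t : ℝ} (hst : s ≤ t) :
    limPrim u t - limPrim u s ≤ limPrim v t - limPrim v s :=
  le_of_tendsto_of_tendsto' (tendsto_limPrim_sub hu hst) (tendsto_limPrim_sub hv hst) fun n =>
    integral_mono_ae ((hu.integrableOn n t).mono_set Ioc_subset_Iic_self)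
      ((hv.integrableOn n t).mono_set Ioc_subset_Iic_self) (ae_restrict_of_ae (h n))

theorem monotone_limPrim (hu : IsLocBdd u) (h : ∀ n s, 0 ≤ u n s) : Monotone (limPrim u) :=
  fun _ _ hst => sub_nonneg.1 (ge_of_tendsto' (tendsto_limPrim_sub hu hst) fun n =>
    integral_nonneg (h n))

theorem ae_differentiableAt_limPrim (hu : IsLocBdd u) :
    ∀ᵐ s ∂halfLine, DifferentiableAt ℝ (limPrim u) s := by
  have habs : Monotone (limPrim fun n s => |u n s|) :=
    monotone_limPrim hu.abs fun _ _ => abs_nonneg _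
  have hadd : Monotone (limPrim fun n s => |u n s| + u n s) :=
    monotone_limPrim (hu.abs.add hu) fun n s => by linarith [neg_abs_le (u n s)]
  rw [limPrim_add hu.abs hu] at hadd
  filter_upwards [ae_restrict_of_ae habs.ae_differentiableAt,
    ae_restrict_of_ae hadd.ae_differentiableAt] with s h₁ h₂
  simpa only [add_sub_cancel_left] using h₂.sub h₁

theorem weakLim_add (hu : IsLocBdd u) (hv : IsLocBdd v) :
    weakLim (fun n s => u n s + v n s) =ᵐ[halfLine] weakLim u + weakLim v := by
  filter_upwards [ae_differentiableAt_limPrim hu, ae_differentiableAt_limPrim hv] with s hus hvs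
  rw [weakLim, limPrim_add hu hv, deriv_add hus hvs]
  rfl

theorem weakLim_const_mul (hu : IsLocBdd u) (c : ℝ) :
    weakLim (fun n s => c * u n s) =ᵐ[halfLine] c • weakLim u := by
  filter_upwards [ae_differentiableAt_limPrim hu] with s hus
  rw [weakLim, limPrim_const_mul hu, deriv_const_mul c hus]
  rfl

theorem weakLim_congr (h : ∀ n, u n =ᵐ[halfLine] v n) : weakLim u = weakLim v := by
  have : limPrim u = limPrim v := funext fun t =>
    congrArg ulim (funext fun n => integral_congr_ae (ae_restrict_of_ae (h n)))
  rw [weakLim, this, weakLim]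

theorem hasDerivAt_le_of_sub_le {f g : ℝ → ℝ} {a b s x : ℝ} (hf : HasDerivAt f a s)
    (hg : HasDerivAt g b x) (h : ∀ δ, 0 < δ → f (s + δ) - f s ≤ g (x + δ) - g x) : a ≤ b := by
  have hf' := (hasDerivAt_iff_tendsto_slope_zero.1 hf).mono_left
    (nhdsWithin_mono 0 fun δ (hδ : δ ∈ Ioi 0) => ne_of_gt hδ)
  have hg' := (hasDerivAt_iff_tendsto_slope_zero.1 hg).mono_left
    (nhdsWithin_mono 0 fun δ (hδ : δ ∈ Ioi 0) => ne_of_gt hδ)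
  refine le_of_tendsto_of_tendsto hf' hg' ?_
  filter_upwards [self_mem_nhdsWithin] with δ hδ
  exact smul_le_smul_of_nonneg_left (h δ hδ) (inv_nonneg.2 (le_of_lt hδ))

theorem weakLim_mono (hu : IsLocBdd u) (hv : IsLocBdd v)
    (h : ∀ n, ∀ᵐ s ∂halfLine, u n s ≤ v n s) : weakLim u ≤ᵐ[halfLine] weakLim v := by
  filter_upwards [ae_differentiableAt_limPrim hu, ae_differentiableAt_limPrim hv] with s hus hvs
  exact hasDerivAt_le_of_sub_le hus.hasDerivAt hvs.hasDerivAt fun δ hδ =>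
    limPrim_sub_le hu hv h (by linarith)

theorem abs_weakLim_le (hu : IsLocBdd u) (hv : IsLocBdd v)
    (h : ∀ n, ∀ᵐ s ∂halfLine, |u n s| ≤ v n s) : ∀ᵐ s ∂halfLine, |weakLim u s| ≤ weakLim v s := by
  have hneg : IsLocBdd fun n s => -1 * u n s :=
    hu.mono (fun n => (hu.aestronglyMeasurable n).const_mul _) fun n => ae_of_all _ fun s => by simp
  filter_upwards [weakLim_mono hu hv fun n => (h n).mono fun s hs => (le_abs_self _).trans hs,
    weakLim_mono hneg hv fun n => (h n).mono fun s hs => by linarith [neg_abs_le (u n s)],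
    weakLim_const_mul hu (-1)] with s hle hneg_le hmul
  rw [hmul, Pi.smul_apply, smul_eq_mul, neg_one_mul] at hneg_le
  exact abs_le'.2 ⟨hle, hneg_le⟩

theorem lintegral_ofReal_deriv_le {f : ℝ → ℝ} (hf : Monotone f) {a b : ℝ} (hb : ∀ t, f t ≤ b) :
    ∫⁻ s in Ioi a, ENNReal.ofReal (deriv f s) ≤ ENNReal.ofReal (b - f a) := by
  have hU : Ioi a = ⋃ N : ℕ, Ioc a (a + N) := by
    ext s
    simp only [mem_Ioi, mem_iUnion, mem_Ioc, exists_and_left, iff_self_and]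
    exact fun _ => (exists_nat_ge (s - a)).imp fun N hN => by linarith
  have hdir : Monotone fun N : ℕ => Ioc a (a + N) := fun N M hNM =>
    Ioc_subset_Ioc_right (by gcongr)
  rw [hU, setLIntegral_iUnion_of_directed _ hdir.directed_le]
  refine iSup_le fun N => ?_
  have haN : a ≤ a + N := by simp
  have hm : MonotoneOn f (uIcc a (a + N)) := hf.monotoneOn _
  have hint := hm.intervalIntegrable_deriv
  have hle := hm.intervalIntegral_deriv_mem_uIcc
  rw [uIcc_of_le (sub_nonneg.2 (hf haN)), intervalIntegral.integral_of_le haN] at hle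
  rw [intervalIntegrable_iff_integrableOn_Ioc_of_le haN] at hint
  rw [← ofReal_integral_eq_lintegral_ofReal hint (ae_of_all _ fun s => hf.deriv_nonneg)]
  exact ENNReal.ofReal_le_ofReal (hle.2.trans (by linarith [hb (a + N)]))

theorem lintegral_weakLim_le_of_nonneg (hu : IsLocBdd u) (h0 : ∀ n s, 0 ≤ u n s) {C : ℝ≥0∞}
    (h : ∀ n, ∫⁻ s, ‖u n s‖ₑ ∂halfLine ≤ C) : ∫⁻ s, ENNReal.ofReal (weakLim u s) ∂halfLine ≤ C := by
  rcases eq_or_ne C ∞ with rfl | hC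
  · exact le_top
  have hle : ∀ t, limPrim u t ≤ C.toReal := fun t =>
    le_of_tendsto' (tendsto_limPrim hu t) fun n => by
      rw [← ENNReal.ofReal_le_iff_le_toReal hC, ← Real.enorm_eq_ofReal (integral_nonneg (h0 n))]
      exact (enorm_integral_le_lintegral_enorm _).trans
        ((setLIntegral_le_lintegral _ _).trans (h n))
  have hzero : 0 ≤ limPrim u 0 :=
    ge_of_tendsto' (tendsto_limPrim hu 0) fun n => integral_nonneg (h0 n)
  calc ∫⁻ s, ENNReal.ofReal (weakLim u s) ∂halfLine
      ≤ ENNReal.ofReal (C.toReal - limPrim u 0) :=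
        lintegral_ofReal_deriv_le (monotone_limPrim hu h0) hle
    _ ≤ C := (ENNReal.ofReal_le_ofReal (by linarith)).trans ENNReal.ofReal_toReal_le

theorem ae_hasDerivAt_setIntegral_Iic {f : ℝ → ℝ} (hf : ∀ t, IntegrableOn f (Iic t) halfLine) :
    ∀ᵐ s ∂halfLine, HasDerivAt (fun t => ∫ r in Iic t, f r ∂halfLine) (f s) s := by
  have hrestr : ∀ t, halfLine.restrict (Iic t) = (volume.restrict (Iic t)).restrict (Ioi 0) :=
    fun t => by
      rw [Measure.restrict_restrict measurableSet_Iic, inter_comm,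
        ← Measure.restrict_restrict measurableSet_Ioi]
  have hloc : LocallyIntegrable ((Ioi (0 : ℝ)).indicator f) volume := by
    rw [locallyIntegrable_iff]
    intro K hK
    obtain ⟨t, ht⟩ := hK.bddAbove
    have hft := hf t
    rw [IntegrableOn, hrestr] at hft
    exact ((integrable_indicator_iff measurableSet_Ioi).2 hft).mono_measure
      (Measure.restrict_mono (fun s hs => ht hs) le_rfl)
  filter_upwards [ae_restrict_of_ae (_root_.LocallyIntegrable.ae_hasDerivAt_integral hloc),
    ae_restrict_mem measurableSet_Ioi] with s hs hs0
  rw [← indicator_of_mem hs0 f]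
  refine (hs 0).congr_of_eventuallyEq ?_
  filter_upwards [Ioi_mem_nhds hs0] with t ht
  rw [intervalIntegral.integral_of_le (le_of_lt ht), setIntegral_indicator measurableSet_Ioi,
    Measure.restrict_restrict measurableSet_Iic, Iic_inter_Ioi,
    inter_eq_left.2 fun r (hr : r ∈ Ioc 0 t) => mem_Ioi.2 hr.1]

theorem weakLim_eq_of_tendsto {f g : ℝ → ℝ} (hg : ∀ t, IntegrableOn g (Iic t) halfLine)
    (hm : ∀ n, AEStronglyMeasurable (u n) halfLine) (hb : ∀ n, ∀ᵐ s ∂halfLine, |u n s| ≤ g s)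
    (hf : ∀ t, IntegrableOn f (Iic t) halfLine)
    (hlim : ∀ᵐ s ∂halfLine, Tendsto (fun n => u n s) atTop (𝓝 (f s))) :
    weakLim u =ᵐ[halfLine] f := by
  have hprim : limPrim u = fun t => ∫ r in Iic t, f r ∂halfLine := funext fun t =>
    Tendsto.limUnder_eq ((tendsto_integral_of_dominated_convergence g (fun n => (hm n).restrict)
      (hg t) (fun n => ae_restrict_of_ae (hb n)) (ae_restrict_of_ae hlim)).mono_left
        Nat.hyperfilter_le_atTop)
  filter_upwards [ae_hasDerivAt_setIntegral_Iic hf] with s hs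
  rw [weakLim, hprim, hs.deriv]

theorem integrableOn_const_Iic (c t : ℝ) : IntegrableOn (fun _ => c) (Iic t) halfLine :=
  integrableOn_const (halfLine_Iic_lt_top t).ne

theorem ae_abs_weakLim_le_const (hu : IsLocBdd u) {c : ℝ}
    (h : ∀ n, ∀ᵐ s ∂halfLine, |u n s| ≤ c) : ∀ᵐ s ∂halfLine, |weakLim u s| ≤ c := by
  have hc := integrableOn_const_Iic c
  have hm : AEStronglyMeasurable (fun _ : ℝ => c) halfLine := aestronglyMeasurable_const
  have hconst : weakLim (fun _ _ => c) =ᵐ[halfLine] fun _ => c :=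
    weakLim_eq_of_tendsto (integrableOn_const_Iic |c|) (fun _ => hm)
      (fun _ => ae_of_all _ fun _ => le_rfl)
      hc (ae_of_all _ fun _ => tendsto_const_nhds)
  filter_upwards [abs_weakLim_le hu (isLocBdd_const hc hm) h, hconst] with s hs hcs
  exact hs.trans_eq hcs

theorem setIntegral_Ioc_add_le_of_antitoneOn {f : ℝ → ℝ} (hf : AntitoneOn f (Ioi 0)) {x s δ : ℝ}
    (hx : 0 < x) (hxs : x ≤ s) (hδ : 0 < δ) :
    ∫ r in Ioc s (s + δ), f r ∂halfLine ≤ ∫ r in Ioc x (x + δ), f r ∂halfLine := by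
  have hs := hx.trans_le hxs
  have hpos : ∀ r ∈ uIcc x (x + δ), 0 < r := fun r hr => by
    rw [uIcc_of_le (by linarith)] at hr
    exact hx.trans_le hr.1
  have hshift : ∀ r ∈ uIcc x (x + δ), 0 < r + (s - x) := fun r hr => by linarith [hpos r hr]
  have hint : IntervalIntegrable f volume x (x + δ) := (hf.mono hpos).intervalIntegrable
  have hint_shift : IntervalIntegrable (fun r => f (r + (s - x))) volume x (x + δ) :=
    AntitoneOn.intervalIntegrable fun r hr r' hr' hrr' =>
      hf (hshift r hr) (hshift r' hr') (by linarith)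
  rw [halfLine_restrict_Ioc hx.le, halfLine_restrict_Ioc hs.le,
    ← intervalIntegral.integral_of_le (by linarith),
    ← intervalIntegral.integral_of_le (by linarith)]
  calc ∫ r in s..s + δ, f r = ∫ r in x + (s - x)..x + δ + (s - x), f r := by
        congr 1 <;> ring
    _ = ∫ r in x..x + δ, f (r + (s - x)) :=
        (intervalIntegral.integral_comp_add_right f (s - x)).symm
    _ ≤ ∫ r in x..x + δ, f r :=
        intervalIntegral.integral_mono_on (by linarith) hint_shift hint fun r hr =>
          hf (hpos r (Icc_subset_uIcc hr)) (hshift r (Icc_subset_uIcc hr)) (by linarith)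

theorem antitoneOn_weakLim (hu : IsLocBdd u) (h : ∀ n, AntitoneOn (u n) (Ioi 0)) :
    AntitoneOn (weakLim u) {s | 0 < s ∧ DifferentiableAt ℝ (limPrim u) s} :=
  fun _ hx _ hs hxs => hasDerivAt_le_of_sub_le hs.2.hasDerivAt hx.2.hasDerivAt fun _ hδ =>
    le_of_tendsto_of_tendsto' (tendsto_limPrim_sub hu (by linarith))
      (tendsto_limPrim_sub hu (by linarith)) fun n =>
      setIntegral_Ioc_add_le_of_antitoneOn (h n) hx.1 hxs hδ

variable {k : ℕ → L0} {w : L0}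

theorem nrm_one_le_of_weakLim (hk : IsLocBdd fun n => k n)
    (hw : w =ᵐ[halfLine] weakLim fun n => k n) {C : ℝ≥0∞}
    (hC : ∀ n, (lebesgue 1).nrm (k n) ≤ C) : (lebesgue 1).nrm w ≤ C := by
  rw [nrm_one_eq]
  calc ∫⁻ s, ‖w s‖ₑ ∂halfLine
      ≤ ∫⁻ s, ENNReal.ofReal (weakLim (fun n s => |k n s|) s) ∂halfLine := by
        refine lintegral_mono_ae ?_
        filter_upwards [hw, abs_weakLim_le hk hk.abs fun n => ae_of_all _ fun s => le_rfl]
          with s hs hle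
        rw [hs, Real.enorm_eq_ofReal_abs]
        exact ENNReal.ofReal_le_ofReal hle
    _ ≤ C := lintegral_weakLim_le_of_nonneg hk.abs (fun _ _ => abs_nonneg _) fun n => by
        simpa only [Real.enorm_abs, nrm_one_eq] using hC n

theorem nrm_top_le_of_weakLim (hk : IsLocBdd fun n => k n)
    (hw : w =ᵐ[halfLine] weakLim fun n => k n) {C : ℝ≥0∞}
    (hC : ∀ n, (lebesgue ∞).nrm (k n) ≤ C) : (lebesgue ∞).nrm w ≤ C := by
  rcases eq_or_ne C ∞ with rfl | hC'
  · exact le_top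
  have hbdd : ∀ n, ∀ᵐ s ∂halfLine, |k n s| ≤ C.toReal := fun n => by
    filter_upwards [ae_le_nrm_top (k n)] with s hs
    rw [← ENNReal.ofReal_le_iff_le_toReal hC', ← Real.enorm_eq_ofReal_abs]
    exact hs.trans (hC n)
  refine nrm_top_le ?_
  filter_upwards [hw, ae_abs_weakLim_le_const hk hbdd] with s hs hle
  rw [hs, Real.enorm_eq_ofReal_abs]
  exact ENNReal.ofReal_le_of_le_toReal hle

theorem tildeNorm_le_of_weakLim (hk : IsLocBdd fun n => k n)
    (hw : w =ᵐ[halfLine] weakLim fun n => k n) {C : ℝ≥0∞} (hC : ∀ n, tildeNorm (k n) ≤ C) :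
    tildeNorm w ≤ C := by
  rcases eq_or_ne C ∞ with rfl | hC'
  · exact le_top
  have hfin : ∀ n s, 0 < s → ldmE (k n) s < ∞ := fun n s hs =>
    ldmE_lt_top_of_tildeNorm ((hC n).trans_lt hC'.lt_top) hs
  let v : ℕ → ℝ → ℝ := fun n s => (ldmE (k n) s).toReal
  have hvC : ∀ n, ∫⁻ s, ‖v n s‖ₑ ∂halfLine ≤ C := fun n => (hC n).trans' (lintegral_mono_ae
    (ae_halfLine_of_forall_pos fun s hs => (Real.enorm_toReal (hfin n s hs).ne).le))
  have hv : IsLocBdd v := isLocBdd_of_lintegral_le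
    (fun n => (measurable_ldmE (k n)).ennreal_toReal.aestronglyMeasurable) hC'.lt_top hvC
  have hvanti : ∀ n, AntitoneOn (v n) (Ioi 0) := fun n x hx s _ hxs =>
    ENNReal.toReal_mono (hfin n x hx).ne (ldmE_antitone _ hxs)
  have hkv : ∀ n, ∀ᵐ s ∂halfLine, |k n s| ≤ v n s := fun n => by
    filter_upwards [ae_le_ldmE (k n), ae_restrict_mem measurableSet_Ioi] with s hs hs0
    rwa [← ENNReal.ofReal_le_iff_le_toReal (hfin n s hs0).ne, ← Real.enorm_eq_ofReal_abs]
  have hdiff := (ae_restrict_mem measurableSet_Ioi).and (ae_differentiableAt_limPrim hv)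
  have hldm : ∀ᵐ x ∂halfLine, ldmE w x ≤ ENNReal.ofReal (weakLim v x) := by
    filter_upwards [hdiff] with x hx
    refine essSup_le_of_ae_le _ ?_
    filter_upwards [ae_restrict_of_ae hw, ae_restrict_of_ae (abs_weakLim_le hk hv hkv),
      ae_restrict_of_ae hdiff, ae_restrict_mem measurableSet_Ici] with s hws hle hs hxs
    rw [hws, Real.enorm_eq_ofReal_abs]
    exact ENNReal.ofReal_le_ofReal (hle.trans (antitoneOn_weakLim hv hvanti hx hs hxs))
  exact (lintegral_mono_ae hldm).trans
    (lintegral_weakLim_le_of_nonneg hv (fun _ _ => ENNReal.toReal_nonneg) hvC)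

end WeakLimits

section Orbits

/-- A couple `(Y₀, L^∞)` of function spaces on the half line with `Y₀ ⊆ L¹`, such that `Y₀` is a
lattice whose unit ball is closed under weak limits. -/
structure IsFunctionCouple (Y : BanachCouple L0) : Prop where
  top : Y.X₁ = lebesgue ∞
  nrm_one_le : ∀ k, (lebesgue 1).nrm k ≤ Y.X₀.nrm k
  mono : ∀ k k' : L0, (∀ᵐ s ∂halfLine, ‖k s‖ₑ ≤ ‖k' s‖ₑ) → Y.X₀.nrm k ≤ Y.X₀.nrm k'
  closed : ∀ (k : ℕ → L0) (w : L0), IsLocBdd (fun n => k n) →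
    w =ᵐ[halfLine] weakLim (fun n => k n) → ∀ C, (∀ n, Y.X₀.nrm (k n) ≤ C) → Y.X₀.nrm w ≤ C

theorem isFunctionCouple_coupleL : IsFunctionCouple coupleL where
  top := rfl
  nrm_one_le _ := le_rfl
  mono _ _ h := eLpNorm_mono_enorm_ae h
  closed _ _ hk hw _ h := nrm_one_le_of_weakLim hk hw h

theorem isFunctionCouple_coupleTildeL : IsFunctionCouple coupleTildeL where
  top := rfl
  nrm_one_le := nrm_one_le_tildeNorm
  mono _ _ h := lintegral_mono fun x => ldmE_mono h x
  closed _ _ hk hw _ h := tildeNorm_le_of_weakLim hk hw h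

variable {V : Type*} [AddCommGroup V] [Module ℝ V] {X : BanachCouple V} {Y : BanachCouple L0}

theorem IsFunctionCouple.mono_top (hY : IsFunctionCouple Y) {k k' : L0}
    (h : ∀ᵐ s ∂halfLine, ‖k s‖ₑ ≤ ‖k' s‖ₑ) : Y.X₁.nrm k ≤ Y.X₁.nrm k' := by
  rw [hY.top]
  change eLpNorm k ∞ halfLine ≤ eLpNorm k' ∞ halfLine
  exact eLpNorm_mono_enorm_ae h

theorem IsFunctionCouple.sum_le (hY : IsFunctionCouple Y) : Y.sum ≤ coupleL.sum :=
  sup_le_sup (fun x hx => lt_of_le_of_lt (hY.nrm_one_le x) hx)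
    (le_of_eq (congrArg BanachSubspace.carrier hY.top))

theorem isLocBdd_of_isContraction (hY : IsFunctionCouple Y) {T : ℕ → X.sum →ₗ[ℝ] L0}
    (hT : ∀ n, IsContraction X Y (T n)) (h : X.sum) : IsLocBdd fun n => T n h := by
  refine ⟨fun n => (T n h).aestronglyMeasurable, fun t => ?_⟩
  obtain ⟨a, b, rfl⟩ := X.exists_add_eq h
  refine ⟨X.X₀.nrm a + X.X₁.nrm b * halfLine (Iic t), ENNReal.add_lt_top.2
    ⟨a.2, ENNReal.mul_lt_top b.2 (halfLine_Iic_lt_top t)⟩, fun n => ?_⟩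
  rw [map_add]
  refine (setLIntegral_enorm_add_le _ _ _).trans ?_
  gcongr
  · exact (hY.nrm_one_le _).trans ((hT n).nrm₀_le _)
  · exact hY.top ▸ (hT n).nrm₁_le (X.incl₁ b)

theorem weakLim_map_add (hY : IsFunctionCouple Y) {T : ℕ → X.sum →ₗ[ℝ] L0}
    (hT : ∀ n, IsContraction X Y (T n)) (a b : X.sum) :
    weakLim (fun n => T n (a + b)) =ᵐ[halfLine]
      fun t => weakLim (fun n => T n a) t + weakLim (fun n => T n b) t := by
  have hadd : ∀ n, ⇑(T n (a + b)) =ᵐ[halfLine] fun s => T n a s + T n b s := fun n => by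
    rw [map_add]
    exact AEEqFun.coeFn_add _ _
  rw [weakLim_congr hadd]
  exact weakLim_add (isLocBdd_of_isContraction hY hT a) (isLocBdd_of_isContraction hY hT b)

theorem weakLim_map_smul (hY : IsFunctionCouple Y) {T : ℕ → X.sum →ₗ[ℝ] L0}
    (hT : ∀ n, IsContraction X Y (T n)) (c : ℝ) (a : X.sum) :
    weakLim (fun n => T n (c • a)) =ᵐ[halfLine] fun t => c * weakLim (fun n => T n a) t := by
  have hsmul : ∀ n, ⇑(T n (c • a)) =ᵐ[halfLine] fun s => c * T n a s := fun n => by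
    rw [map_smul]
    exact AEEqFun.coeFn_smul _ _
  rw [weakLim_congr hsmul]
  exact weakLim_const_mul (isLocBdd_of_isContraction hY hT a) c

theorem exists_isContraction_weakLim (hY : IsFunctionCouple Y) {T : ℕ → X.sum →ₗ[ℝ] L0}
    (hT : ∀ n, IsContraction X Y (T n)) :
    ∃ S : X.sum →ₗ[ℝ] L0, IsContraction X Y S ∧
      ∀ h, S h =ᵐ[halfLine] weakLim fun n => T n h := by
  have hb := isLocBdd_of_isContraction hY hT
  let S := linOfRep (fun h : X.sum => weakLim fun n => T n h)
    (fun _ => (measurable_deriv _).aestronglyMeasurable)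
    (weakLim_map_add hY hT) (weakLim_map_smul hY hT)
  have hS : ∀ h, S h =ᵐ[halfLine] weakLim fun n => T n h := linOfRep_ae
  refine ⟨S, ⟨fun h => hY.closed _ _ (hb h) (hS h) _ fun n => (hT n).nrm₀_le h, fun h => ?_⟩, hS⟩
  have htop := fun n => (hT n).nrm₁_le h
  rw [hY.top] at htop ⊢
  exact nrm_top_le_of_weakLim (hb h) (hS h) htop

theorem exists_multiplier {x y : L0} (h : ∀ᵐ s ∂halfLine, ‖y s‖ₑ ≤ ‖x s‖ₑ) :
    ∃ S : L0 →ₗ[ℝ] L0, S x = y ∧ ∀ v, ∀ᵐ s ∂halfLine, ‖S v s‖ₑ ≤ ‖v s‖ₑ := by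
  let S := linOfRep (V := L0) (fun v s => y s / x s * v s)
    (fun v => ((y.aestronglyMeasurable.aemeasurable.div x.aestronglyMeasurable.aemeasurable).mul
      v.aestronglyMeasurable.aemeasurable).aestronglyMeasurable)
    (fun v w => by
      filter_upwards [AEEqFun.coeFn_add v w] with s hs
      simp only [hs, Pi.add_apply, mul_add])
    (fun a v => by
      filter_upwards [AEEqFun.coeFn_smul a v] with s hs
      simp only [hs, Pi.smul_apply, smul_eq_mul]
      ring)
  have hS : ∀ v : L0, S v =ᵐ[halfLine] fun s => y s / x s * v s := linOfRep_ae
  refine ⟨S, AEEqFun.ext ?_, fun v => ?_⟩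
  · filter_upwards [hS x, h] with s hSx hs
    rw [hSx, div_mul_cancel_of_imp]
    intro hx
    simpa [hx] using hs
  · filter_upwards [hS v, h] with s hSv hs
    rw [hSv, enorm_mul]
    refine mul_le_of_le_one_left zero_le ?_
    rw [Real.enorm_eq_ofReal_abs, ENNReal.ofReal_le_one, abs_div]
    exact div_le_one_of_le₀ (enorm_le_enorm_iff_abs_le.1 hs) (abs_nonneg _)

theorem IsContraction.multiplier_comp (hY : IsFunctionCouple Y) {T : X.sum →ₗ[ℝ] L0}
    (hT : IsContraction X Y T) {S : L0 →ₗ[ℝ] L0}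
    (hS : ∀ v, ∀ᵐ s ∂halfLine, ‖S v s‖ₑ ≤ ‖v s‖ₑ) : IsContraction X Y (S.comp T) :=
  ⟨fun h => (hY.mono _ _ (hS _)).trans (hT.nrm₀_le h),
    fun h => (hY.mono_top (hS _)).trans (hT.nrm₁_le h)⟩

theorem inOrbit_of_enorm_le (hY : IsFunctionCouple Y) {T : X.sum →ₗ[ℝ] L0}
    (hT : IsContraction X Y T) {x : X.sum} {y : L0} (h : ∀ᵐ s ∂halfLine, ‖y s‖ₑ ≤ ‖T x s‖ₑ) :
    InOrbit X Y x y := by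
  obtain ⟨S, hSx, hS⟩ := exists_multiplier h
  exact ⟨_, hT.multiplier_comp hY hS, hSx⟩

theorem inOrbit_of_ae_le (hY : IsFunctionCouple Y) (x : Y.sum) {y : L0}
    (h : ∀ᵐ s ∂halfLine, ‖y s‖ₑ ≤ ‖(x : L0) s‖ₑ) : InOrbit Y Y x y :=
  inOrbit_of_enorm_le hY (isContraction_subtype Y) h

theorem inOrbit_abs (hY : IsFunctionCouple Y) (x : Y.sum) : InOrbit Y Y x |(x : L0)| :=
  inOrbit_of_ae_le hY x ((AEEqFun.coeFn_abs (x : L0)).mono fun s hs => by rw [hs, Real.enorm_abs])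

theorem inOrbit_of_approx (hY : IsFunctionCouple Y) {T : ℕ → X.sum →ₗ[ℝ] L0}
    (hT : ∀ n, IsContraction X Y (T n)) {x : X.sum} {y : L0} (hy : y ∈ Y.sum) {w : ℕ → ℝ → ℝ}
    (hwm : ∀ n, AEStronglyMeasurable (w n) halfLine)
    (hw : ∀ n, ∀ᵐ s ∂halfLine, w n s ≤ T n x s)
    (hwy : ∀ n, ∀ᵐ s ∂halfLine, |w n s| ≤ |y s|)
    (hlim : ∀ᵐ s ∂halfLine, Tendsto (fun n => w n s) atTop (𝓝 |y s|)) : InOrbit X Y x y := by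
  obtain ⟨S, hS, hSw⟩ := exists_isContraction_weakLim hY hT
  have hyi : ∀ t, IntegrableOn (fun s => |y s|) (Iic t) halfLine := fun t =>
    (integrableOn_of_mem_sum (hY.sum_le hy) (halfLine_Iic_lt_top t)).abs
  have hwb : IsLocBdd w := (isLocBdd_const hyi y.aestronglyMeasurable.norm).mono hwm fun n =>
    (hwy n).mono fun s hs => enorm_le_enorm_iff_abs_le.2 (hs.trans_eq (abs_abs _).symm)
  refine inOrbit_of_enorm_le hY hS ?_
  filter_upwards [weakLim_mono hwb (isLocBdd_of_isContraction hY hT x) hw,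
    weakLim_eq_of_tendsto hyi hwm hwy hyi hlim, hSw x] with s hle heq hSs
  rw [enorm_le_enorm_iff_abs_le, hSs, ← heq]
  exact hle.trans (le_abs_self _)

end Orbits

section Truncation

theorem abs_sub_clamp_le {r : ℝ} (hr : 0 ≤ r) (x : ℝ) :
    |x - max (-r) (min r x)| ≤ max (|x| - r) 0 := by
  rcases le_total r x with h | h
  · rw [min_eq_left h, max_eq_right (by linarith), abs_of_nonneg (by linarith),
      abs_of_nonneg (by linarith)]
    exact le_max_left _ _
  rw [min_eq_right h]
  rcases le_total x (-r) with h' | h'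
  · rw [max_eq_left h', abs_of_nonpos (by linarith), abs_of_nonpos (by linarith)]
    exact le_max_of_le_left (by linarith)
  · simp [max_eq_right h']

theorem exists_truncation (x : L0) {c : ℝ≥0∞} (hc : c < ∞) : ∃ x₀ x₁ : L0, x₀ + x₁ = x ∧
    (∀ᵐ s ∂halfLine, ‖x₀ s‖ₑ ≤ ‖x s‖ₑ - c) ∧ (lebesgue ∞).nrm x₁ ≤ c := by
  lift c to ℝ≥0 using hc.ne
  have hm : Measurable fun s => max (-(c : ℝ)) (min (c : ℝ) (x s)) :=
    measurable_const.max (measurable_const.min x.measurable)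
  let x₁ : L0 := AEEqFun.mk _ hm.aestronglyMeasurable
  have hx₁ : x₁ =ᵐ[halfLine] fun s => max (-(c : ℝ)) (min (c : ℝ) (x s)) := AEEqFun.coeFn_mk _ _
  refine ⟨x - x₁, x₁, sub_add_cancel _ _, ?_, nrm_top_le ?_⟩
  · filter_upwards [AEEqFun.coeFn_sub x x₁, hx₁] with s hsub hs
    rw [hsub, Pi.sub_apply, hs, Real.enorm_eq_ofReal_abs, Real.enorm_eq_ofReal_abs,
      ← ENNReal.ofReal_coe_nnreal, ← ENNReal.ofReal_sub _ c.coe_nonneg]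
    refine (ENNReal.ofReal_le_ofReal (abs_sub_clamp_le c.coe_nonneg _)).trans_eq ?_
    rw [ENNReal.ofReal_max, ENNReal.ofReal_zero, max_eq_left zero_le]
  · filter_upwards [hx₁] with s hs
    rw [hs, Real.enorm_eq_ofReal_abs, ← ENNReal.ofReal_coe_nnreal]
    exact ENNReal.ofReal_le_ofReal
      (abs_le.2 ⟨le_max_left _ _, max_le (neg_le_self c.coe_nonneg) (min_le_left _ _)⟩)

theorem tildeNorm_le_lintegral_sub {u v : L0} {q : ℝ → ℝ≥0∞} (hq : Antitone q) {c : ℝ≥0∞}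
    (huv : ∀ᵐ s ∂halfLine, ‖u s‖ₑ ≤ ‖v s‖ₑ - c) (hv : ∀ᵐ s ∂halfLine, ‖v s‖ₑ ≤ q s) :
    tildeNorm u ≤ ∫⁻ s, (q s - c) ∂halfLine := by
  refine tildeNorm_le_of_antitoneOn
    (Antitone.antitoneOn (fun s t hst => tsub_le_tsub_right (hq hst) c) _) ?_
  filter_upwards [huv, hv] with s hu hv
  exact hu.trans (tsub_le_tsub_right hv c)

theorem mem_coupleTildeL_sum_of_antitone {u : L0} {q : ℝ → ℝ≥0∞} (hq : Antitone q)
    (hu : ∀ᵐ s ∂halfLine, ‖u s‖ₑ ≤ q s) {c : ℝ≥0∞} (hc : c < ∞)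
    (hint : ∫⁻ s, (q s - c) ∂halfLine < ∞) : u ∈ coupleTildeL.sum := by
  obtain ⟨u₀, u₁, rfl, h₀, h₁⟩ := exists_truncation u hc
  exact Submodule.add_mem_sup ((tildeNorm_le_lintegral_sub hq h₀ hu).trans_lt hint)
    (h₁.trans_lt hc)

end Truncation

section StepOperators

theorem setAverage_add_of_mem_sum {P : Set ℝ} (hP : halfLine P < ∞) {h k : L0}
    (hh : h ∈ coupleL.sum) (hk : k ∈ coupleL.sum) :
    ⨍ s in P, (h + k : L0) s ∂halfLine = ⨍ s in P, h s ∂halfLine + ⨍ s in P, k s ∂halfLine := by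
  rw [setAverage_eq, setAverage_eq, setAverage_eq, ← smul_add, setIntegral_add_of_mem_sum hP hh hk]

theorem setAverage_const_smul (P : Set ℝ) (c : ℝ) (h : L0) :
    ⨍ s in P, (c • h : L0) s ∂halfLine = c * ⨍ s in P, h s ∂halfLine := by
  rw [setAverage_eq, setAverage_eq, setIntegral_const_smul, smul_eq_mul, smul_eq_mul,
    mul_left_comm]

theorem enorm_setAverage_le (P : Set ℝ) (h : ℝ → ℝ) :
    ‖⨍ s in P, h s ∂halfLine‖ₑ ≤ ⨍⁻ s in P, ‖h s‖ₑ ∂halfLine :=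
  enorm_integral_le_lintegral_enorm _

theorem enorm_setAverage_le_of_ae {P : Set ℝ} {h : ℝ → ℝ} {C : ℝ≥0∞}
    (hC : ∀ᵐ s ∂halfLine.restrict P, ‖h s‖ₑ ≤ C) : ‖⨍ s in P, h s ∂halfLine‖ₑ ≤ C := by
  refine (enorm_setAverage_le P h).trans ?_
  rw [setLAverage_eq]
  refine ENNReal.div_le_of_le_mul ?_
  exact (lintegral_mono_ae hC).trans_eq (setLIntegral_const _ _)

theorem exists_stepOperator {X : BanachCouple L0} (hX : X.sum ≤ coupleL.sum) {ι : Type*}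
    [MeasurableSpace ι] [DiscreteMeasurableSpace ι] {κ : ℝ → ι} (hκ : Measurable κ)
    {P : ι → Set ℝ} (hP : ∀ i, halfLine (P i) < ∞) :
    ∃ T : X.sum →ₗ[ℝ] L0,
      ∀ h, T h =ᵐ[halfLine] fun s => ⨍ y in P (κ s), (h : L0) y ∂halfLine :=
  ⟨linOfRep (fun (h : X.sum) s => ⨍ y in P (κ s), (h : L0) y ∂halfLine)
    (fun h => ((Measurable.of_discrete (f := fun i =>
      ⨍ y in P i, (h : L0) y ∂halfLine)).comp hκ).aestronglyMeasurable)
    (fun h k => Eventually.of_forall fun _ =>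
      setAverage_add_of_mem_sum (hP _) (hX h.2) (hX k.2))
    (fun c h => Eventually.of_forall fun _ => setAverage_const_smul _ c (h : L0)), linOfRep_ae⟩

theorem nrm_top_le_of_ae_eq_setAverage {P : ℝ → Set ℝ} {w h : L0}
    (hw : w =ᵐ[halfLine] fun s => ⨍ y in P s, h y ∂halfLine) :
    (lebesgue ∞).nrm w ≤ (lebesgue ∞).nrm h := by
  refine nrm_top_le ?_
  filter_upwards [hw] with s hs
  rw [hs]
  exact enorm_setAverage_le_of_ae (ae_restrict_of_ae (ae_le_nrm_top h))

end StepOperators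

section Grid

/-- The index of the least point of the grid `ℕ / (n + 1)` that is `≥ s`. -/
def gridIndex (n : ℕ) (s : ℝ) : ℕ := ⌈s * (n + 1)⌉₊

/-- The least point of the grid `ℕ / (n + 1)` that is `≥ s`. -/
def gridUp (n : ℕ) (s : ℝ) : ℝ := gridIndex n s / (n + 1)

theorem measurable_gridIndex (n : ℕ) : Measurable (gridIndex n) :=
  Nat.measurable_ceil.comp (measurable_id.mul_const _)

theorem measurable_comp_gridUp (n : ℕ) (f : ℝ → ℝ) : Measurable fun s => f (gridUp n s) :=
  (measurable_from_top (f := fun i : ℕ => f (i / (n + 1)))).comp (measurable_gridIndex n)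

theorem le_gridUp (n : ℕ) (s : ℝ) : s ≤ gridUp n s := by
  rw [gridUp, le_div_iff₀ n.cast_add_one_pos]
  exact Nat.le_ceil _

theorem gridUp_eq_of_mem_Ioc {n i : ℕ} {s : ℝ}
    (hs : s ∈ Ioc ((i : ℝ) / (n + 1)) ((i + 1 : ℕ) / (n + 1))) :
    gridUp n s = (i + 1 : ℕ) / (n + 1) := by
  have hn : (0 : ℝ) < n + 1 := n.cast_add_one_pos
  rw [gridUp, gridIndex, (Nat.ceil_eq_iff i.succ_ne_zero).2
    ⟨(div_lt_iff₀ hn).1 hs.1, (le_div_iff₀ hn).1 hs.2⟩]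

theorem le_gridUp_of_lt {n i : ℕ} {s : ℝ} (hs : (i : ℝ) / (n + 1) < s) :
    ((i + 1 : ℕ) : ℝ) / (n + 1) ≤ gridUp n s := by
  have hi : i + 1 ≤ gridIndex n s := Nat.lt_ceil.2 ((div_lt_iff₀ n.cast_add_one_pos).1 hs)
  rw [gridUp]
  gcongr

theorem gridUp_lt (n : ℕ) {s : ℝ} (hs : 0 ≤ s) : gridUp n s < s + 1 / (n + 1) := by
  have hn : (0 : ℝ) < n + 1 := n.cast_add_one_pos
  rw [gridUp, div_lt_iff₀ hn, add_mul, one_div_mul_cancel hn.ne']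
  exact Nat.ceil_lt_add_one (by positivity)

theorem tendsto_gridUp {s : ℝ} (hs : 0 ≤ s) : Tendsto (fun n => gridUp n s) atTop (𝓝 s) := by
  have h : Tendsto (fun n : ℕ => s + 1 / ((n : ℝ) + 1)) atTop (𝓝 (s + 0)) :=
    tendsto_const_nhds.add tendsto_one_div_add_atTop_nhds_zero_nat
  rw [add_zero] at h
  exact tendsto_of_tendsto_of_tendsto_of_le_of_le tendsto_const_nhds h
    (fun n => le_gridUp n s) fun n => (gridUp_lt n hs).le

theorem ae_tendsto_comp_gridUp {q : ℝ → ℝ≥0∞} (hq : Antitone q) (hfin : ∀ s, 0 < s → q s < ∞) :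
    ∀ᵐ s ∂halfLine, Tendsto (fun n => (q (gridUp n s)).toReal) atTop (𝓝 (q s).toReal) := by
  have hcont : ∀ᵐ s ∂halfLine, ContinuousAt q s :=
    hq.countable_not_continuousAt.measure_zero _
  filter_upwards [hcont, ae_restrict_mem measurableSet_Ioi] with s hs hs₀
  exact (ENNReal.tendsto_toReal (hfin s hs₀).ne).comp
    (hs.tendsto.comp (tendsto_gridUp (le_of_lt hs₀)))

end Grid

section Majorant

theorem ldm_ae (f : L0) : ldm f =ᵐ[halfLine] fun s => (ldmE f s).toReal :=
  AEEqFun.coeFn_mk _ _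

theorem ldm_mem_coupleTildeL_sum {f : L0} (hf : f ∈ coupleTildeL.sum) :
    ldm f ∈ coupleTildeL.sum := by
  obtain ⟨f₀, h₀, f₁, h₁, rfl⟩ := Submodule.mem_sup.1 hf
  refine mem_coupleTildeL_sum_of_antitone (ldmE_antitone (f₀ + f₁)) ?_
    (c := (lebesgue ∞).nrm f₁) h₁ (lt_of_le_of_lt (lintegral_mono fun x => ?_) h₀)
  · filter_upwards [ldm_ae (f₀ + f₁), ae_halfLine_of_forall_pos fun s => ldmE_lt_top hf]
      with s hs hfin
    rw [hs, Real.enorm_toReal hfin.ne]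
  · rw [tsub_le_iff_right]
    exact (ldmE_add_le f₀ f₁ x).trans (by gcongr; exact ldmE_le_nrm_top f₁ x)

theorem measure_setOf_mul_ldmE_le_pos (f : L0) {t : ℝ} (ht : 0 < t) (hf : ldmE f t < ∞) {θ : ℝ≥0∞}
    (hθ : θ < 1) : 0 < halfLine (Ici t ∩ {s | θ * ldmE f t ≤ ‖f s‖ₑ}) := by
  rw [pos_iff_ne_zero]
  intro hnull
  have hle : ldmE f t ≤ θ * ldmE f t := by
    refine essSup_le_of_ae_le _ ?_
    rw [EventuallyLE, ae_restrict_iff' measurableSet_Ici]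
    filter_upwards [measure_eq_zero_iff_ae_notMem.1 hnull] with s hs hst
    by_contra hlt
    exact hs ⟨hst, (not_le.1 hlt).le⟩
  have hzero : ldmE f t = 0 := by
    by_contra hne
    have hlt := ENNReal.mul_lt_mul_left hne hf.ne hθ
    rw [one_mul] at hlt
    exact hlt.not_ge hle
  have hIoc : halfLine (Ioc t (t + 1)) ≤ 0 := by
    rw [← hnull]
    exact measure_mono fun s hs => ⟨hs.1.le, by simp [hzero]⟩
  rw [halfLine_Ioc ht.le] at hIoc
  simp at hIoc

theorem exists_subset_near_ldmE (f : L0) {t : ℝ} (ht : 0 < t) (hf : ldmE f t < ∞) {θ : ℝ≥0∞}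
    (hθ : θ < 1) : ∃ P ⊆ Ici t, MeasurableSet P ∧ halfLine P ≠ 0 ∧ halfLine P < ∞ ∧
      ∀ s ∈ P, θ * ldmE f t ≤ ‖f s‖ₑ := by
  have hD : MeasurableSet (Ici t ∩ {s | θ * ldmE f t ≤ ‖f s‖ₑ}) :=
    measurableSet_Ici.inter (measurableSet_le measurable_const f.measurable.enorm)
  obtain ⟨P, hPm, hPs, hP₀, hP⟩ :=
    Measure.exists_subset_measure_lt_top hD (measure_setOf_mul_ldmE_le_pos f ht hf hθ)
  exact ⟨P, hPs.trans inter_subset_left, hPm, hP₀.ne', hP, fun s hs => (hPs hs).2⟩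

theorem tildeNorm_le_of_ae_eq_setAverage {n : ℕ} {P : ℕ → Set ℝ}
    (hP : ∀ i : ℕ, P i ⊆ Ici ((i : ℝ) / (n + 1))) {w h : L0}
    (hw : w =ᵐ[halfLine] fun s => ⨍ y in P (gridIndex n s), h y ∂halfLine) :
    tildeNorm w ≤ tildeNorm h := by
  refine tildeNorm_le_of_antitoneOn ((ldmE_antitone h).antitoneOn _) ?_
  filter_upwards [hw] with s hs
  rw [hs]
  have hess : ∀ᵐ y ∂halfLine.restrict (Ici (gridUp n s)), ‖h y‖ₑ ≤ ldmE h (gridUp n s) :=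
    ENNReal.ae_le_essSup _
  exact (enorm_setAverage_le_of_ae (ae_mono (Measure.restrict_mono (hP _) le_rfl) hess)).trans
    (ldmE_antitone h (le_gridUp n s))

theorem exists_isContraction_mul_ldmE_le {f : coupleTildeL.sum}
    (hf : ∀ᵐ s ∂halfLine, 0 ≤ (f : L0) s) (n : ℕ) {θ : ℝ} (hθ₀ : 0 ≤ θ) (hθ : θ < 1) :
    ∃ T, IsContraction coupleTildeL coupleTildeL T ∧
      ∀ᵐ s ∂halfLine, θ * (ldmE f (gridUp n s)).toReal ≤ T f s := by
  have hex : ∀ i : ℕ, ∃ P ⊆ Ici ((i : ℝ) / (n + 1)), MeasurableSet P ∧ halfLine P < ∞ ∧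
      (0 < i → halfLine P ≠ 0 ∧ ∀ s ∈ P,
        ENNReal.ofReal θ * ldmE f ((i : ℝ) / (n + 1)) ≤ ‖(f : L0) s‖ₑ) := by
    intro i
    rcases i.eq_zero_or_pos with rfl | hi
    · exact ⟨∅, empty_subset _, MeasurableSet.empty, by simp, fun h => absurd h (lt_irrefl 0)⟩
    · have ht : 0 < (i : ℝ) / (n + 1) := by positivity
      obtain ⟨P, hPs, hPm, hP₀, hP, hPf⟩ := exists_subset_near_ldmE f ht (ldmE_lt_top f.2 ht)
        (θ := ENNReal.ofReal θ) (ENNReal.ofReal_lt_one.2 hθ)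
      exact ⟨P, hPs, hPm, hP, fun _ => ⟨hP₀, hPf⟩⟩
  choose P hPs hPm hP hPf using hex
  obtain ⟨T, hT⟩ := exists_stepOperator coupleTildeL_sum_le (measurable_gridIndex n) hP
  refine ⟨T, ⟨fun h => tildeNorm_le_of_ae_eq_setAverage hPs (hT h),
    fun h => nrm_top_le_of_ae_eq_setAverage (hT h)⟩, ?_⟩
  filter_upwards [hT f, ae_restrict_mem measurableSet_Ioi] with s hs hs₀
  have hi : 0 < gridIndex n s := Nat.ceil_pos.2 (mul_pos hs₀ n.cast_add_one_pos)
  have hfin := ldmE_lt_top f.2 (lt_of_lt_of_le hs₀ (le_gridUp n s))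
  rw [hs]
  refine (convex_Ici _).set_average_mem isClosed_Ici (hPf _ hi).1 (hP _).ne ?_
    (integrableOn_of_mem_sum (coupleTildeL_sum_le f.2) (hP _))
  filter_upwards [ae_restrict_mem (hPm _), ae_restrict_of_ae hf] with y hy hy₀
  rw [mem_Ici, ← ENNReal.ofReal_le_ofReal_iff hy₀, ← Real.enorm_eq_ofReal hy₀,
    ENNReal.ofReal_mul hθ₀, ENNReal.ofReal_toReal hfin.ne]
  exact (hPf _ hi).2 y hy

theorem inOrbit_ldm_of_nonneg {f : coupleTildeL.sum} (hf : ∀ᵐ s ∂halfLine, 0 ≤ (f : L0) s) :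
    InOrbit coupleTildeL coupleTildeL f (ldm f) := by
  obtain ⟨θ, -, hθ, hθlim⟩ := exists_seq_strictMono_tendsto' (zero_lt_one (α := ℝ))
  choose T hT hTf using fun n => exists_isContraction_mul_ldmE_le hf n (hθ n).1.le (hθ n).2
  refine inOrbit_of_approx isFunctionCouple_coupleTildeL hT (ldm_mem_coupleTildeL_sum f.2)
    (fun n => ((measurable_comp_gridUp n fun t =>
      (ldmE f t).toReal).const_mul (θ n)).aestronglyMeasurable) hTf (fun n => ?_) ?_
  · filter_upwards [ldm_ae f, ae_restrict_mem measurableSet_Ioi] with s hs hs₀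
    rw [hs, abs_of_nonneg (mul_nonneg (hθ n).1.le ENNReal.toReal_nonneg),
      abs_of_nonneg ENNReal.toReal_nonneg]
    exact (mul_le_of_le_one_left ENNReal.toReal_nonneg (hθ n).2.le).trans
      (ENNReal.toReal_mono (ldmE_lt_top f.2 hs₀).ne (ldmE_antitone _ (le_gridUp n s)))
  · filter_upwards [ldm_ae f, ae_tendsto_comp_gridUp (ldmE_antitone f) fun s => ldmE_lt_top f.2]
      with s hs hlim
    rw [hs, abs_of_nonneg ENNReal.toReal_nonneg, ← one_mul (ldmE f s).toReal]
    exact hθlim.mul hlim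

theorem ldm_abs (f : L0) : ldm |f| = ldm f := by
  have habs : ∀ᵐ s ∂halfLine, ‖(|f| : L0) s‖ₑ = ‖f s‖ₑ :=
    (AEEqFun.coeFn_abs f).mono fun s hs => by rw [hs, Real.enorm_abs]
  have hldmE : ldmE |f| = ldmE f := funext fun x => le_antisymm
    (ldmE_mono (habs.mono fun _ hs => hs.le) x) (ldmE_mono (habs.mono fun _ hs => hs.ge) x)
  simp only [ldm, hldmE]

theorem inOrbit_ldm (f : coupleTildeL.sum) : InOrbit coupleTildeL coupleTildeL f (ldm f) := by
  have habs := inOrbit_abs isFunctionCouple_coupleTildeL f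
  refine habs.trans habs.mem_sum ?_
  rw [← ldm_abs]
  refine inOrbit_ldm_of_nonneg ((AEEqFun.coeFn_abs (f : L0)).mono fun s hs => ?_)
  rw [hs]
  exact abs_nonneg _

end Majorant

section Averaging

variable {a b : ℝ}

/-- The function `h` with its values on `(a, b]` replaced by their average. -/
def avgFun (a b : ℝ) (h : ℝ → ℝ) : ℝ → ℝ :=
  (Ioc a b).piecewise (fun _ => ⨍ y in Ioc a b, h y ∂halfLine) h

/-- The version of `avgFun` for functions with values in `[0, ∞]`. -/
def avgE (a b : ℝ) (q : ℝ → ℝ≥0∞) : ℝ → ℝ≥0∞ :=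
  (Ioc a b).piecewise (fun _ => ⨍⁻ y in Ioc a b, q y ∂halfLine) q

theorem avgFun_of_mem {s : ℝ} (hs : s ∈ Ioc a b) (h : ℝ → ℝ) :
    avgFun a b h s = ⨍ y in Ioc a b, h y ∂halfLine :=
  piecewise_eq_of_mem _ _ _ hs

theorem avgFun_of_notMem {s : ℝ} (hs : s ∉ Ioc a b) (h : ℝ → ℝ) : avgFun a b h s = h s :=
  piecewise_eq_of_notMem _ _ _ hs

theorem halfLine_Ioc_ne_zero (ha : 0 ≤ a) (hab : a < b) : halfLine (Ioc a b) ≠ 0 := by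
  simpa [halfLine_Ioc ha] using hab

theorem antitoneOn_piecewise_Ioc {α β : Type*} [LinearOrder α] [Preorder β] {D : Set α}
    {q : α → β} (hq : AntitoneOn q D) {a b : α} {c : β} (hleft : ∀ s ∈ D, s ≤ a → c ≤ q s)
    (hright : ∀ t ∈ D, b < t → q t ≤ c) : AntitoneOn ((Ioc a b).piecewise (fun _ => c) q) D := by
  intro s hs t ht hst
  by_cases h₁ : s ∈ Ioc a b <;> by_cases h₂ : t ∈ Ioc a b
  · rw [piecewise_eq_of_mem _ _ _ h₁, piecewise_eq_of_mem _ _ _ h₂]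
  · rw [piecewise_eq_of_mem _ _ _ h₁, piecewise_eq_of_notMem _ _ _ h₂]
    exact hright t ht (not_le.1 fun htb => h₂ ⟨h₁.1.trans_le hst, htb⟩)
  · rw [piecewise_eq_of_notMem _ _ _ h₁, piecewise_eq_of_mem _ _ _ h₂]
    exact hleft s hs (not_lt.1 fun has => h₁ ⟨has, hst.trans h₂.2⟩)
  · rw [piecewise_eq_of_notMem _ _ _ h₁, piecewise_eq_of_notMem _ _ _ h₂]
    exact hq hs ht hst

theorem antitoneOn_avgFun (ha : 0 ≤ a) (hab : a < b) {u : ℝ → ℝ} (hu : AntitoneOn u (Ioi 0))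
    (hui : IntegrableOn u (Ioc a b) halfLine) : AntitoneOn (avgFun a b u) (Ioi 0) := by
  have hP₀ := halfLine_Ioc_ne_zero ha hab
  have hP := (halfLine_Ioc_lt_top a b).ne
  refine antitoneOn_piecewise_Ioc hu (fun s hs hsa => ?_) fun t ht hbt => ?_
  · refine (convex_Iic (u s)).set_average_mem isClosed_Iic hP₀ hP ?_ hui
    filter_upwards [ae_restrict_mem measurableSet_Ioc] with y hy
    exact hu hs (ha.trans_lt hy.1) (hsa.trans hy.1.le)
  · refine (convex_Ici (u t)).set_average_mem isClosed_Ici hP₀ hP ?_ hui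
    filter_upwards [ae_restrict_mem measurableSet_Ioc] with y hy
    exact hu (ha.trans_lt hy.1) ht (hy.2.trans hbt.le)

theorem antitoneOn_avgE (ha : 0 ≤ a) (hab : a < b) {q : ℝ → ℝ≥0∞} (hq : Antitone q) :
    AntitoneOn (avgE a b q) (Ioi 0) := by
  have hP₀ := halfLine_Ioc_ne_zero ha hab
  have hP := (halfLine_Ioc_lt_top a b).ne
  refine antitoneOn_piecewise_Ioc (hq.antitoneOn _) (fun s _ hsa => ?_) fun t _ hbt => ?_
  · rw [← setLAverage_const hP₀ hP (q s)]
    refine laverage_mono_ae ?_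
    filter_upwards [ae_restrict_mem measurableSet_Ioc] with y hy
    exact hq (hsa.trans hy.1.le)
  · rw [← setLAverage_const hP₀ hP (q t)]
    refine laverage_mono_ae ?_
    filter_upwards [ae_restrict_mem measurableSet_Ioc] with y hy
    exact hq (hy.2.trans hbt.le)

theorem lintegral_avgE (a b : ℝ) (q : ℝ → ℝ≥0∞) :
    ∫⁻ s, avgE a b q s ∂halfLine = ∫⁻ s, q s ∂halfLine := by
  rw [avgE, lintegral_piecewise measurableSet_Ioc, setLIntegral_const, mul_comm,
    measure_mul_setLAverage q (halfLine_Ioc_lt_top a b).ne,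
    lintegral_add_compl q measurableSet_Ioc]

theorem avgE_mono {q r : ℝ → ℝ≥0∞} (h : ∀ᵐ s ∂halfLine, q s ≤ r s) :
    ∀ᵐ s ∂halfLine, avgE a b q s ≤ avgE a b r s := by
  filter_upwards [h] with s hs
  by_cases hs' : s ∈ Ioc a b
  · rw [avgE, avgE, piecewise_eq_of_mem _ _ _ hs', piecewise_eq_of_mem _ _ _ hs']
    exact setLAverage_mono_ae _ h
  · rwa [avgE, avgE, piecewise_eq_of_notMem _ _ _ hs', piecewise_eq_of_notMem _ _ _ hs']

theorem enorm_avgFun_le (h : ℝ → ℝ) (s : ℝ) :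
    ‖avgFun a b h s‖ₑ ≤ avgE a b (fun y => ‖h y‖ₑ) s := by
  by_cases hs : s ∈ Ioc a b
  · rw [avgFun_of_mem hs, avgE, piecewise_eq_of_mem _ _ _ hs]
    exact enorm_setAverage_le _ h
  · rw [avgFun_of_notMem hs, avgE, piecewise_eq_of_notMem _ _ _ hs]

theorem avgFun_congr {h k : ℝ → ℝ} (hhk : h =ᵐ[halfLine] k) :
    avgFun a b h =ᵐ[halfLine] avgFun a b k := by
  filter_upwards [hhk] with s hs
  by_cases hs' : s ∈ Ioc a b
  · rw [avgFun_of_mem hs', avgFun_of_mem hs', average_congr (ae_restrict_of_ae hhk)]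
  · rwa [avgFun_of_notMem hs', avgFun_of_notMem hs']

theorem exists_avgFun_linearMap {Y : BanachCouple L0} (hY : IsFunctionCouple Y) (a b : ℝ) :
    ∃ T : Y.sum →ₗ[ℝ] L0, ∀ h, T h =ᵐ[halfLine] avgFun a b (h : L0) := by
  refine ⟨linOfRep (fun h : Y.sum => avgFun a b (h : L0))
    (fun h => (measurable_const.piecewise measurableSet_Ioc
      (h : L0).measurable).aestronglyMeasurable) (fun h k => ?_) (fun c h => ?_), linOfRep_ae⟩
  · filter_upwards [AEEqFun.coeFn_add (h : L0) k] with s hs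
    rw [Pi.add_apply]
    by_cases hs' : s ∈ Ioc a b
    · rw [avgFun_of_mem hs', avgFun_of_mem hs', avgFun_of_mem hs']
      exact setAverage_add_of_mem_sum (halfLine_Ioc_lt_top a b) (hY.sum_le h.2) (hY.sum_le k.2)
    · rw [avgFun_of_notMem hs', avgFun_of_notMem hs', avgFun_of_notMem hs']
      exact hs
  · filter_upwards [AEEqFun.coeFn_smul c (h : L0)] with s hs
    rw [Pi.smul_apply]
    by_cases hs' : s ∈ Ioc a b
    · rw [avgFun_of_mem hs', avgFun_of_mem hs']
      exact setAverage_const_smul _ c (h : L0)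
    · rw [avgFun_of_notMem hs', avgFun_of_notMem hs']
      exact hs

/-- Averaging over an interval is a contraction of `Y₀`. It automatically is one of `L^∞`. -/
def AveragingContracts (Y : BanachCouple L0) : Prop :=
  ∀ a b : ℝ, 0 ≤ a → a < b → ∀ h k : L0, k =ᵐ[halfLine] avgFun a b h → Y.X₀.nrm k ≤ Y.X₀.nrm h

theorem averagingContracts_coupleL : AveragingContracts coupleL := by
  intro a b _ _ h k hk
  change (lebesgue 1).nrm k ≤ (lebesgue 1).nrm h
  rw [nrm_one_eq, nrm_one_eq, ← lintegral_avgE a b fun s => ‖h s‖ₑ]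
  refine lintegral_mono_ae ?_
  filter_upwards [hk] with s hs
  rw [hs]
  exact enorm_avgFun_le h s

theorem averagingContracts_coupleTildeL : AveragingContracts coupleTildeL := by
  intro a b ha hab h k hk
  refine (tildeNorm_le_of_antitoneOn (antitoneOn_avgE ha hab (ldmE_antitone h)) ?_).trans_eq
    (lintegral_avgE a b _)
  filter_upwards [hk, avgE_mono (a := a) (b := b) (ae_le_ldmE h)] with s hs hle
  rw [hs]
  exact (enorm_avgFun_le h s).trans hle

theorem exists_isContraction_avgFun {Y : BanachCouple L0} (hY : IsFunctionCouple Y)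
    (hA : AveragingContracts Y) (ha : 0 ≤ a) (hab : a < b) :
    ∃ T : Y.sum →ₗ[ℝ] L0, IsContraction Y Y T ∧ ∀ h, T h =ᵐ[halfLine] avgFun a b (h : L0) := by
  obtain ⟨T, hT⟩ := exists_avgFun_linearMap hY a b
  refine ⟨T, ⟨fun h => hA a b ha hab _ _ (hT h), fun h => ?_⟩, hT⟩
  rw [hY.top]
  refine nrm_top_le ?_
  filter_upwards [hT h, ae_le_nrm_top (h : L0)] with s hs hle
  rw [hs]
  by_cases hs' : s ∈ Ioc a b
  · rw [avgFun_of_mem hs']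
    exact enorm_setAverage_le_of_ae (ae_restrict_of_ae (ae_le_nrm_top _))
  · rwa [avgFun_of_notMem hs']

end Averaging

section Antitone

theorem intervalIntegrable_of_mem_sum {U : L0} (hU : U ∈ coupleL.sum) {u : ℝ → ℝ}
    (h : U =ᵐ[halfLine] u) {a b : ℝ} (ha : 0 ≤ a) (hb : 0 ≤ b) :
    IntervalIntegrable u volume a b := by
  have key : ∀ {a b : ℝ}, 0 ≤ a → IntegrableOn u (Ioc a b) volume := fun {a b} ha => by
    rw [IntegrableOn, ← halfLine_restrict_Ioc ha]
    exact (integrableOn_of_mem_sum hU (halfLine_Ioc_lt_top a b)).congr (ae_restrict_of_ae h)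
  exact ⟨key ha, key hb⟩

theorem setAverage_Ioc_eq_of_integral_eq {u : ℝ → ℝ} {a b c : ℝ} (ha : 0 ≤ a) (hab : a < b)
    (h : ∫ y in a..b, u y = c * (b - a)) : ⨍ y in Ioc a b, u y ∂halfLine = c := by
  rw [setAverage_eq, measureReal_def, halfLine_Ioc ha, ENNReal.toReal_ofReal (sub_nonneg.2 hab.le),
    halfLine_restrict_Ioc ha, ← intervalIntegral.integral_of_le hab.le, h, smul_eq_mul, mul_comm,
    mul_inv_cancel_right₀ (sub_pos.2 hab).ne']

variable {u w : ℝ → ℝ} {a b c d : ℝ}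

theorem exists_integral_le_mul (ha : 0 ≤ a) (hu : AntitoneOn u (Ioi 0))
    (hui : ∀ x y : ℝ, 0 ≤ x → 0 ≤ y → IntervalIntegrable u volume x y) {s : ℝ} (has : a < s)
    (hs : u s < c) (d : ℝ) : ∃ x, d ≤ x ∧ a ≤ x ∧ ∫ y in a..x, u y ≤ c * (x - a) := by
  have hs₀ : 0 < s := ha.trans_lt has
  have hbound : ∀ x, s ≤ x → ∫ y in a..x, u y ≤ (∫ y in a..s, u y) + u s * (x - s) := by
    intro x hsx
    rw [← intervalIntegral.integral_add_adjacent_intervals (hui a s ha hs₀.le)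
      (hui s x hs₀.le (hs₀.le.trans hsx)), mul_comm, ← smul_eq_mul,
      ← intervalIntegral.integral_const]
    gcongr
    exact intervalIntegral.integral_mono_on hsx (hui s x hs₀.le (hs₀.le.trans hsx))
      intervalIntegrable_const fun y hy => hu hs₀ (hs₀.trans_le hy.1) hy.1
  have hlin : Tendsto (fun x => (c - u s) * x) atTop atTop :=
    tendsto_id.const_mul_atTop (sub_pos.2 hs)
  obtain ⟨x, hx, hdx, hsx⟩ := ((hlin.eventually_ge_atTop
    ((∫ y in a..s, u y) - u s * s + c * a)).and
      ((eventually_ge_atTop d).and (eventually_ge_atTop s))).exists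
  exact ⟨x, hdx, has.le.trans hsx, (hbound x hsx).trans (by linarith)⟩

theorem exists_integral_eq_mul (ha : 0 ≤ a) (had : a < d) (hu : AntitoneOn u (Ioi 0))
    (hui : ∀ x y : ℝ, 0 ≤ x → 0 ≤ y → IntervalIntegrable u volume x y)
    (h : c * (d - a) ≤ ∫ s in a..d, u s) {s : ℝ} (has : a < s) (hs : u s < c) :
    ∃ b, d ≤ b ∧ ∫ s in a..b, u s = c * (b - a) := by
  obtain ⟨x, hdx, hax, hx⟩ := exists_integral_le_mul ha hu hui has hs d
  have hcont : ContinuousOn (fun x => (∫ y in a..x, u y) - c * (x - a)) (Icc d x) := by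
    have hprim := intervalIntegral.continuousOn_primitive_interval' (a := a)
      (hui a x ha (ha.trans hax)) left_mem_uIcc
    rw [uIcc_of_le hax] at hprim
    exact (hprim.mono (Icc_subset_Icc_left had.le)).sub (by fun_prop)
  obtain ⟨b, hb, hb₀⟩ := intermediate_value_Icc' hdx hcont ⟨sub_nonpos.2 hx, sub_nonneg.2 h⟩
  exact ⟨b, hb.1, sub_eq_zero.1 hb₀⟩

theorem integral_le_integral_avgFun (ha : 0 ≤ a) (had : a < d) (hdb : d ≤ b)
    (hwi : ∀ x y : ℝ, 0 ≤ x → 0 ≤ y → IntervalIntegrable w volume x y)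
    (hui : ∀ x y : ℝ, 0 ≤ x → 0 ≤ y → IntervalIntegrable u volume x y)
    (hvi : ∀ x y : ℝ, 0 ≤ x → 0 ≤ y → IntervalIntegrable (avgFun a b u) volume x y)
    (hw : ∫ s in a..d, w s = c * (d - a)) (hwc : ∀ s, a < s → w s ≤ c)
    (hub : ∫ s in a..b, u s = c * (b - a))
    (h : ∀ t, a ≤ t → ∫ s in a..t, w s ≤ ∫ s in a..t, u s) {t : ℝ} (hdt : d ≤ t) :
    ∫ s in d..t, w s ≤ ∫ s in d..t, avgFun a b u s := by
  have hab := had.trans_le hdb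
  have hd := ha.trans had.le
  have hb := ha.trans hab.le
  have ht := hd.trans hdt
  have hc : ∀ s ∈ Ioc a b, avgFun a b u s = c := fun s hs =>
    (avgFun_of_mem hs u).trans (setAverage_Ioc_eq_of_integral_eq ha hab hub)
  rcases le_or_gt t b with htb | hbt
  · exact intervalIntegral.integral_mono_on_of_le_Ioo hdt (hwi d t hd ht) (hvi d t hd ht)
      fun s hs => (hwc s (had.trans hs.1)).trans_eq
        (hc s ⟨had.trans hs.1, hs.2.le.trans htb⟩).symm
  · have hdb_eq : ∫ s in d..b, avgFun a b u s = c * (b - d) := by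
      rw [intervalIntegral.integral_congr_uIoo (g := fun _ => c) (fun s hs => ?_),
        intervalIntegral.integral_const, smul_eq_mul, mul_comm]
      rw [uIoo_of_le hdb] at hs
      exact hc s ⟨had.trans hs.1, hs.2.le⟩
    have hbt_eq : ∫ s in b..t, avgFun a b u s = ∫ s in b..t, u s := by
      refine intervalIntegral.integral_congr_uIoo fun s hs => ?_
      rw [uIoo_of_le hbt.le] at hs
      exact avgFun_of_notMem (fun hs' => hs'.2.not_gt hs.1) u
    have hw_add := intervalIntegral.integral_add_adjacent_intervals (hwi a d ha hd) (hwi d t hd ht)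
    have hu_add := intervalIntegral.integral_add_adjacent_intervals (hui a b ha hb) (hui b t hb ht)
    rw [← intervalIntegral.integral_add_adjacent_intervals (hvi d b hd hb) (hvi b t hb ht)]
    linarith [h t (had.le.trans hdt)]

end Antitone

section Majorization

/-- The stage of the averaging procedure that has reached `a`: the antitone function `u ≥ 0`
dominates `w` pointwise on `(0, a]`, and its integrals from `a` on dominate those of `w`. -/
structure MajorizesFrom (w u : ℝ → ℝ) (a : ℝ) : Prop where
  antitoneOn : AntitoneOn u (Ioi 0)
  nonneg : ∀ s, 0 < s → 0 ≤ u s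
  le : ∀ s ∈ Ioc 0 a, w s ≤ u s
  integral_le : ∀ t, a ≤ t → ∫ s in a..t, w s ≤ ∫ s in a..t, u s

variable {Y : BanachCouple L0} {u w : ℝ → ℝ} {a d c : ℝ}

theorem MajorizesFrom.of_le (hu : MajorizesFrom w u a) (ha : 0 ≤ a) (had : a < d)
    (hwi : ∀ x y : ℝ, 0 ≤ x → 0 ≤ y → IntervalIntegrable w volume x y)
    (hui : ∀ x y : ℝ, 0 ≤ x → 0 ≤ y → IntervalIntegrable u volume x y)
    (hwu : ∀ s, a < s → w s ≤ u s) : MajorizesFrom w u d where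
  antitoneOn := hu.antitoneOn
  nonneg := hu.nonneg
  le s hs := (le_or_gt s a).elim (fun hsa => hu.le s ⟨hs.1, hsa⟩) (hwu s)
  integral_le t hdt := by
    have hd := ha.trans had.le
    exact intervalIntegral.integral_mono_on_of_le_Ioo hdt (hwi d t hd (hd.trans hdt))
      (hui d t hd (hd.trans hdt)) fun s hs => hwu s (had.trans hs.1)

theorem MajorizesFrom.of_average_eq {b : ℝ} (hu : MajorizesFrom w u a) (ha : 0 ≤ a) (had : a < d)
    (hdb : d ≤ b) (hwi : ∀ x y : ℝ, 0 ≤ x → 0 ≤ y → IntervalIntegrable w volume x y)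
    (hui : ∀ x y : ℝ, 0 ≤ x → 0 ≤ y → IntervalIntegrable u volume x y)
    (hvi : ∀ x y : ℝ, 0 ≤ x → 0 ≤ y → IntervalIntegrable (avgFun a b u) volume x y)
    (hc : 0 ≤ c) (hw : ∫ s in a..d, w s = c * (d - a)) (hwc : ∀ s, a < s → w s ≤ c)
    (hub : ∫ s in a..b, u s = c * (b - a)) : MajorizesFrom w (avgFun a b u) d := by
  have hab := had.trans_le hdb
  have hval : ∀ s ∈ Ioc a b, avgFun a b u s = c := fun s hs =>
    (avgFun_of_mem hs u).trans (setAverage_Ioc_eq_of_integral_eq ha hab hub)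
  refine ⟨antitoneOn_avgFun ha hab hu.antitoneOn ?_, fun s hs => ?_, fun s hs => ?_,
    fun t hdt => integral_le_integral_avgFun ha had hdb hwi hui hvi hw hwc hub hu.integral_le hdt⟩
  · rw [IntegrableOn, halfLine_restrict_Ioc ha]
    exact (hui a b ha (ha.trans hab.le)).1
  · by_cases hsab : s ∈ Ioc a b
    · exact hc.trans_eq (hval s hsab).symm
    · exact (hu.nonneg s hs).trans_eq (avgFun_of_notMem hsab u).symm
  · rcases le_or_gt s a with hsa | has
    · exact (hu.le s ⟨hs.1, hsa⟩).trans_eq (avgFun_of_notMem (fun h => h.1.not_ge hsa) u).symm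
    · exact (hwc s has).trans_eq (hval s ⟨has, hs.2.trans hdb⟩).symm

theorem exists_isContraction_majorizesFrom (hY : IsFunctionCouple Y) (hA : AveragingContracts Y)
    {U : Y.sum} (hU : (U : L0) =ᵐ[halfLine] u) (ha : 0 ≤ a) (had : a < d)
    (hwi : ∀ x y : ℝ, 0 ≤ x → 0 ≤ y → IntervalIntegrable w volume x y) (hc : 0 ≤ c)
    (hw : ∀ s ∈ Ioc a d, w s = c) (hwc : ∀ s, a < s → w s ≤ c) (hu : MajorizesFrom w u a) :
    ∃ T, IsContraction Y Y T ∧ ∃ v, T U =ᵐ[halfLine] v ∧ MajorizesFrom w v d := by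
  have hui : ∀ x y : ℝ, 0 ≤ x → 0 ≤ y → IntervalIntegrable u volume x y := fun x y =>
    intervalIntegrable_of_mem_sum (hY.sum_le U.2) hU
  have hwad : ∫ s in a..d, w s = c * (d - a) := by
    rw [intervalIntegral.integral_congr_uIoo (g := fun _ => c) (fun s hs => ?_),
      intervalIntegral.integral_const, smul_eq_mul, mul_comm]
    rw [uIoo_of_le had.le] at hs
    exact hw s ⟨hs.1, hs.2.le⟩
  by_cases hcu : ∀ s, a < s → c ≤ u s
  · exact ⟨_, isContraction_subtype Y, u, hU,
      hu.of_le ha had hwi hui fun s hs => (hwc s hs).trans (hcu s hs)⟩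
  · push Not at hcu
    obtain ⟨s, has, hs⟩ := hcu
    obtain ⟨b, hdb, hub⟩ := exists_integral_eq_mul ha had hu.antitoneOn hui
      (hwad ▸ hu.integral_le d had.le) has hs
    obtain ⟨T, hT, hTavg⟩ := exists_isContraction_avgFun hY hA ha (had.trans_le hdb)
    have hTU := (hTavg U).trans (avgFun_congr hU)
    exact ⟨T, hT, _, hTU, hu.of_average_eq ha had hdb hwi hui (fun x y =>
      intervalIntegrable_of_mem_sum (hY.sum_le (hT.mem_sum U)) hTU) hc hwad hwc hub⟩

theorem exists_isContraction_majorizesFrom_step (hY : IsFunctionCouple Y)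
    (hA : AveragingContracts Y) {U : Y.sum} (hU : (U : L0) =ᵐ[halfLine] u) {τ c : ℕ → ℝ}
    (hτ₀ : τ 0 = 0) (hτ : StrictMono τ)
    (hwi : ∀ x y : ℝ, 0 ≤ x → 0 ≤ y → IntervalIntegrable w volume x y) (hc : ∀ i, 0 ≤ c i)
    (hw : ∀ i, ∀ s ∈ Ioc (τ i) (τ (i + 1)), w s = c i) (hwc : ∀ i s, τ i < s → w s ≤ c i)
    (hu : MajorizesFrom w u 0) (i : ℕ) :
    ∃ T, IsContraction Y Y T ∧ ∃ v, T U =ᵐ[halfLine] v ∧ MajorizesFrom w v (τ i) := by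
  induction i with
  | zero => exact ⟨_, isContraction_subtype Y, u, hU, hτ₀.symm ▸ hu⟩
  | succ i ih =>
    obtain ⟨T, hT, v, hTU, hv⟩ := ih
    obtain ⟨S, hS, hv'⟩ := exists_isContraction_majorizesFrom hY hA (U := ⟨T U, hT.mem_sum U⟩) hTU
      (hτ₀ ▸ hτ.monotone i.zero_le) (hτ i.lt_succ_self) hwi (hc i) (hw i) (hwc i) hv
    exact ⟨_, hT.comp hS, hv'⟩

variable {p q : ℝ → ℝ≥0∞}

theorem setLIntegral_ne_top_of_mem_sum {U : L0} (hU : U ∈ coupleL.sum)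
    (h : U =ᵐ[halfLine] fun s => (p s).toReal) (hfin : ∀ s, 0 < s → p s < ∞) (t : ℝ) :
    ∫⁻ s in Ioc 0 t, p s ∂halfLine ≠ ∞ := by
  have hint := (integrableOn_of_mem_sum hU (halfLine_Ioc_lt_top 0 t)).congr
    (ae_restrict_of_ae h)
  refine ne_top_of_le_ne_top hint.lintegral_lt_top.ne (lintegral_mono_ae ?_)
  filter_upwards [ae_restrict_of_ae (ae_restrict_mem measurableSet_Ioi)] with s hs
  rw [ENNReal.ofReal_toReal (hfin s hs).ne]

theorem antitoneOn_toReal (hp : Antitone p) (hfin : ∀ s, 0 < s → p s < ∞) :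
    AntitoneOn (fun s => (p s).toReal) (Ioi 0) := fun s hs _ _ hst =>
  ENNReal.toReal_mono (hfin s hs).ne (hp hst)

theorem intervalIntegral_toReal (hp : Measurable p) (hfin : ∀ s, 0 < s → p s < ∞) {t : ℝ}
    (ht : 0 ≤ t) :
    ∫ s in (0 : ℝ)..t, (p s).toReal = (∫⁻ s in Ioc 0 t, p s ∂halfLine).toReal := by
  rw [intervalIntegral.integral_of_le ht, ← halfLine_restrict_Ioc le_rfl]
  refine integral_toReal hp.aemeasurable ?_
  filter_upwards [ae_restrict_of_ae (ae_restrict_mem measurableSet_Ioi)] with s hs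
  exact hfin s hs

theorem toReal_gridUp_le (hq : Antitone q) (hqf : ∀ s, 0 < s → q s < ∞) (n : ℕ) {s : ℝ}
    (hs : 0 < s) : (q (gridUp n s)).toReal ≤ (q s).toReal :=
  ENNReal.toReal_mono (hqf s hs).ne (hq (le_gridUp n s))

theorem intervalIntegrable_toReal_gridUp (hq : Antitone q) (hqf : ∀ s, 0 < s → q s < ∞) (n : ℕ)
    {x y : ℝ} (hx : 0 ≤ x) (hy : 0 ≤ y)
    (hint : IntervalIntegrable (fun s => (q s).toReal) volume x y) :
    IntervalIntegrable (fun s => (q (gridUp n s)).toReal) volume x y := by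
  refine hint.mono_fun (measurable_comp_gridUp n fun s => (q s).toReal).aestronglyMeasurable ?_
  filter_upwards [ae_restrict_mem measurableSet_uIoc] with s hs
  rw [Real.norm_of_nonneg ENNReal.toReal_nonneg, Real.norm_of_nonneg ENNReal.toReal_nonneg]
  exact toReal_gridUp_le hq hqf n ((le_min hx hy).trans_lt hs.1)

theorem majorizesFrom_gridUp (hp : Antitone p) (hq : Antitone q) (hpf : ∀ s, 0 < s → p s < ∞)
    (hqf : ∀ s, 0 < s → q s < ∞)
    (hqi : ∀ x y : ℝ, 0 ≤ x → 0 ≤ y → IntervalIntegrable (fun s => (q s).toReal) volume x y)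
    (hpi : ∀ t, ∫⁻ s in Ioc 0 t, p s ∂halfLine ≠ ∞)
    (h : ∀ t, 0 < t → ∫⁻ s in Ioc 0 t, q s ∂halfLine ≤ ∫⁻ s in Ioc 0 t, p s ∂halfLine) (n : ℕ) :
    MajorizesFrom (fun s => (q (gridUp n s)).toReal) (fun s => (p s).toReal) 0 where
  antitoneOn := antitoneOn_toReal hp hpf
  nonneg _ _ := ENNReal.toReal_nonneg
  le s hs := absurd hs (by simp)
  integral_le t ht := calc
    ∫ s in (0 : ℝ)..t, (q (gridUp n s)).toReal ≤ ∫ s in (0 : ℝ)..t, (q s).toReal :=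
      intervalIntegral.integral_mono_on_of_le_Ioo ht
        (intervalIntegrable_toReal_gridUp hq hqf n le_rfl ht (hqi 0 t le_rfl ht))
        (hqi 0 t le_rfl ht) fun s hs => toReal_gridUp_le hq hqf n hs.1
    _ = (∫⁻ s in Ioc 0 t, q s ∂halfLine).toReal := intervalIntegral_toReal hq.measurable hqf ht
    _ ≤ (∫⁻ s in Ioc 0 t, p s ∂halfLine).toReal := by
      refine ENNReal.toReal_mono (hpi t) ?_
      rcases ht.eq_or_lt with rfl | ht₀
      · simp
      · exact h t ht₀
    _ = ∫ s in (0 : ℝ)..t, (p s).toReal := (intervalIntegral_toReal hp.measurable hpf ht).symm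

theorem exists_isContraction_indicator_gridUp_le (hY : IsFunctionCouple Y)
    (hA : AveragingContracts Y) (hq : Antitone q) (hqf : ∀ s, 0 < s → q s < ∞)
    (hqi : ∀ x y : ℝ, 0 ≤ x → 0 ≤ y → IntervalIntegrable (fun s => (q s).toReal) volume x y)
    {U : Y.sum} (hU : (U : L0) =ᵐ[halfLine] u) {n : ℕ}
    (hu : MajorizesFrom (fun s => (q (gridUp n s)).toReal) u 0) :
    ∃ T, IsContraction Y Y T ∧ ∀ᵐ s ∂halfLine,
      (Iic ((n : ℝ) + 1)).indicator (fun s => (q (gridUp n s)).toReal) s ≤ T U s := by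
  have hn : (0 : ℝ) < n + 1 := n.cast_add_one_pos
  obtain ⟨T, hT, v, hTU, hv⟩ := exists_isContraction_majorizesFrom_step hY hA hU
    (τ := fun i => i / (n + 1)) (c := fun i => (q ((i + 1 : ℕ) / (n + 1))).toReal) (by simp)
    (fun i j hij => by simp only; gcongr)
    (fun x y hx hy => intervalIntegrable_toReal_gridUp hq hqf n hx hy (hqi x y hx hy))
    (fun _ => ENNReal.toReal_nonneg) (fun i s hs => by simp only [gridUp_eq_of_mem_Ioc hs])
    (fun i s hs => ENNReal.toReal_mono (hqf _ (by positivity)).ne (hq (le_gridUp_of_lt hs)))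
    hu ((n + 1) * (n + 1))
  refine ⟨T, hT, ?_⟩
  filter_upwards [hTU, ae_restrict_mem measurableSet_Ioi] with s hs hs₀
  rw [hs]
  refine indicator_apply_le' (fun hsn => hv.le s ⟨hs₀, hsn.trans_eq ?_⟩) fun _ => hv.nonneg s hs₀
  push_cast
  rw [mul_div_cancel_right₀ _ hn.ne']

theorem inOrbit_of_antitone (hY : IsFunctionCouple Y) (hA : AveragingContracts Y)
    (hp : Antitone p) (hq : Antitone q) (hpf : ∀ s, 0 < s → p s < ∞) (hqf : ∀ s, 0 < s → q s < ∞)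
    {U : Y.sum} {V : L0} (hV : V ∈ Y.sum) (hUp : (U : L0) =ᵐ[halfLine] fun s => (p s).toReal)
    (hVq : V =ᵐ[halfLine] fun s => (q s).toReal)
    (h : ∀ t, 0 < t → ∫⁻ s in Ioc 0 t, q s ∂halfLine ≤ ∫⁻ s in Ioc 0 t, p s ∂halfLine) :
    InOrbit Y Y U V := by
  have hqi : ∀ x y : ℝ, 0 ≤ x → 0 ≤ y → IntervalIntegrable (fun s => (q s).toReal) volume x y :=
    fun x y => intervalIntegrable_of_mem_sum (hY.sum_le hV) hVq
  have hpi := setLIntegral_ne_top_of_mem_sum (hY.sum_le U.2) hUp hpf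
  choose T hT hTU using fun n => exists_isContraction_indicator_gridUp_le hY hA hq hqf hqi hUp
    (majorizesFrom_gridUp hp hq hpf hqf hqi hpi h n)
  refine inOrbit_of_approx hY hT hV (fun n => ((measurable_comp_gridUp n fun s =>
    (q s).toReal).indicator measurableSet_Iic).aestronglyMeasurable) hTU (fun n => ?_) ?_
  · filter_upwards [hVq, ae_restrict_mem measurableSet_Ioi] with s hs hs₀
    rw [hs]
    refine abs_le_abs_of_nonneg (indicator_nonneg (fun _ _ => ENNReal.toReal_nonneg) s) ?_
    exact (indicator_le_self' (fun _ _ => ENNReal.toReal_nonneg) s).trans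
      (toReal_gridUp_le hq hqf n hs₀)
  · filter_upwards [hVq, ae_tendsto_comp_gridUp hq hqf] with s hs hlim
    rw [hs, abs_of_nonneg ENNReal.toReal_nonneg]
    refine hlim.congr' ?_
    obtain ⟨N, hN⟩ := exists_nat_ge s
    filter_upwards [eventually_ge_atTop N] with n hn
    have hsn : s ≤ (n : ℝ) + 1 := (hN.trans (Nat.cast_le.2 hn)).trans (lt_add_one _).le
    rw [indicator_of_mem (mem_Iic.2 hsn)]

end Majorization

section Transfer

theorem continuous_halfLine_inter_Iic (D : Set ℝ) : Continuous fun r => halfLine (D ∩ Iic r) := by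
  refine continuous_of_le_add_edist 1 ENNReal.one_ne_top fun x y => ?_
  calc halfLine (D ∩ Iic x) ≤ halfLine (D ∩ Iic y ∪ Ioc y x) := measure_mono fun s hs =>
        (le_or_gt s y).imp (fun hsy => ⟨hs.1, hsy⟩) fun hys => ⟨hys, hs.2⟩
    _ ≤ halfLine (D ∩ Iic y) + halfLine (Ioc y x) := measure_union_le _ _
    _ ≤ halfLine (D ∩ Iic y) + 1 * edist x y := by
      gcongr
      rw [one_mul, edist_dist, Real.dist_eq]
      refine (Measure.restrict_apply_le _ _).trans ?_
      rw [Real.volume_Ioc]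
      exact ENNReal.ofReal_le_ofReal (le_abs_self _)

theorem exists_subset_measure_eq {D : Set ℝ} (hD : MeasurableSet D) {m : ℝ≥0∞}
    (hm : m ≤ halfLine D) : ∃ P ⊆ D, MeasurableSet P ∧ halfLine P = m := by
  rcases hm.eq_or_lt with rfl | hlt
  · exact ⟨D, Subset.rfl, hD, rfl⟩
  have hunion : D = ⋃ n : ℕ, D ∩ Iic (n : ℝ) := by
    rw [← inter_iUnion, inter_eq_left.2]
    exact fun s _ => mem_iUnion.2 (exists_nat_ge s)
  have hmono : Monotone fun n : ℕ => D ∩ Iic (n : ℝ) := fun i j hij =>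
    inter_subset_inter_right D (Iic_subset_Iic.2 (Nat.cast_le.2 hij))
  rw [hunion, hmono.measure_iUnion] at hlt
  obtain ⟨n, hn⟩ := lt_iSup_iff.1 hlt
  have hzero : halfLine (D ∩ Iic 0) = 0 :=
    measure_mono_null inter_subset_right (by rw [halfLine_Iic, ENNReal.ofReal_zero])
  obtain ⟨r, hr⟩ := mem_range_of_exists_le_of_exists_ge (continuous_halfLine_inter_Iic D)
    ⟨0, hzero.trans_le zero_le⟩ ⟨n, hn.le⟩
  exact ⟨D ∩ Iic r, inter_subset_left, hD.inter measurableSet_Iic, hr⟩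

theorem exists_disjoint_subsets {D : ℕ → Set ℝ} (hD : ∀ i, MeasurableSet (D i)) {m : ℕ → ℝ≥0∞}
    (hm : ∀ i, m i < ∞) (h : ∀ i, ∑ j ∈ Finset.range (i + 1), m j ≤ halfLine (D i)) :
    ∃ P : ℕ → Set ℝ, (∀ i, MeasurableSet (P i)) ∧ (∀ i, P i ⊆ D i) ∧ (∀ i, halfLine (P i) = m i) ∧
      Pairwise (Function.onFun Disjoint P) := by
  have hnext : ∀ i A, MeasurableSet A ∧ halfLine A ≤ ∑ j ∈ Finset.range i, m j →
      ∃ Q ⊆ D i \ A, MeasurableSet Q ∧ halfLine Q = m i := fun i A hA => by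
    refine exists_subset_measure_eq ((hD i).diff hA.1) (le_trans ?_ le_measure_sdiff)
    refine ENNReal.le_sub_of_add_le_right
      (hA.2.trans_lt (ENNReal.sum_lt_top.2 fun j _ => hm j)).ne ?_
    calc m i + halfLine A ≤ m i + ∑ j ∈ Finset.range i, m j := by gcongr; exact hA.2
      _ = ∑ j ∈ Finset.range (i + 1), m j := by rw [Finset.sum_range_succ, add_comm]
      _ ≤ halfLine (D i) := h i
  choose! Q hQD hQm hQ using hnext
  let E : ℕ → Set ℝ := fun n => n.rec ∅ fun i A => A ∪ Q i A
  have hE : ∀ i, MeasurableSet (E i) ∧ halfLine (E i) ≤ ∑ j ∈ Finset.range i, m j := by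
    intro i
    induction i with
    | zero => exact ⟨MeasurableSet.empty, measure_empty.trans_le zero_le⟩
    | succ i ih =>
      refine ⟨ih.1.union (hQm i _ ih), (measure_union_le _ _).trans ?_⟩
      rw [Finset.sum_range_succ, hQ i _ ih]
      gcongr
      exact ih.2
  have hEmono : Monotone E := monotone_nat_of_le_succ fun i => subset_union_left
  refine ⟨fun i => Q i (E i), fun i => hQm i _ (hE i), fun i => (hQD i _ (hE i)).trans sdiff_subset,
    fun i => hQ i _ (hE i), (pairwise_disjoint_on _).2 fun i j hij => ?_⟩
  exact disjoint_left.2 fun s hsi hsj => (hQD j _ (hE j) hsj).2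
    (hEmono (Nat.succ_le_of_lt hij) (subset_union_right hsi))

theorem enorm_setAverage_mul_measure_le (P : Set ℝ) (h : ℝ → ℝ) {c : ℝ≥0∞}
    (hc : halfLine P = 0 ∨ c ≤ halfLine P) :
    ‖⨍ s in P, h s ∂halfLine‖ₑ * c ≤ ∫⁻ s in P, ‖h s‖ₑ ∂halfLine := by
  rcases hc with hP | hc
  · rw [Measure.restrict_eq_zero.2 hP, average_zero_measure, enorm_zero, zero_mul]
    exact zero_le
  · refine (mul_le_mul' (enorm_setAverage_le P h) hc).trans ?_
    rw [setLAverage_eq]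
    rw [mul_comm]
    exact ENNReal.mul_div_le

theorem nrm_one_le_of_ae_eq_setAverage {κ : ℝ → ℕ} (hκ : Measurable κ) {P : ℕ → Set ℝ}
    (hPm : ∀ i, MeasurableSet (P i)) (hPd : Pairwise (Function.onFun Disjoint P))
    (hPκ : ∀ i, halfLine (P i) = 0 ∨ halfLine (κ ⁻¹' {i}) ≤ halfLine (P i)) {w h : L0}
    (hw : w =ᵐ[halfLine] fun s => ⨍ y in P (κ s), h y ∂halfLine) :
    (lebesgue 1).nrm w ≤ (lebesgue 1).nrm h := by
  rw [nrm_one_eq, nrm_one_eq]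
  calc ∫⁻ s, ‖w s‖ₑ ∂halfLine = ∫⁻ s, ‖⨍ y in P (κ s), h y ∂halfLine‖ₑ ∂halfLine :=
        lintegral_congr_ae (hw.fun_comp enorm)
    _ = ∑' i, ‖⨍ y in P i, h y ∂halfLine‖ₑ * halfLine (κ ⁻¹' {i}) := by
        rw [← lintegral_map (f := fun i => ‖⨍ y in P i, h y ∂halfLine‖ₑ) measurable_from_top hκ,
          lintegral_countable']
        simp only [Measure.map_apply hκ (measurableSet_singleton _)]
    _ ≤ ∑' i, ∫⁻ s in P i, ‖h s‖ₑ ∂halfLine :=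
        ENNReal.tsum_le_tsum fun i => enorm_setAverage_mul_measure_le (P i) h (hPκ i)
    _ = ∫⁻ s in ⋃ i, P i, ‖h s‖ₑ ∂halfLine := (lintegral_iUnion hPm hPd _).symm
    _ ≤ ∫⁻ s, ‖h s‖ₑ ∂halfLine := setLIntegral_le_lintegral _ _

/-- The index of the level set of `|y|` at scale `1 / N`, counted from above; the value `N * N`
stands for points at which `|y|` is small or large or which are beyond `N`. -/
def levelIndex (y : L0) (N : ℕ) (s : ℝ) : ℕ :=
  open Classical in
  if s ≤ N ∧ ⌊|y s| * N⌋₊ ≤ N * N then N * N - ⌊|y s| * N⌋₊ else N * N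

/-- The value at scale `1 / N` attached to an index. By truncation it is `0` for large indices. -/
def levelValue (N i : ℕ) : ℝ := ((N * N - 1 - i : ℕ) : ℝ) / N

/-- The set of the points of index `i`; it is empty when `i` is the exceptional index. -/
def levelSet (y : L0) (N i : ℕ) : Set ℝ := {s | levelIndex y N s = i ∧ i < N * N}

variable {y : L0} {N : ℕ} {s : ℝ} {i : ℕ}

theorem measurable_levelIndex (y : L0) (N : ℕ) : Measurable (levelIndex y N) := by
  have hfloor : Measurable fun s => ⌊|y s| * N⌋₊ :=
    Nat.measurable_floor.comp (y.measurable.abs.mul_const _)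
  classical
  refine Measurable.ite ?_ (measurable_const.sub hfloor) measurable_const
  exact (measurableSet_Iic (a := (N : ℝ))).inter (measurableSet_le hfloor measurable_const)

theorem measurableSet_levelSet (y : L0) (N i : ℕ) : MeasurableSet (levelSet y N i) :=
  (measurable_levelIndex y N (measurableSet_singleton i)).inter (MeasurableSet.const _)

theorem levelIndex_lt (h : levelIndex y N s < N * N) :
    s ≤ N ∧ 0 < ⌊|y s| * N⌋₊ ∧ levelIndex y N s = N * N - ⌊|y s| * N⌋₊ := by
  unfold levelIndex at h ⊢
  split_ifs at h ⊢ with hs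
  · exact ⟨hs.1, by omega, rfl⟩
  · exact absurd h (lt_irrefl _)

theorem levelValue_nonneg (N i : ℕ) : 0 ≤ levelValue N i := by
  unfold levelValue
  positivity

theorem levelValue_eq_zero (hi : N * N ≤ i) : levelValue N i = 0 := by
  rw [levelValue, Nat.sub_eq_zero_of_le ((Nat.sub_le _ _).trans hi), Nat.cast_zero, zero_div]

theorem levelValue_lt (hN : 0 < N) (hs : levelIndex y N s < N * N) (h : levelIndex y N s ≤ i) :
    levelValue N i < |y s| := by
  obtain ⟨-, hpos, heq⟩ := levelIndex_lt hs
  rw [levelValue, div_lt_iff₀ (Nat.cast_pos.2 hN)]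
  have hlt : N * N - 1 - i < ⌊|y s| * N⌋₊ := by omega
  exact (Nat.cast_lt.2 hlt).trans_le (Nat.floor_le (by positivity))

theorem le_levelValue (hN : 0 < N) (hs : s ≤ N) (hy : |y s| ≤ N) :
    |y s| - 2 / N ≤ levelValue N (levelIndex y N s) := by
  have hN' : (0 : ℝ) < N := Nat.cast_pos.2 hN
  have hfloor : ⌊|y s| * N⌋₊ ≤ N * N := by
    refine Nat.floor_le_of_le ?_
    rw [Nat.cast_mul]
    gcongr
  have hindex : levelIndex y N s = N * N - ⌊|y s| * N⌋₊ := if_pos ⟨hs, hfloor⟩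
  have hle : ⌊|y s| * N⌋₊ ≤ N * N - 1 - levelIndex y N s + 1 := by omega
  rw [levelValue, le_div_iff₀ hN', sub_mul, div_mul_cancel₀ _ hN'.ne', sub_le_iff_le_add]
  calc |y s| * N ≤ ⌊|y s| * N⌋₊ + 1 := (Nat.lt_floor_add_one _).le
    _ ≤ ((N * N - 1 - levelIndex y N s + 1 : ℕ) : ℝ) + 1 := by gcongr
    _ = ((N * N - 1 - levelIndex y N s : ℕ) : ℝ) + 2 := by push_cast; ring

theorem halfLine_levelSet_lt_top (y : L0) (N i : ℕ) : halfLine (levelSet y N i) < ∞ :=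
  (measure_mono fun _ hs => (levelIndex_lt (hs.1.trans_lt hs.2)).1).trans_lt
    (halfLine_Iic_lt_top N)

theorem sum_halfLine_levelSet_le (hN : 0 < N) (i : ℕ) :
    ∑ j ∈ Finset.range (i + 1), halfLine (levelSet y N j) ≤
      halfLine {s | levelValue N i < |y s|} := by
  rw [← measure_biUnion_finset (fun a _ b _ hab => disjoint_left.2 fun s hs hs' =>
    hab (hs.1.symm.trans hs'.1)) fun j _ => measurableSet_levelSet y N j]
  refine measure_mono fun s hs => ?_
  obtain ⟨j, hj, hsj, hjN⟩ := mem_iUnion₂.1 hs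
  exact levelValue_lt hN (hsj.trans_lt hjN)
    (hsj.trans_le (Nat.lt_succ_iff.1 (Finset.mem_range.1 hj)))

theorem exists_isContraction_levelValue_le {x : coupleL.sum} (hx : ∀ᵐ s ∂halfLine, 0 ≤ (x : L0) s)
    (hN : 0 < N)
    (h : ∀ c : ℝ, 0 ≤ c → halfLine {s | c < |y s|} ≤ halfLine {s | c < |(x : L0) s|}) :
    ∃ T, IsContraction coupleL coupleL T ∧
      ∀ᵐ s ∂halfLine, levelValue N (levelIndex y N s) ≤ T x s := by
  obtain ⟨P, hPm, hPD, hP, hPd⟩ := exists_disjoint_subsets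
    (fun i => measurableSet_lt (measurable_const (a := levelValue N i)) (x : L0).measurable.abs)
    (halfLine_levelSet_lt_top y N)
    (fun i => (sum_halfLine_levelSet_le hN i).trans (h _ (levelValue_nonneg N i)))
  have hPtop : ∀ i, halfLine (P i) < ∞ := fun i => hP i ▸ halfLine_levelSet_lt_top y N i
  obtain ⟨T, hT⟩ := exists_stepOperator (X := coupleL) le_rfl (measurable_levelIndex y N) hPtop
  refine ⟨T, ⟨fun k => nrm_one_le_of_ae_eq_setAverage (measurable_levelIndex y N) hPm hPd
    (fun i => ?_) (hT k), fun k => nrm_top_le_of_ae_eq_setAverage (hT k)⟩, ?_⟩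
  · rw [hP]
    rcases lt_or_ge i (N * N) with hi | hi
    · exact Or.inr (measure_mono fun s hs => ⟨hs, hi⟩)
    · exact Or.inl (measure_mono_null (fun s hs => hs.2.not_ge hi) measure_empty)
  · have hnull : ∀ᵐ s ∂halfLine, ∀ i, halfLine (P i) = 0 → s ∉ levelSet y N i := by
      refine ae_all_iff.2 fun i => eventually_imp_distrib_left.2 fun hi => ?_
      exact measure_eq_zero_iff_ae_notMem.1 (hP i ▸ hi)
    filter_upwards [hnull, hT x] with s hs hTs
    rw [hTs]
    rcases lt_or_ge (levelIndex y N s) (N * N) with hlt | hge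
    · refine (convex_Ici _).set_average_mem isClosed_Ici (fun h₀ => hs _ h₀ ⟨rfl, hlt⟩)
        (hPtop _).ne ?_ (integrableOn_of_mem_sum x.2 (hPtop _))
      filter_upwards [ae_restrict_mem (hPm _), ae_restrict_of_ae hx] with r hr hr₀
      exact (hPD _ hr).le.trans_eq (abs_of_nonneg hr₀)
    · rw [levelValue_eq_zero hge]
      exact integral_nonneg_of_ae (Measure.ae_smul_measure (ae_restrict_of_ae hx) _)

theorem abs_levelValue_le (hN : 0 < N) (s : ℝ) : |levelValue N (levelIndex y N s)| ≤ |y s| := by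
  rw [abs_of_nonneg (levelValue_nonneg _ _)]
  rcases lt_or_ge (levelIndex y N s) (N * N) with hlt | hge
  · exact (levelValue_lt hN hlt le_rfl).le
  · exact (levelValue_eq_zero hge).trans_le (abs_nonneg _)

theorem tendsto_levelValue (y : L0) (s : ℝ) :
    Tendsto (fun n : ℕ => levelValue (n + 1) (levelIndex y (n + 1) s)) atTop (𝓝 |y s|) := by
  have hlower : Tendsto (fun n : ℕ => |y s| - 2 / ((n + 1 : ℕ) : ℝ)) atTop (𝓝 (|y s| - 0)) :=
    tendsto_const_nhds.sub ((tendsto_const_div_atTop_nhds_zero_nat 2).comp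
      (tendsto_add_atTop_nat 1))
  rw [sub_zero] at hlower
  refine tendsto_of_tendsto_of_tendsto_of_le_of_le' hlower tendsto_const_nhds ?_
    (Eventually.of_forall fun n => (le_abs_self _).trans (abs_levelValue_le n.succ_pos s))
  obtain ⟨M, hM⟩ := exists_nat_ge (max s |y s|)
  filter_upwards [eventually_ge_atTop M] with n hn
  have hMn : max s |y s| ≤ (n + 1 : ℕ) := hM.trans (Nat.cast_le.2 (hn.trans n.le_succ))
  exact le_levelValue n.succ_pos ((le_max_left _ _).trans hMn) ((le_max_right _ _).trans hMn)

theorem inOrbit_of_distribution_le_of_nonneg {x y : coupleL.sum}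
    (hx : ∀ᵐ s ∂halfLine, 0 ≤ (x : L0) s)
    (h : ∀ c : ℝ, 0 ≤ c → halfLine {s | c < |(y : L0) s|} ≤ halfLine {s | c < |(x : L0) s|}) :
    InOrbit coupleL coupleL x y := by
  choose T hT hTx using fun n : ℕ => exists_isContraction_levelValue_le hx n.succ_pos h
  exact inOrbit_of_approx (w := fun n s => levelValue (n + 1) (levelIndex y (n + 1) s))
    isFunctionCouple_coupleL hT y.2
    (fun n => ((measurable_from_top (f := levelValue (n + 1))).comp
      (measurable_levelIndex y (n + 1))).aestronglyMeasurable) hTx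
    (fun n => Eventually.of_forall fun s => abs_levelValue_le n.succ_pos s)
    (Eventually.of_forall fun s => tendsto_levelValue y s)

theorem inOrbit_of_distribution_le {x y : coupleL.sum}
    (h : ∀ c : ℝ, 0 ≤ c → halfLine {s | c < |(y : L0) s|} ≤ halfLine {s | c < |(x : L0) s|}) :
    InOrbit coupleL coupleL x y := by
  have habs := inOrbit_abs isFunctionCouple_coupleL x
  refine habs.trans habs.mem_sum (inOrbit_of_distribution_le_of_nonneg ?_ fun c hc => ?_)
  · exact (AEEqFun.coeFn_abs (x : L0)).mono fun s hs => hs ▸ abs_nonneg _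
  · refine (h c hc).trans_eq (measure_congr ?_)
    filter_upwards [AEEqFun.coeFn_abs (x : L0)] with s hs
    exact congrArg (fun r => c < r) (by rw [hs, abs_abs])

end Transfer

section Rearrangement

/-- The decreasing rearrangement `x*` of `x`, with values in `[0, ∞]`. -/
def rearr (x : L0) (s : ℝ) : ℝ≥0∞ :=
  sInf {c : ℝ≥0∞ | halfLine {y | c < ‖x y‖ₑ} ≤ ENNReal.ofReal s}

theorem antitone_rearr (x : L0) : Antitone (rearr x) := fun _ _ hst =>
  sInf_le_sInf fun _ hc => le_trans hc (ENNReal.ofReal_le_ofReal hst)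

theorem exists_lt_halfLine_lt_enorm {x : L0} {c m : ℝ≥0∞} (h : m < halfLine {y | c < ‖x y‖ₑ}) :
    ∃ d, c < d ∧ m < halfLine {y | d < ‖x y‖ₑ} := by
  have hc : c < ∞ := by
    rw [lt_top_iff_ne_top]
    rintro rfl
    simp at h
  obtain ⟨v, hv, hvc, hvlim⟩ := exists_seq_strictAnti_tendsto' hc
  have hunion : {y | c < ‖x y‖ₑ} = ⋃ n, {y | v n < ‖x y‖ₑ} := Subset.antisymm
    (fun y hy => mem_iUnion.2 (hvlim.eventually (gt_mem_nhds hy)).exists)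
    (iUnion_subset fun n y hy => (hvc n).1.trans hy)
  have hmono : Monotone fun n => {y | v n < ‖x y‖ₑ} := fun i j hij y hy =>
    (hv.antitone hij).trans_lt hy
  rw [hunion, hmono.measure_iUnion] at h
  obtain ⟨n, hn⟩ := lt_iSup_iff.1 h
  exact ⟨v n, (hvc n).1, hn⟩

theorem lt_rearr_iff {x : L0} {c : ℝ≥0∞} {s : ℝ} :
    c < rearr x s ↔ ENNReal.ofReal s < halfLine {y | c < ‖x y‖ₑ} := by
  refine ⟨fun h => lt_of_not_ge fun hle => (sInf_le hle : rearr x s ≤ c).not_gt h, fun h => ?_⟩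
  obtain ⟨d, hcd, hd⟩ := exists_lt_halfLine_lt_enorm h
  refine hcd.trans_le (le_sInf fun e he => le_of_not_gt fun hed => he.not_gt (hd.trans_le ?_))
  exact measure_mono fun y hy => hed.trans hy

theorem halfLine_setOf_ofReal_lt (d : ℝ≥0∞) : halfLine {s | ENNReal.ofReal s < d} = d := by
  rcases eq_or_ne d ∞ with rfl | hd
  · simp
  have h : {s | ENNReal.ofReal s < d} ∩ Ioi 0 = Ioo 0 d.toReal := by
    ext s
    rw [mem_inter_iff, mem_Ioo, and_comm]
    exact and_congr_right fun hs => ENNReal.ofReal_lt_iff_lt_toReal (le_of_lt hs) hd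
  rw [Measure.restrict_apply (measurableSet_lt ENNReal.measurable_ofReal measurable_const), h,
    Real.volume_Ioo, sub_zero, ENNReal.ofReal_toReal hd]

theorem halfLine_lt_rearr (x : L0) (c : ℝ≥0∞) :
    halfLine {s | c < rearr x s} = halfLine {y | c < ‖x y‖ₑ} := by
  simp only [lt_rearr_iff]
  exact halfLine_setOf_ofReal_lt _

theorem lintegral_enorm_add_sub_le (a b : L0) :
    ∫⁻ s, (‖(a + b : L0) s‖ₑ - (lebesgue ∞).nrm b) ∂halfLine ≤ (lebesgue 1).nrm a := by
  rw [nrm_one_eq]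
  refine lintegral_mono_ae ?_
  filter_upwards [ae_enorm_add_le a b] with s hs
  exact tsub_le_iff_right.2 hs

theorem rearr_lt_top {x : L0} (hx : x ∈ coupleL.sum) {s : ℝ} (hs : 0 < s) : rearr x s < ∞ := by
  obtain ⟨a, ha, b, hb, rfl⟩ := Submodule.mem_sup.1 hx
  have hs₀ : ENNReal.ofReal s ≠ 0 := (ENNReal.ofReal_pos.2 hs).ne'
  set β := (lebesgue ∞).nrm b
  set ε := ((lebesgue 1).nrm a + 1) / ENNReal.ofReal s with hε
  have hε₀ : ε ≠ 0 := ENNReal.div_ne_zero.2 ⟨by simp, ENNReal.ofReal_ne_top⟩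
  have hεtop : ε ≠ ∞ :=
    ENNReal.div_ne_top (ENNReal.add_lt_top.2 ⟨ha, ENNReal.one_lt_top⟩).ne hs₀
  suffices h : halfLine {y | β + ε < ‖(a + b : L0) y‖ₑ} ≤ ENNReal.ofReal s from
    (sInf_le h : rearr (a + b) s ≤ β + ε).trans_lt (ENNReal.add_lt_top.2 ⟨hb, hεtop.lt_top⟩)
  calc halfLine {y | β + ε < ‖(a + b : L0) y‖ₑ}
      ≤ halfLine {y | ε ≤ ‖(a + b : L0) y‖ₑ - β} := measure_mono fun y hy =>
        ENNReal.le_sub_of_add_le_left hb.ne (le_of_lt hy)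
    _ ≤ (∫⁻ s, (‖(a + b : L0) s‖ₑ - β) ∂halfLine) / ε :=
        meas_ge_le_lintegral_div ((a + b : L0).measurable.enorm.sub_const _).aemeasurable hε₀ hεtop
    _ ≤ ENNReal.ofReal s := by
        refine ENNReal.div_le_of_le_mul ((lintegral_enorm_add_sub_le a b).trans ?_)
        rw [hε, ENNReal.mul_div_cancel hs₀ ENNReal.ofReal_ne_top]
        exact le_self_add

theorem ae_rearr_lt_top {x : L0} (hx : x ∈ coupleL.sum) : ∀ᵐ s ∂halfLine, rearr x s < ∞ :=
  ae_halfLine_of_forall_pos fun _ hs => rearr_lt_top hx hs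

theorem lintegral_sub_const_eq_lintegral_distribution {α : Type*} [MeasurableSpace α]
    {μ : Measure α} {F : α → ℝ≥0∞} (hF : Measurable F) (hF_top : ∀ᵐ s ∂μ, F s < ∞) (c : ℝ≥0∞) :
    ∫⁻ s, (F s - c) ∂μ = ∫⁻ t in Ioi (0 : ℝ), μ {s | ENNReal.ofReal t + c < F s} := by
  have hsub : ∀ᵐ s ∂μ, F s - c ≠ ∞ := hF_top.mono fun s hs => (tsub_le_self.trans_lt hs).ne
  calc ∫⁻ s, (F s - c) ∂μ = ∫⁻ s, ENNReal.ofReal (F s - c).toReal ∂μ :=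
        lintegral_congr_ae (hsub.mono fun s hs => (ENNReal.ofReal_toReal hs).symm)
    _ = ∫⁻ t in Ioi (0 : ℝ), μ {s | t < (F s - c).toReal} :=
        lintegral_eq_lintegral_meas_lt μ (Eventually.of_forall fun _ => ENNReal.toReal_nonneg)
          (hF.sub_const c).ennreal_toReal.aemeasurable
    _ = ∫⁻ t in Ioi (0 : ℝ), μ {s | ENNReal.ofReal t + c < F s} := by
        refine setLIntegral_congr_fun measurableSet_Ioi fun t ht => measure_congr ?_
        filter_upwards [hsub] with s hs
        refine propext ?_
        change t < (F s - c).toReal ↔ ENNReal.ofReal t + c < F s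
        rw [← ENNReal.ofReal_lt_iff_lt_toReal (le_of_lt ht) hs, lt_tsub_iff_right]

theorem lintegral_rearr_sub {x : L0} (hx : x ∈ coupleL.sum) (c : ℝ≥0∞) :
    ∫⁻ s, (rearr x s - c) ∂halfLine = ∫⁻ s, (‖x s‖ₑ - c) ∂halfLine := by
  rw [lintegral_sub_const_eq_lintegral_distribution (antitone_rearr x).measurable
      (ae_rearr_lt_top hx),
    lintegral_sub_const_eq_lintegral_distribution x.measurable.enorm
      (Eventually.of_forall fun _ => enorm_lt_top)]
  simp only [halfLine_lt_rearr]

/-- The decreasing rearrangement as an element of `L0`. -/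
def rearrFun (x : L0) : L0 :=
  AEEqFun.mk (fun s => (rearr x s).toReal)
    (antitone_rearr x).measurable.ennreal_toReal.aestronglyMeasurable

theorem rearrFun_ae (x : L0) : rearrFun x =ᵐ[halfLine] fun s => (rearr x s).toReal :=
  AEEqFun.coeFn_mk _ _

theorem rearrFun_mem_coupleTildeL_sum {x : L0} (hx : x ∈ coupleL.sum) :
    rearrFun x ∈ coupleTildeL.sum := by
  have henorm : ∀ᵐ s ∂halfLine, ‖rearrFun x s‖ₑ ≤ rearr x s := by
    filter_upwards [rearrFun_ae x] with s hs
    rw [hs, Real.enorm_of_nonneg ENNReal.toReal_nonneg]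
    exact ENNReal.ofReal_toReal_le
  obtain ⟨a, ha, b, hb, heq⟩ := Submodule.mem_sup.1 hx
  refine mem_coupleTildeL_sum_of_antitone (antitone_rearr x) henorm hb ?_
  rw [lintegral_rearr_sub hx, ← heq]
  exact (lintegral_enorm_add_sub_le a b).trans_lt ha

theorem distribution_rearrFun {x : L0} (hx : x ∈ coupleL.sum) {c : ℝ} (hc : 0 ≤ c) :
    halfLine {s | c < |rearrFun x s|} = halfLine {s | c < |x s|} :=
  calc halfLine {s | c < |rearrFun x s|} = halfLine {s | ENNReal.ofReal c < rearr x s} := by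
        refine measure_congr ?_
        filter_upwards [rearrFun_ae x, ae_rearr_lt_top hx] with s hs hfin
        refine propext ?_
        change c < |rearrFun x s| ↔ ENNReal.ofReal c < rearr x s
        rw [hs, abs_of_nonneg ENNReal.toReal_nonneg, ENNReal.ofReal_lt_iff_lt_toReal hc hfin.ne]
    _ = halfLine {s | ENNReal.ofReal c < ‖x s‖ₑ} := halfLine_lt_rearr x _
    _ = halfLine {s | c < |x s|} := by
        simp only [Real.enorm_eq_ofReal_abs, ENNReal.ofReal_lt_ofReal_iff_of_nonneg hc]

end Rearrangement

section KFunctional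

variable {V : Type*} [AddCommGroup V] [Module ℝ V] {X : BanachCouple V}

theorem BanachCouple.K_le {t : ℝ≥0} {x₀ x₁ : V} (h₀ : X.X₀.nrm x₀ < ∞) (h₁ : X.X₁.nrm x₁ < ∞) :
    X.K t (x₀ + x₁) ≤ X.X₀.nrm x₀ + t * X.X₁.nrm x₁ :=
  iInf_le_of_le x₀ <| iInf_le_of_le x₁ <| iInf_le_of_le h₀ <| iInf_le_of_le h₁ <|
    iInf_le_of_le rfl le_rfl

theorem BanachCouple.le_K {t : ℝ≥0} {x : V} {C : ℝ≥0∞}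
    (h : ∀ x₀ x₁, x₀ + x₁ = x → C ≤ X.X₀.nrm x₀ + t * X.X₁.nrm x₁) : C ≤ X.K t x :=
  le_iInf fun x₀ => le_iInf fun x₁ => le_iInf fun _ => le_iInf fun _ => le_iInf fun heq =>
    h x₀ x₁ heq

theorem setLIntegral_Ioc_eq_lintegral_sub_add {q : ℝ → ℝ≥0∞} (hq : Antitone q) (t : ℝ≥0) :
    ∫⁻ s in Ioc (0 : ℝ) t, q s ∂halfLine = ∫⁻ s, (q s - q t) ∂halfLine + t * q t := by
  have hsub : ∫⁻ s, (q s - q t) ∂halfLine = ∫⁻ s in Ioc (0 : ℝ) t, (q s - q t) ∂halfLine := by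
    have hsupport : Function.support (fun s => q s - q t) ⊆ Iic (t : ℝ) := fun s hs =>
      le_of_not_gt fun hts => hs (tsub_eq_zero_of_le (hq hts.le))
    rw [← setLIntegral_eq_of_support_subset hsupport]
    refine setLIntegral_congr ?_
    filter_upwards [ae_restrict_mem measurableSet_Ioi] with s hs
    exact propext ⟨fun hst => ⟨hs, hst⟩, fun hst => hst.2⟩
  have hconst : t * q t = ∫⁻ _ in Ioc (0 : ℝ) t, q t ∂halfLine := by
    rw [setLIntegral_const, halfLine_Ioc le_rfl, sub_zero, ENNReal.ofReal_coe_nnreal, mul_comm]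
  rw [hsub, hconst, ← lintegral_add_right _ measurable_const]
  exact setLIntegral_congr_fun measurableSet_Ioc fun s hs => (tsub_add_cancel_of_le (hq hs.2)).symm

theorem setLIntegral_Ioc_le_lintegral_sub_add (q : ℝ → ℝ≥0∞) (t : ℝ≥0) (c : ℝ≥0∞) :
    ∫⁻ s in Ioc (0 : ℝ) t, q s ∂halfLine ≤ ∫⁻ s, (q s - c) ∂halfLine + t * c :=
  calc ∫⁻ s in Ioc (0 : ℝ) t, q s ∂halfLine ≤ ∫⁻ s in Ioc (0 : ℝ) t, ((q s - c) + c) ∂halfLine :=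
        lintegral_mono fun s => le_tsub_add
    _ = ∫⁻ s in Ioc (0 : ℝ) t, (q s - c) ∂halfLine + t * c := by
        rw [lintegral_add_right _ measurable_const, setLIntegral_const, halfLine_Ioc le_rfl,
          sub_zero, ENNReal.ofReal_coe_nnreal, mul_comm c]
    _ ≤ ∫⁻ s, (q s - c) ∂halfLine + t * c := by
        gcongr
        exact Measure.restrict_le_self

theorem K_le_setLIntegral_of_antitone {Y : BanachCouple L0} {q : ℝ → ℝ≥0∞} (hq : Antitone q)
    {t : ℝ≥0} (hqt : q t < ∞) (hfin : ∫⁻ s in Ioc (0 : ℝ) t, q s ∂halfLine < ∞) {x₀ x₁ : L0}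
    (h₀ : Y.X₀.nrm x₀ ≤ ∫⁻ s, (q s - q t) ∂halfLine) (h₁ : Y.X₁.nrm x₁ ≤ q t) :
    Y.K t (x₀ + x₁) ≤ ∫⁻ s in Ioc (0 : ℝ) t, q s ∂halfLine := by
  rw [setLIntegral_Ioc_eq_lintegral_sub_add hq] at hfin ⊢
  refine (BanachCouple.K_le (h₀.trans_lt (le_self_add.trans_lt hfin)) (h₁.trans_lt hqt)).trans ?_
  gcongr

theorem K_coupleL_le {x : L0} (hx : x ∈ coupleL.sum) {t : ℝ≥0} (ht : 0 < t) :
    coupleL.K t x ≤ ∫⁻ s in Ioc (0 : ℝ) t, rearr x s ∂halfLine := by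
  have hfin : ∀ s : ℝ, 0 < s → rearr x s < ∞ := fun s hs => rearr_lt_top hx hs
  obtain ⟨x₀, x₁, rfl, h₀, h₁⟩ := exists_truncation x (hfin t ht)
  refine K_le_setLIntegral_of_antitone (antitone_rearr _) (hfin t ht)
    (setLIntegral_ne_top_of_mem_sum (coupleTildeL_sum_le (rearrFun_mem_coupleTildeL_sum hx))
      (rearrFun_ae _) hfin t).lt_top ?_ h₁
  rw [lintegral_rearr_sub hx]
  exact (nrm_one_eq x₀).trans_le (lintegral_mono_ae h₀)

theorem le_K_coupleL {x : L0} (hx : x ∈ coupleL.sum) (t : ℝ≥0) :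
    ∫⁻ s in Ioc (0 : ℝ) t, rearr x s ∂halfLine ≤ coupleL.K t x := by
  refine BanachCouple.le_K fun x₀ x₁ heq => ?_
  refine (setLIntegral_Ioc_le_lintegral_sub_add _ t ((lebesgue ∞).nrm x₁)).trans ?_
  rw [lintegral_rearr_sub hx, ← heq]
  exact add_le_add_left (lintegral_enorm_add_sub_le x₀ x₁) _

theorem K_coupleTildeL_le {x : L0} (hx : x ∈ coupleTildeL.sum) {t : ℝ≥0} (ht : 0 < t) :
    coupleTildeL.K t x ≤ ∫⁻ s in Ioc (0 : ℝ) t, ldmE x s ∂halfLine := by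
  have hfin : ∀ s : ℝ, 0 < s → ldmE x s < ∞ := fun s hs => ldmE_lt_top hx hs
  obtain ⟨x₀, x₁, rfl, h₀, h₁⟩ := exists_truncation x (hfin t ht)
  exact K_le_setLIntegral_of_antitone (ldmE_antitone _) (hfin t ht)
    (setLIntegral_ne_top_of_mem_sum (ldm_mem_sum hx) (ldm_ae _) hfin t).lt_top
    (tildeNorm_le_lintegral_sub (ldmE_antitone _) h₀ (ae_le_ldmE _)) h₁

theorem le_K_coupleTildeL (x : L0) (t : ℝ≥0) :
    ∫⁻ s in Ioc (0 : ℝ) t, ldmE x s ∂halfLine ≤ coupleTildeL.K t x := by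
  refine BanachCouple.le_K fun x₀ x₁ heq => ?_
  refine (setLIntegral_Ioc_le_lintegral_sub_add _ t ((lebesgue ∞).nrm x₁)).trans ?_
  refine add_le_add_left (lintegral_mono fun s => ?_) _
  rw [tsub_le_iff_right, ← heq]
  exact (ldmE_add_le x₀ x₁ s).trans (by gcongr; exact ldmE_le_nrm_top x₁ s)

theorem setLIntegral_enorm_le_K_coupleL (x : L0) (t : ℝ≥0) :
    ∫⁻ s in Ioc (0 : ℝ) t, ‖x s‖ₑ ∂halfLine ≤ coupleL.K t x := by
  refine BanachCouple.le_K fun x₀ x₁ heq => ?_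
  refine (setLIntegral_Ioc_le_lintegral_sub_add _ t ((lebesgue ∞).nrm x₁)).trans ?_
  rw [← heq]
  exact add_le_add_left (lintegral_enorm_add_sub_le x₀ x₁) _

end KFunctional

section DyadicShift

/-- The number `n` such that `s` lies in the dyadic interval `(2 ^ (n - 1), 2 ^ n]`. -/
def dyadicIndex (s : ℝ) : ℤ := ⌈Real.logb 2 s⌉

/-- The dyadic interval with right end `2 ^ n`. -/
def dyadicIoc (n : ℤ) : Set ℝ := Ioc (2 ^ (n - 1)) (2 ^ n)

theorem measurable_dyadicIndex : Measurable dyadicIndex :=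
  Int.measurable_ceil.comp (Real.measurable_log.div_const _)

theorem mem_dyadicIoc_dyadicIndex {s : ℝ} (hs : 0 < s) : s ∈ dyadicIoc (dyadicIndex s) := by
  have hclog : dyadicIndex s = Int.clog 2 s := mod_cast Real.ceil_logb_natCast (b := 2) hs.le
  rw [hclog]
  exact ⟨mod_cast Int.zpow_pred_clog_lt_self one_lt_two hs,
    mod_cast Int.self_le_zpow_clog one_lt_two s⟩

theorem pairwise_disjoint_dyadicIoc : Pairwise (Function.onFun Disjoint dyadicIoc) :=
  (zpow_right_mono₀ (one_le_two (α := ℝ))).pairwise_disjoint_on_Ioc_pred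

theorem halfLine_dyadicIoc (n : ℤ) : halfLine (dyadicIoc n) = ENNReal.ofReal (2 ^ (n - 1)) := by
  rw [dyadicIoc, halfLine_Ioc (by positivity), zpow_sub_one₀ two_ne_zero]
  congr 1
  ring

theorem halfLine_dyadicIoc_lt_top (n : ℤ) : halfLine (dyadicIoc n) < ∞ :=
  halfLine_Ioc_lt_top _ _

theorem antitone_indicator_Iic (a : ℝ) (c : ℝ≥0∞) : Antitone ((Iic a).indicator fun _ => c) := by
  intro s t hst
  by_cases ht : t ∈ Iic a
  · rw [indicator_of_mem ht, indicator_of_mem (mem_Iic.2 (hst.trans ht))]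
  · rw [indicator_of_notMem ht]
    exact zero_le

-- `2 ^ (n + 1)` is four times the length of `dyadicIoc n`; this is the source of the constant `4`.
theorem lintegral_indicator_setLAverage_dyadicIoc (n : ℤ) (f : ℝ → ℝ≥0∞) :
    ∫⁻ s, (Iic ((2 : ℝ) ^ (n + 1))).indicator (fun _ => ⨍⁻ y in dyadicIoc n, f y ∂halfLine) s
      ∂halfLine = 4 * ∫⁻ y in dyadicIoc n, f y ∂halfLine := by
  have hlength : halfLine (Iic ((2 : ℝ) ^ (n + 1))) = 4 * halfLine (dyadicIoc n) := by
    rw [halfLine_Iic, halfLine_dyadicIoc, ← ENNReal.ofReal_ofNat,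
      ← ENNReal.ofReal_mul (by norm_num), zpow_add_one₀ two_ne_zero, zpow_sub_one₀ two_ne_zero]
    congr 1
    ring
  rw [lintegral_indicator measurableSet_Iic, setLIntegral_const, hlength, mul_comm, mul_assoc,
    measure_mul_setLAverage _ (halfLine_dyadicIoc_lt_top n).ne]

theorem tildeNorm_le_of_ae_eq_dyadicShift {w h : L0}
    (hw : w =ᵐ[halfLine] fun s => ⨍ y in dyadicIoc (dyadicIndex s - 1), h y ∂halfLine) :
    tildeNorm w ≤ 4 * (lebesgue 1).nrm h := by
  set c : ℤ → ℝ≥0∞ := fun n => ⨍⁻ y in dyadicIoc n, ‖h y‖ₑ ∂halfLine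
  set q : ℝ → ℝ≥0∞ := fun s => ∑' n, (Iic ((2 : ℝ) ^ (n + 1))).indicator (fun _ => c n) s
  have hq : Antitone q := fun s t hst =>
    ENNReal.tsum_le_tsum fun n => antitone_indicator_Iic _ (c n) hst
  have hwq : ∀ᵐ s ∂halfLine, ‖w s‖ₑ ≤ q s := by
    filter_upwards [hw, ae_restrict_mem measurableSet_Ioi] with s hs hs₀
    have hmem : s ∈ Iic ((2 : ℝ) ^ (dyadicIndex s - 1 + 1)) := by
      rw [sub_add_cancel]
      exact (mem_dyadicIoc_dyadicIndex hs₀).2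
    calc ‖w s‖ₑ ≤ c (dyadicIndex s - 1) := hs ▸ enorm_setAverage_le _ h
      _ = (Iic ((2 : ℝ) ^ (dyadicIndex s - 1 + 1))).indicator
          (fun _ => c (dyadicIndex s - 1)) s := by rw [indicator_of_mem hmem]
      _ ≤ q s := ENNReal.le_tsum (dyadicIndex s - 1)
  calc tildeNorm w ≤ ∫⁻ s, q s ∂halfLine := tildeNorm_le_of_antitoneOn (hq.antitoneOn _) hwq
    _ = 4 * ∫⁻ y in ⋃ n, dyadicIoc n, ‖h y‖ₑ ∂halfLine := by
        rw [lintegral_tsum fun n => (measurable_const.indicator measurableSet_Iic).aemeasurable]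
        simp only [c, lintegral_indicator_setLAverage_dyadicIoc]
        rw [ENNReal.tsum_mul_left, lintegral_iUnion (s := dyadicIoc) (fun n => measurableSet_Ioc)
          pairwise_disjoint_dyadicIoc]
    _ ≤ 4 * (lebesgue 1).nrm h := by
        gcongr
        exact setLIntegral_le_nrm_one h _

theorem ae_enorm_le_of_ae_eq_dyadicShift {g w : L0} (hg : g ∈ coupleTildeL.sum)
    (hw : w =ᵐ[halfLine] fun s => ⨍ y in dyadicIoc (dyadicIndex s - 1), ldm g y ∂halfLine) :
    ∀ᵐ s ∂halfLine, ‖g s‖ₑ ≤ ‖w s‖ₑ := by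
  filter_upwards [hw, ae_le_ldmE g, ae_restrict_mem measurableSet_Ioi] with s hws hgs hs
  have hP := halfLine_dyadicIoc_lt_top (dyadicIndex s - 1)
  have hP₀ : halfLine (dyadicIoc (dyadicIndex s - 1)) ≠ 0 := by
    rw [halfLine_dyadicIoc, Ne, ENNReal.ofReal_eq_zero, not_le]
    positivity
  have hfin := ldmE_lt_top hg hs
  have hle : (ldmE g s).toReal ≤ w s := by
    rw [hws]
    refine (convex_Ici _).set_average_mem isClosed_Ici hP₀ hP.ne ?_
      (integrableOn_of_mem_sum (ldm_mem_sum hg) hP)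
    filter_upwards [ae_restrict_of_ae (ldm_ae g), ae_restrict_mem measurableSet_Ioc] with y hy hmem
    have hy₀ : 0 < y := (zpow_pos two_pos _).trans hmem.1
    rw [mem_Ici, hy]
    exact ENNReal.toReal_mono (ldmE_lt_top hg hy₀).ne
      (ldmE_antitone g (hmem.2.trans (mem_dyadicIoc_dyadicIndex hs).1.le))
  calc ‖g s‖ₑ ≤ ldmE g s := hgs
    _ = ENNReal.ofReal (ldmE g s).toReal := (ENNReal.ofReal_toReal hfin.ne).symm
    _ ≤ ENNReal.ofReal (w s) := ENNReal.ofReal_le_ofReal hle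
    _ ≤ ‖w s‖ₑ := Real.ofReal_le_enorm _

theorem isMajorantConstant_four : IsMajorantConstant 4 := by
  intro g
  obtain ⟨T, hT⟩ := exists_stepOperator (X := coupleL) le_rfl
    (measurable_dyadicIndex.sub_const 1) halfLine_dyadicIoc_lt_top
  obtain ⟨S, hSg, hS⟩ := exists_multiplier
    (ae_enorm_le_of_ae_eq_dyadicShift g.2 (hT (majorant g)))
  obtain ⟨M, hM, hMS⟩ := exists_coupleMap_of_nrm_le (X := coupleL) (Y := coupleTildeL) (c := 4)
    (T := S.comp T)
    (fun h => (isFunctionCouple_coupleTildeL.mono _ _ (hS _)).trans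
      (tildeNorm_le_of_ae_eq_dyadicShift (hT _)))
    (fun h => (isFunctionCouple_coupleTildeL.mono_top (hS _)).trans
      ((nrm_top_le_of_ae_eq_setAverage (hT _)).trans
        (le_mul_of_one_le_left zero_le (by norm_num))))
  exact ⟨M, hM, Subtype.ext ((hMS _).trans hSg)⟩

end DyadicShift

section RelativePairs

theorem inOrbit_of_setLIntegral_le_K (f : coupleTildeL.sum) {q : ℝ → ℝ≥0∞} (hq : Antitone q)
    (hqf : ∀ s, 0 < s → q s < ∞) {v : L0} (hv : v ∈ coupleTildeL.sum)
    (hvq : v =ᵐ[halfLine] fun s => (q s).toReal)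
    (h : ∀ t : ℝ≥0, 0 < t → ∫⁻ s in Ioc (0 : ℝ) t, q s ∂halfLine ≤ coupleTildeL.K t f) :
    InOrbit coupleTildeL coupleTildeL f v := by
  refine (inOrbit_ldm f).trans (ldm_mem_coupleTildeL_sum f.2) ?_
  refine inOrbit_of_antitone isFunctionCouple_coupleTildeL averagingContracts_coupleTildeL
    (ldmE_antitone f) hq (fun s hs => ldmE_lt_top f.2 hs) hqf hv (ldm_ae f) hvq fun t ht => ?_
  lift t to ℝ≥0 using ht.le
  exact (h t ht).trans (K_coupleTildeL_le f.2 ht)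

theorem ae_enorm_le_enorm_ldm (g : coupleTildeL.sum) :
    ∀ᵐ s ∂halfLine, ‖(g : L0) s‖ₑ ≤ ‖ldm g s‖ₑ := by
  filter_upwards [ldm_ae g, ae_le_ldmE g, ae_halfLine_of_forall_pos fun s => ldmE_lt_top g.2]
    with s hs hle hfin
  rwa [hs, Real.enorm_toReal hfin.ne]

theorem isExactCouple_coupleTildeL : IsExactCouple coupleTildeL := by
  intro f g hK
  have hfg : InOrbit coupleTildeL coupleTildeL f (ldm g) :=
    inOrbit_of_setLIntegral_le_K f (ldmE_antitone g) (fun s hs => ldmE_lt_top g.2 hs)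
      (ldm_mem_coupleTildeL_sum g.2) (ldm_ae g) fun t ht => (le_K_coupleTildeL _ t).trans (hK t ht)
  exact (hfg.trans hfg.mem_sum
    (inOrbit_of_ae_le isFunctionCouple_coupleTildeL _ (ae_enorm_le_enorm_ldm g))).exists_coupleMap

theorem inOrbit_coupleTildeL_coupleL (f : coupleTildeL.sum) : InOrbit coupleTildeL coupleL f f :=
  ⟨coupleTildeL.sum.subtype, ⟨fun _ => nrm_one_le_tildeNorm _, fun _ => le_rfl⟩, rfl⟩

theorem isExactRelativePair_coupleTildeL_coupleL : IsExactRelativePair coupleTildeL coupleL := by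
  intro f g hK
  have hfg : InOrbit coupleTildeL coupleTildeL f (rearrFun g) :=
    inOrbit_of_setLIntegral_le_K f (antitone_rearr g) (fun s hs => rearr_lt_top g.2 hs)
      (rearrFun_mem_coupleTildeL_sum g.2) (rearrFun_ae g)
      fun t ht => (le_K_coupleL g.2 t).trans (hK t ht)
  have hfg' : InOrbit coupleTildeL coupleL f (rearrFun g) :=
    hfg.trans hfg.mem_sum (inOrbit_coupleTildeL_coupleL _)
  exact (hfg'.trans hfg'.mem_sum
    (inOrbit_of_distribution_le fun c hc => (distribution_rearrFun g.2 hc).ge)).exists_coupleMap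

theorem isUniformRelativePair_of_isMajorantConstant {m : ℝ≥0} (hm : IsMajorantConstant m) :
    IsUniformRelativePair m coupleL coupleTildeL := by
  intro x g hK
  have hx : rearrFun x ∈ coupleL.sum := coupleTildeL_sum_le (rearrFun_mem_coupleTildeL_sum x.2)
  have hxr : InOrbit coupleL coupleL x (rearrFun x) :=
    inOrbit_of_distribution_le (y := ⟨rearrFun x, hx⟩)
      fun c hc => (distribution_rearrFun x.2 hc).le
  have hrg : InOrbit coupleL coupleL ⟨rearrFun x, hx⟩ (majorant g : L0) := by
    refine inOrbit_of_antitone isFunctionCouple_coupleL averagingContracts_coupleL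
      (antitone_rearr x) (ldmE_antitone g) (fun s hs => rearr_lt_top x.2 hs)
      (fun s hs => ldmE_lt_top g.2 hs) (ldm_mem_sum g.2) (rearrFun_ae x) (ldm_ae g) fun t ht => ?_
    lift t to ℝ≥0 using ht.le
    exact ((le_K_coupleTildeL _ t).trans (hK t ht)).trans (K_coupleL_le x.2 ht)
  obtain ⟨M, hM, hMg⟩ := hm g
  exact hMg ▸ (hxr.trans hx hrg).exists_coupleMap_comp hM

end RelativePairs

section TwoStep

/-- The indicator function of `(a, b]`. -/
def indIoc (a b : ℝ) : L0 :=
  AEEqFun.mk ((Ioc a b).indicator fun _ => (1 : ℝ))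
    (measurable_const.indicator measurableSet_Ioc).aestronglyMeasurable

theorem indIoc_ae (a b : ℝ) : indIoc a b =ᵐ[halfLine] (Ioc a b).indicator fun _ => (1 : ℝ) :=
  AEEqFun.coeFn_mk _ _

theorem nrm_one_indIoc (a b : ℝ) : (lebesgue 1).nrm (indIoc a b) = halfLine (Ioc a b) := by
  rw [nrm_one_eq, ← lintegral_indicator_one measurableSet_Ioc]
  refine lintegral_congr_ae ((indIoc_ae a b).mono fun s hs => ?_)
  change ‖indIoc a b s‖ₑ = _
  rw [hs, enorm_indicator_eq_indicator_enorm, enorm_one]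
  rfl

/-- `1_{(a, b]}` as an element of `L¹ + L^∞`. -/
def indSum (a b : ℝ) : coupleL.sum :=
  coupleL.incl₀ ⟨indIoc a b, (nrm_one_indIoc a b).trans_lt (halfLine_Ioc_lt_top a b)⟩

theorem indIoc_mem_sum (a b : ℝ) : indIoc a b ∈ coupleL.sum := (indSum a b).2

theorem indIoc_add_indIoc {a b c : ℝ} (hab : a ≤ b) (hbc : b ≤ c) :
    indIoc a b + indIoc b c = indIoc a c := by
  refine AEEqFun.ext ?_
  filter_upwards [AEEqFun.coeFn_add (indIoc a b) (indIoc b c), indIoc_ae a b, indIoc_ae b c,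
    indIoc_ae a c] with s hadd h₁ h₂ h
  rw [hadd, Pi.add_apply, h₁, h₂, h, ← Ioc_union_Ioc_eq_Ioc hab hbc,
    indicator_union_of_disjoint (Ioc_disjoint_Ioc_of_le le_rfl)]

theorem nrm_top_indIoc_le_one (a b : ℝ) : (lebesgue ∞).nrm (indIoc a b) ≤ 1 := by
  refine nrm_top_le ((indIoc_ae a b).mono fun s hs => ?_)
  rw [hs, enorm_indicator_eq_indicator_enorm, enorm_one]
  exact indicator_le_self' (fun _ _ => zero_le) s

theorem setIntegral_indIoc_self (a b : ℝ) :
    ∫ s in Ioc a b, indIoc a b s ∂halfLine = halfLine.real (Ioc a b) := by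
  rw [integral_congr_ae (ae_restrict_of_ae (indIoc_ae a b)),
    setIntegral_indicator measurableSet_Ioc, inter_self, setIntegral_one_eq_measureReal]

theorem setIntegral_indIoc_of_disjoint {a b : ℝ} {P : Set ℝ} (h : Disjoint P (Ioc a b)) :
    ∫ s in P, indIoc a b s ∂halfLine = 0 := by
  rw [integral_congr_ae (ae_restrict_of_ae (indIoc_ae a b)),
    setIntegral_indicator measurableSet_Ioc, h.inter_eq, setIntegral_empty]

/-- The function `2 · 1_{(0, 1]} + 1_{(1, 3]}`. -/
def twoStep : L0 := (2 : ℝ) • indIoc 0 1 + indIoc 1 3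

theorem setIntegral_twoStep {P : Set ℝ} (hP : halfLine P < ∞) :
    ∫ s in P, twoStep s ∂halfLine =
      2 * ∫ s in P, indIoc 0 1 s ∂halfLine + ∫ s in P, indIoc 1 3 s ∂halfLine := by
  rw [twoStep, setIntegral_add_of_mem_sum hP
    (coupleL.sum.smul_mem 2 (indIoc_mem_sum 0 1)) (indIoc_mem_sum 1 3), setIntegral_const_smul]

theorem setIntegral_twoStep_zero_one : ∫ s in Ioc (0 : ℝ) 1, twoStep s ∂halfLine = 2 := by
  rw [setIntegral_twoStep (halfLine_Ioc_lt_top 0 1), setIntegral_indIoc_self,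
    setIntegral_indIoc_of_disjoint (Ioc_disjoint_Ioc_of_le le_rfl), measureReal_def,
    halfLine_Ioc le_rfl]
  norm_num

theorem setIntegral_twoStep_one_three : ∫ s in Ioc (1 : ℝ) 3, twoStep s ∂halfLine = 2 := by
  rw [setIntegral_twoStep (halfLine_Ioc_lt_top 1 3), setIntegral_indIoc_self,
    setIntegral_indIoc_of_disjoint (Ioc_disjoint_Ioc_of_le le_rfl).symm, measureReal_def,
    halfLine_Ioc zero_le_one]
  norm_num

/-- The decreasing function that represents `twoStep` on all of `(0, ∞)`. -/
def twoStepE : ℝ → ℝ≥0∞ := (Iic 1).indicator (fun _ => 1) + (Iic 3).indicator (fun _ => 1)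

theorem antitone_twoStepE : Antitone twoStepE :=
  (antitone_indicator_Iic 1 1).add (antitone_indicator_Iic 3 1)

theorem twoStepE_le_two (s : ℝ) : twoStepE s ≤ 2 := by
  rw [twoStepE, ← one_add_one_eq_two]
  exact add_le_add (indicator_le_self' (fun _ _ => zero_le) s)
    (indicator_le_self' (fun _ _ => zero_le) s)

theorem twoStep_ae : twoStep =ᵐ[halfLine] fun s => (twoStepE s).toReal := by
  filter_upwards [AEEqFun.coeFn_add ((2 : ℝ) • indIoc 0 1) (indIoc 1 3),
    AEEqFun.coeFn_smul (2 : ℝ) (indIoc 0 1), indIoc_ae 0 1, indIoc_ae 1 3,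
    ae_restrict_mem measurableSet_Ioi] with s hadd hsmul h₀ h₁ hs
  rw [mem_Ioi] at hs
  rw [twoStep, hadd, Pi.add_apply, hsmul, Pi.smul_apply, h₀, h₁, twoStepE, Pi.add_apply]
  rcases le_or_gt s 1 with hs₁ | hs₁
  · have hs₃ : s ≤ 3 := by linarith
    norm_num [indicator, hs, hs₁, hs₃, hs₁.not_gt]
  · rcases le_or_gt s 3 with hs₃ | hs₃
    · simp [indicator, hs₁, hs₃, hs₁.not_ge]
    · simp [indicator, hs₁.not_ge, hs₃.not_ge]

theorem enorm_twoStep_ae : ∀ᵐ s ∂halfLine, ‖twoStep s‖ₑ = twoStepE s := by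
  filter_upwards [twoStep_ae] with s hs
  rw [hs, Real.enorm_toReal ((twoStepE_le_two s).trans_lt ENNReal.ofNat_lt_top).ne]

theorem ldmE_ae_eq_of_antitone {f : L0} {q : ℝ → ℝ≥0∞} (hq : Antitone q)
    (hfq : ∀ᵐ s ∂halfLine, ‖f s‖ₑ = q s) : ldmE f =ᵐ[halfLine] q := by
  filter_upwards [hfq, ae_le_ldmE f, ae_restrict_mem measurableSet_Ioi] with s hs hle hs₀
  exact (ldmE_le_of_antitoneOn (hq.antitoneOn _) (hfq.mono fun _ h => h.le) hs₀).antisymm (hs ▸ hle)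

theorem ldm_twoStep : ldm twoStep = twoStep := by
  refine AEEqFun.ext ?_
  filter_upwards [ldm_ae twoStep, ldmE_ae_eq_of_antitone antitone_twoStepE enorm_twoStep_ae,
    twoStep_ae] with s hldm hldmE hs
  rw [hldm, hldmE, hs]

theorem tildeNorm_twoStep_lt_top : tildeNorm twoStep < ∞ := by
  calc tildeNorm twoStep ≤ ∫⁻ s, twoStepE s ∂halfLine :=
        tildeNorm_le_of_antitoneOn (antitone_twoStepE.antitoneOn _)
          (enorm_twoStep_ae.mono fun _ h => h.le)
    _ = halfLine (Iic 1) + halfLine (Iic 3) := by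
        simp only [twoStepE, Pi.add_apply]
        rw [lintegral_add_left (measurable_const.indicator measurableSet_Iic),
          lintegral_indicator_const measurableSet_Iic, lintegral_indicator_const measurableSet_Iic,
          one_mul, one_mul]
    _ < ∞ := ENNReal.add_lt_top.2 ⟨halfLine_Iic_lt_top 1, halfLine_Iic_lt_top 3⟩

theorem nrm_top_twoStep_lt_top : (lebesgue ∞).nrm twoStep < ∞ :=
  (nrm_top_le (enorm_twoStep_ae.mono fun s hs => hs.trans_le (twoStepE_le_two s))).trans_lt
    ENNReal.ofNat_lt_top

/-- `twoStep` as an element of `L̃¹ + L^∞`. -/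
def twoStepSum : coupleTildeL.sum := coupleTildeL.incl₀ ⟨twoStep, tildeNorm_twoStep_lt_top⟩

theorem majorant_twoStepSum : majorant twoStepSum = (2 : ℝ) • indSum 0 1 + indSum 1 3 :=
  Subtype.ext ldm_twoStep

theorem setIntegral_le_of_setLIntegral_le {f : L0} {P : Set ℝ} {C : ℝ≥0}
    (h : ∫⁻ s in P, ‖f s‖ₑ ∂halfLine ≤ C) : ∫ s in P, f s ∂halfLine ≤ C := by
  have hnorm : ‖∫ s in P, f s ∂halfLine‖ₑ ≤ C := (enorm_integral_le_lintegral_enorm _).trans h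
  exact (Real.le_norm_self _).trans (mod_cast hnorm)

theorem halfLine_Iic_mul_setLIntegral_le (f : L0) {a b : ℝ} (hab : a ≤ b) :
    halfLine (Iic b) * ∫⁻ s in Ioc a b, ‖f s‖ₑ ∂halfLine ≤
      halfLine (Ioc a b) * tildeNorm f := by
  set J := ∫⁻ s in Ioc a b, ‖f s‖ₑ ∂halfLine
  have hJ : J ≤ halfLine (Ioc a b) * ldmE f a := by
    rw [mul_comm, ← setLIntegral_const]
    refine setLIntegral_mono_ae aemeasurable_const ?_
    exact (ae_le_ldmE f).mono fun s hs hmem => hs.trans (ldmE_antitone f hmem.1.le)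
  have hbefore : halfLine (Iic a) * ldmE f a ≤ ∫⁻ s in Iic a, ldmE f s ∂halfLine := by
    rw [mul_comm, ← setLIntegral_const]
    exact setLIntegral_mono (measurable_ldmE f) fun s hs => ldmE_antitone f hs
  have hon : J ≤ ∫⁻ s in Ioc a b, ldmE f s ∂halfLine :=
    lintegral_mono_ae (ae_restrict_of_ae (ae_le_ldmE f))
  have hdisj : Disjoint (Iic a) (Ioc a b) := Iic_disjoint_Ioc le_rfl
  calc halfLine (Iic b) * J = halfLine (Iic a) * J + halfLine (Ioc a b) * J := by
        rw [← add_mul, ← measure_union hdisj measurableSet_Ioc, Iic_union_Ioc_eq_Iic hab]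
    _ ≤ halfLine (Iic a) * (halfLine (Ioc a b) * ldmE f a) + halfLine (Ioc a b) * J := by gcongr
    _ = halfLine (Ioc a b) * (halfLine (Iic a) * ldmE f a + J) := by ring
    _ ≤ halfLine (Ioc a b) *
        (∫⁻ s in Iic a, ldmE f s ∂halfLine + ∫⁻ s in Ioc a b, ldmE f s ∂halfLine) := by gcongr
    _ ≤ halfLine (Ioc a b) * tildeNorm f := by
        rw [← lintegral_union measurableSet_Ioc hdisj]
        gcongr
        exact setLIntegral_le_lintegral _ _

theorem setIntegral_add_le_of_nrm_top_le {A B : L0} (hA : A ∈ coupleL.sum) (hB : B ∈ coupleL.sum)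
    {n : ℝ≥0} (h : (lebesgue ∞).nrm (A + B) ≤ n) :
    ∫ s in Ioc (0 : ℝ) 1, A s ∂halfLine + ∫ s in Ioc (0 : ℝ) 1, B s ∂halfLine ≤ n := by
  rw [← setIntegral_add_of_mem_sum (halfLine_Ioc_lt_top 0 1) hA hB]
  refine setIntegral_le_of_setLIntegral_le ?_
  calc ∫⁻ s in Ioc (0 : ℝ) 1, ‖(A + B : L0) s‖ₑ ∂halfLine
      ≤ ∫⁻ _ in Ioc (0 : ℝ) 1, (n : ℝ≥0∞) ∂halfLine :=
        lintegral_mono_ae (ae_restrict_of_ae ((ae_le_nrm_top _).mono fun _ hs => hs.trans h))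
    _ = n := by
        rw [setLIntegral_const, halfLine_Ioc le_rfl, sub_zero, ENNReal.ofReal_one, mul_one]

theorem setIntegral_zero_one_add_one_three_le {A : L0} (hA : A ∈ coupleL.sum) {n : ℝ≥0}
    (h : (lebesgue 1).nrm A ≤ n) :
    ∫ s in Ioc (0 : ℝ) 1, A s ∂halfLine + ∫ s in Ioc (1 : ℝ) 3, A s ∂halfLine ≤ n := by
  rw [← setIntegral_union (Ioc_disjoint_Ioc_of_le le_rfl) measurableSet_Ioc
    (integrableOn_of_mem_sum hA (halfLine_Ioc_lt_top 0 1))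
    (integrableOn_of_mem_sum hA (halfLine_Ioc_lt_top 1 3))]
  exact setIntegral_le_of_setLIntegral_le ((setLIntegral_le_nrm_one A _).trans h)

theorem three_mul_setIntegral_one_three_le {B : L0} {c : ℝ≥0} (h : tildeNorm B ≤ c) :
    3 * ∫ s in Ioc (1 : ℝ) 3, B s ∂halfLine ≤ 2 * c := by
  have hle : 3 * ∫⁻ s in Ioc (1 : ℝ) 3, ‖B s‖ₑ ∂halfLine ≤ 2 * c := by
    have h₃ : halfLine (Iic (3 : ℝ)) = 3 := by rw [halfLine_Iic, ENNReal.ofReal_ofNat]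
    have h₂ : halfLine (Ioc (1 : ℝ) 3) = 2 := by
      rw [halfLine_Ioc zero_le_one]
      norm_num
    calc 3 * ∫⁻ s in Ioc (1 : ℝ) 3, ‖B s‖ₑ ∂halfLine ≤ 2 * tildeNorm B :=
          h₃ ▸ h₂ ▸ halfLine_Iic_mul_setLIntegral_le B (by norm_num : (1 : ℝ) ≤ 3)
      _ ≤ 2 * c := by gcongr
  have hreal := setIntegral_le_of_setLIntegral_le (f := B) (P := Ioc (1 : ℝ) 3) (C := 2 * c / 3) (by
    push_cast
    rw [ENNReal.le_div_iff_mul_le (by simp) (by simp), mul_comm]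
    exact hle)
  push_cast at hreal
  linarith

theorem nine_eighths_le_of_smul_add_eq_twoStep {A B : L0} {n : ℝ≥0}
    (hAB : (2 : ℝ) • A + B = twoStep) (hA : (lebesgue 1).nrm A ≤ n)
    (hB : tildeNorm B ≤ (2 * n : ℝ≥0)) (hsum : (lebesgue ∞).nrm (A + B) ≤ n) :
    (9 / 8 : ℝ) ≤ n := by
  have hA' : A ∈ coupleL.sum := Submodule.mem_sup_left (hA.trans_lt ENNReal.coe_lt_top)
  have hB' : B ∈ coupleL.sum := coupleTildeL_sum_le
    (Submodule.mem_sup_left (hB.trans_lt ENNReal.coe_lt_top))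
  have hstep : ∀ {P : Set ℝ}, halfLine P < ∞ →
      2 * ∫ s in P, A s ∂halfLine + ∫ s in P, B s ∂halfLine = ∫ s in P, twoStep s ∂halfLine :=
    fun hP => by
      rw [← hAB, setIntegral_add_of_mem_sum hP (coupleL.sum.smul_mem 2 hA') hB',
        setIntegral_const_smul]
  have h₀₁ := hstep (halfLine_Ioc_lt_top 0 1)
  have h₁₃ := hstep (halfLine_Ioc_lt_top 1 3)
  rw [setIntegral_twoStep_zero_one] at h₀₁
  rw [setIntegral_twoStep_one_three] at h₁₃
  have htop := setIntegral_add_le_of_nrm_top_le hA' hB' hsum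
  have hone := setIntegral_zero_one_add_one_three_le hA' hA
  have htilde := three_mul_setIntegral_one_three_le hB
  push_cast at htilde
  linarith

theorem nine_eighths_le_norm (M : CoupleMap coupleL coupleTildeL)
    (hM : M.toLin (majorant twoStepSum) = twoStepSum) : 9 / 8 ≤ M.norm := by
  rcases eq_or_ne M.norm ∞ with htop | htop
  · exact htop ▸ le_top
  obtain ⟨n, hn⟩ : ∃ n : ℝ≥0, (n : ℝ≥0∞) = M.norm := ⟨_, ENNReal.coe_toNNReal htop⟩
  have hAB : (2 : ℝ) • (M.toLin (indSum 0 1) : L0) + M.toLin (indSum 1 3) = twoStep := by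
    rw [majorant_twoStepSum, map_add, map_smul] at hM
    exact congrArg Subtype.val hM
  have hA : tildeNorm (M.toLin (indSum 0 1)) ≤ n := by
    refine (M.nrm₀_le hn.ge _).trans_eq ?_
    change n * (lebesgue 1).nrm (indIoc 0 1) = n
    rw [nrm_one_indIoc, halfLine_Ioc le_rfl, sub_zero, ENNReal.ofReal_one, mul_one]
  have hB : tildeNorm (M.toLin (indSum 1 3)) ≤ (2 * n : ℝ≥0) := by
    refine (M.nrm₀_le hn.ge _).trans_eq ?_
    change n * (lebesgue 1).nrm (indIoc 1 3) = (2 * n : ℝ≥0)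
    rw [nrm_one_indIoc, halfLine_Ioc zero_le_one, mul_comm]
    norm_num
  have hsum : (lebesgue ∞).nrm (M.toLin (indSum 0 1) + M.toLin (indSum 1 3) : L0) ≤ n := by
    have hadd : indSum 0 1 + indSum 1 3 = indSum 0 3 :=
      Subtype.ext (indIoc_add_indIoc zero_le_one (by norm_num))
    rw [← Submodule.coe_add, ← map_add, hadd]
    exact (M.nrm₁_le hn.ge ⟨indIoc 0 3,
      (nrm_top_indIoc_le_one 0 3).trans_lt ENNReal.one_lt_top⟩).trans
      (mul_le_of_le_one_right zero_le (nrm_top_indIoc_le_one 0 3))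
  have hfinal := nine_eighths_le_of_smul_add_eq_twoStep hAB ((nrm_one_le_tildeNorm _).trans hA)
    hB hsum
  rw [← hn, ENNReal.div_le_iff (by norm_num) (by norm_num)]
  rw [div_le_iff₀ (by norm_num)] at hfinal
  exact mod_cast hfinal

theorem not_isExactRelativePair : ¬ IsExactRelativePair coupleL coupleTildeL := by
  intro h
  obtain ⟨M, hM, hMg⟩ := h (majorant twoStepSum) twoStepSum fun t ht => by
    calc coupleTildeL.K t twoStep ≤ ∫⁻ s in Ioc (0 : ℝ) t, ldmE twoStep s ∂halfLine :=
          K_coupleTildeL_le twoStepSum.2 ht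
      _ = ∫⁻ s in Ioc (0 : ℝ) t, ‖ldm twoStep s‖ₑ ∂halfLine := by
          refine lintegral_congr_ae (ae_restrict_of_ae ?_)
          rw [ldm_twoStep]
          exact (ldmE_ae_eq_of_antitone antitone_twoStepE enorm_twoStep_ae).trans
            (enorm_twoStep_ae.mono fun _ hs => hs.symm)
      _ ≤ coupleL.K t (majorant twoStepSum) := setLIntegral_enorm_le_K_coupleL _ t
  have hle : (9 / 8 : ℝ≥0∞) ≤ 1 := (nine_eighths_le_norm M hMg).trans hM
  rw [ENNReal.div_le_iff (by norm_num) (by norm_num)] at hle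
  norm_num at hle

end TwoStep

end

end CalderonMityagin

theorem theorem3p1 :
    -- `m = 4` is an admissible constant
    IsMajorantConstant 4 ∧
    ∀ m : NNReal, IsMajorantConstant m →
      -- (a)
      IsExactCouple coupleTildeL ∧
      -- (b)
      IsExactRelativePair coupleTildeL coupleL ∧
      -- (c)
      IsUniformRelativePair m coupleL coupleTildeL ∧
      -- (d), with the quantitative form of the failure
      ¬ IsExactRelativePair coupleL coupleTildeL ∧
      ∃ g : coupleTildeL.sum, (g : L0) ∈ tildeL1.carrier ⊓ (lebesgue ⊤).carrier ∧
        ∀ M : CoupleMap coupleL coupleTildeL, M.toLin (majorant g) = g → 9 / 8 ≤ M.norm := by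
  exact ⟨isMajorantConstant_four, fun m hm => ⟨isExactCouple_coupleTildeL,
    isExactRelativePair_coupleTildeL_coupleL, isUniformRelativePair_of_isMajorantConstant hm,
    not_isExactRelativePair, twoStepSum, ⟨tildeNorm_twoStep_lt_top, nrm_top_twoStep_lt_top⟩,
    nine_eighths_le_norm⟩⟩
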